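/- **Setting.** There are $N\ge 2$ agents and $K\ge 2$ arms with Bernoulli rewards of means $1>\mu_1>\mu_2\ge\dots\ge\mu_K\ge 0$; put $\Delta_j=\mu_1-\mu_j$. Let $P$ be an $N\times N$ row-stochastic matrix. Let $(B_t)_{t\in\mathbb N}$ be non-negative and non-decreasing, $\varepsilon>0$, and $$A_x=\max\left(\min\{t\in\mathbb N:B_t\ge x\},\lceil(1+x)^{1+\varepsilon}\rceil\right)\ (x\ge 0),\qquad A_{-1}=0,\qquad A^{-1}(x)=\sup\{y\in\mathbb N:A_y\le x\}.$$ Assume: * (A.1) for all $i\ne j$ there is a path $i=k_1,\dots,k_l=j$ with $P(k_1,k_2)\cdots P(k_{l-1},k_l)>0$; * (A.2) for every $D>0$, $B_t\ge D\log t$ for all large $t$; $A_{\lfloor\lambda x+(1-\lambda)y\rfloor}\le\lambda A_x+(1-\lambda)A_y$ for all $x,y\in\mathbb N$, $\lambda\in[0,1]$; and $\sum_{l\ge2}A_{2l}/A_{l-1}^3<\infty$; * (A.3) $\sum_{x\ge1}A_{A_x}e^{-\kappa(A_x-A_{x-1})}<\infty$ for some $\kappa>0$. **Algorithm** (parameters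 $\alpha,\delta$). Put $q=\lceil K/N\rceil$. Agent $i$ has the sticky set $\widehat S^{(i)}=\{(((i-1)q+m)\bmod K)+1:0\le m<q\}$ and initially the two further arms $U_0^{(i)}=(iq\bmod K)+1$ and $L_0^{(i)}=((iq+1)\bmod K)+1$; $S_j^{(i)}=\widehat S^{(i)}\cup\{U_j^{(i)},L_j^{(i)}\}$. The length $\mathcal P_j^{(i)}$ of its phase $j\ge0$ is Poisson with mean $(1+\frac\delta2)(A_j-A_{j-1})$; phase $j$ consists of the slots $t$ with $\sum_{y<j}\mathcal P^{(i)}_y<t\le\sum_{y\le j}\mathcal P^{(i)}_y$ (a phase of length $0$ is completed at once). In slot $t$ of phase $j$ it pulls an arm of $S_j^{(i)}$ that maximises $\widehat\mu_l^{(i)}(t-1)+\sqrt{\alpha\ln t/T_l^{(i)}(t-1)}$, where $T^{(i)}_l$ and $\widehat\mu^{(i)}_l$ are the number of its pulls of arm $l$ and their empirical mean, and the index is $\infty$ if $T_l^{(i)}(t-1)=0$. At the end of phase $j$, in slot $t$, it calls an agent $m\sim P(i,\cdot)$, who returns the arm $\mathcal O$ of its playing set that $m$ played most in the phase before the phase of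 $m$ containing $t$ (an arbitrary arm of $S^{(m)}_0$ if $m$ is in phase $0$). If $\mathcal O\in S_j^{(i)}$, nothing changes; otherwise $U_{j+1}^{(i)}$ is whichever of $U_j^{(i)},L_j^{(i)}$ agent $i$ played more in phase $j$, and $L_{j+1}^{(i)}=\mathcal O$. Ties are broken by an arbitrary deterministic rule. Rewards, calls and phase lengths are independent. The regret is $R_T^{(i)}=\sum_{t=1}^T(\mu_1-\mu_{I_t^{(i)}})$, with $I_t^{(i)}$ the arm pulled in slot $t$. **Spreading time.** $\tau_{spr}^{(P)}$ is the first time at which all nodes have a rumor that initially only node $1$ has, when in each step every node $j$ without the rumor independently calls a node with law $P(j,\cdot)$ and obtains the rumor if the called node has it. **Theorem.** Let $\alpha>3$ and let $\delta>0$ be such that for some $D>0$, $c(\delta)\ge\frac54D$ and $3+2\delta+\ln(4+2\delta)\ge\frac54D^{-1}$, where $$c(\delta)=\min\left(\tfrac\delta2+\ln(1+\tfrac\delta2),\ (1+\delta)\ln\tfrac{2+2\delta}{2+\delta}-\tfrac\delta2\right).$$ Let $\omega>0$ and $x_0\in\mathbb N$ be such that $A_x-A_{x-1}\ge A_{x-1}^{\omega}$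 for all $x\ge x_0$. Then for every agent $i$ and every $T\in\mathbb N$, $$\mathbb E[R_T^{(i)}]\le\left(\sum_{j=2}^{\min(K,\lceil K/N\rceil+2)}\frac1{\Delta_j}\right)4\alpha\ln T+\frac K4+(1+\delta)\,\mathbb E\left[A_{2\lfloor2+\delta\rfloor\tau_{spr}^{(P)}}\right]+\widehat g_1+N\widehat g_2$$ (for $T=0$ the logarithmic term is read as $0$), where, in $[0,\infty]$, $$\widehat g_1=2(1+\delta)\left(A_{2\lceil2+\delta\rceil j^*}+\frac2{2\alpha-3}\sum_{l\ge3}\frac{A_{2l}}{A_{l-1}^3}+2\sum_{x\ge\lceil j^*/2\rceil}(A_{4\lceil2+\delta\rceil x})^{2(2\alpha-6)+2}e^{-c(\delta)(A_{x+1}-A_x)}\right),$$ $$\widehat g_2=2\left(A_{x_0}^2e^{-c(\delta)(A_{x_0}-A_{x_0-1})}+\sum_{x\ge1}A_xe^{-c(\delta)A_x^{\omega}}\right)+\frac1{c(\delta)}+(1+\delta)\left(2\sum_{x\ge1}A_{A_x}e^{-c(\delta)(A_x-A_{x-1})}+N\sum_{t\ge1}e^{-(3+2\delta+\ln(4+2\delta))A^{-1}(t)}\right),$$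 $$j^*=2\max\left(A^{-1}\left(\left(N\tbinom K2(\lceil\tfrac KN\rceil+1)\right)^{\frac1{2\alpha-6}}\right)+1,\ \min\left\{j\in\mathbb N:\ \frac{A_{j'}-A_{j'-1}}{2+\lceil K/N\rceil}\ge1+\frac{4\alpha\log A_{j'}}{\Delta_2^2}\ \text{ for all }j'\ge j\right\}\right).$$ -/

import Mathlib

open MeasureTheory ProbabilityTheory
open scoped ENNReal NNReal

noncomputable section

namespace GossipBandit

/-! ### The communication sequence -/

/-- The reparametrised budget `A_x = max (min {t : B_t ≥ x}) ⌈(1 + x)^(1 + ε)⌉`. -/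
def commSeq (B : ℕ → ℝ) (ε : ℝ) (x : ℕ) : ℕ :=
  max (sInf {t : ℕ | (x : ℝ) ≤ B t}) ⌈(1 + (x : ℝ)) ^ (1 + ε)⌉₊

/-- The value `A_{x-1}`, with the convention `A_{-1} = 0`. -/
def prevVal (A : ℕ → ℕ) : ℕ → ℕ
  | 0 => 0
  | x + 1 => A x

/-- The increment `A_x - A_{x-1}`, with the convention `A_{-1} = 0`. -/
def incr (A : ℕ → ℕ) (x : ℕ) : ℝ := (A x : ℝ) - (prevVal A x : ℝ)

/-- `A⁻¹(x) = sup {y : A_y ≤ x}`. -/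
def invSeq (A : ℕ → ℕ) (x : ℝ) : ℕ := sSup {y : ℕ | (A y : ℝ) ≤ x}

/-! ### Assumptions on the inputs -/

/-- `P` is a gossip matrix: every row is a probability distribution. -/
def IsGossipMatrix {N : ℕ} (P : Matrix (Fin N) (Fin N) ℝ) : Prop :=
  (∀ i j, 0 ≤ P i j) ∧ ∀ i, ∑ j, P i j = 1

/-- (A.1): any two distinct agents are joined by a directed path of positive entries of `P`. -/
def AssumptionA1 {N : ℕ} (P : Matrix (Fin N) (Fin N) ℝ) : Prop :=
  ∀ i j, i ≠ j → Relation.TransGen (fun a b => 0 < P a b) i j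

/-- (A.2): the budget grows faster than any multiple of the logarithm, the sequence `A` is
convex, and `∑_{l ≥ 2} A_{2l} / A_{l-1}^3` converges. -/
structure AssumptionA2 (B : ℕ → ℝ) (ε : ℝ) : Prop where
  log_growth : ∀ D : ℝ, 0 < D → ∃ t₀ : ℕ, ∀ t : ℕ, t₀ ≤ t → D * Real.log t ≤ B t
  convex : ∀ (x y : ℕ) (r : ℝ), 0 ≤ r → r ≤ 1 →
    (commSeq B ε ⌊r * x + (1 - r) * y⌋₊ : ℝ) ≤ r * commSeq B ε x + (1 - r) * commSeq B ε y
  summable : Summable fun l : ℕ =>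
    (commSeq B ε (2 * (l + 2)) : ℝ) / (commSeq B ε (l + 1) : ℝ) ^ 3

/-- (A.3): `∑_{x ≥ 1} A_{A_x} exp (-κ (A_x - A_{x-1}))` converges for some `κ > 0`. -/
def AssumptionA3 (B : ℕ → ℝ) (ε : ℝ) : Prop :=
  ∃ κ : ℝ, 0 < κ ∧ Summable fun x : ℕ =>
    (commSeq B ε (commSeq B ε (x + 1)) : ℝ) * Real.exp (-κ * incr (commSeq B ε) (x + 1))

/-- The arm means, in decreasing order with a unique best arm; arm `1` of the informal
description is `0 : Fin K`. -/
structure IsArmMeans {K : ℕ} [NeZero K] (μ : Fin K → ℝ) : Prop where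
  lt_one : μ 0 < 1
  nonneg : ∀ k, 0 ≤ μ k
  anti : Antitone μ
  best : ∀ k, k ≠ 0 → μ k < μ 0

/-! ### The algorithm

Agents and arms are numbered from `0`. A time slot `t ≥ 1` belongs to phase `j` of an agent when
`t` lies in `(𝒫_0 + ⋯ + 𝒫_{j-1}, 𝒫_0 + ⋯ + 𝒫_j]`. A Poisson phase length can be `0`; such a phase
contains no time slot and is completed at the moment at which it starts. -/

/-- `⌈K / N⌉`. -/
def stickySize (N K : ℕ) : ℕ := ⌈(K : ℝ) / (N : ℝ)⌉₊

/-- The sticky set of agent `i`: `⌈K / N⌉` cyclically consecutive arms. -/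
def sticky {N K : ℕ} [NeZero K] (i : Fin N) : Finset (Fin K) :=
  (Finset.range (stickySize N K)).image fun m => Fin.ofNat K (i.val * stickySize N K + m)

/-- The last time slot of phase `j`, namely `𝒫_0 + ⋯ + 𝒫_j`. -/
def phaseEnd (len : ℕ → ℕ) (j : ℕ) : ℕ := ∑ y ∈ Finset.range (j + 1), len y

/-- The phase of time slot `t`. -/
def phaseOf (len : ℕ → ℕ) (t : ℕ) : ℕ := sInf {r : ℕ | t ≤ phaseEnd len r}

/-- Rules for breaking the ties in the three kinds of `argmax` of the algorithm: the arm pulled in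
a slot, the most played arm of a phase (the recommendation), and the non-sticky arm that is kept. -/
structure TieBreaking (N K : ℕ) where
  pull : Fin N → ℕ → Finset (Fin K) → Fin K
  advice : Fin N → ℕ → Finset (Fin K) → Fin K
  keep : Fin N → ℕ → Finset (Fin K) → Fin K
  pull_mem : ∀ i t s, s.Nonempty → pull i t s ∈ s
  advice_mem : ∀ i j s, s.Nonempty → advice i j s ∈ s
  keep_mem : ∀ i j s, s.Nonempty → keep i j s ∈ s

/-- One realisation of the randomness: `reward i k n` is the reward of the `(n+1)`-st pull of arm
`k` by agent `i`, `call i j` the agent called by `i` at the end of its phase `j`, and `len i j` the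
length of phase `j` of agent `i`. -/
structure Noise (N K : ℕ) where
  reward : Fin N → Fin K → ℕ → Bool
  call : Fin N → ℕ → Fin N
  len : Fin N → ℕ → ℕ

/-- The state of an agent: its current phase, its two non-sticky arms, the number of pulls of each
arm so far, the total reward of each arm so far, the number of pulls of each arm before the current
phase, and the arm it played most in its previous phase. -/
structure AgentState (K : ℕ) where
  phase : ℕ
  U : Fin K
  L : Fin K
  pulls : Fin K → ℕ
  wins : Fin K → ℕ
  pullsBefore : Fin K → ℕ
  advice : Fin K

/-- The maximisers of `f` on `s`. -/
def argmaxSet {α β : Type*} [LinearOrder β] (s : Finset α) (f : α → β) : Finset α :=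
  s.filter fun a => ∀ b ∈ s, f b ≤ f a

/-- The playing set, `Ŝ ∪ {U, L}`. -/
def playSet {N K : ℕ} [NeZero K] (i : Fin N) (s : AgentState K) : Finset (Fin K) :=
  sticky i ∪ {s.U, s.L}

/-- The UCB index of an arm in slot `t`, from the counts up to slot `t - 1`; it is infinite for an
arm that has not been pulled. -/
def ucbIndex {K : ℕ} (α : ℝ) (t : ℕ) (s : AgentState K) (k : Fin K) : EReal :=
  if s.pulls k = 0 then ⊤
  else (((s.wins k : ℝ) / s.pulls k + Real.sqrt (α * Real.log t / s.pulls k) : ℝ) : EReal)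

/-- The arm that agent `i` pulls in slot `t`, given its state after slot `t - 1`. -/
def pulledArm {N K : ℕ} [NeZero K] (α : ℝ) (tie : TieBreaking N K) (i : Fin N) (t : ℕ)
    (s : AgentState K) : Fin K :=
  tie.pull i t (argmaxSet (playSet i s) (ucbIndex α t s))

/-- The arm-pulling part of slot `t`. -/
def pullStep {N K : ℕ} [NeZero K] (α : ℝ) (tie : TieBreaking N K) (w : Noise N K) (i : Fin N)
    (t : ℕ) (s : AgentState K) : AgentState K :=
  let a := pulledArm α tie i t s
  { s with
    pulls := Function.update s.pulls a (s.pulls a + 1)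
    wins := Function.update s.wins a (s.wins a + (w.reward i a (s.pulls a)).toNat) }

/-- Completion of the current phase of agent `i`, which receives the recommendation `o`. -/
def finishPhase {N K : ℕ} [NeZero K] (tie : TieBreaking N K) (i : Fin N) (o : Fin K)
    (s : AgentState K) : AgentState K :=
  let plays : Fin K → ℕ := fun k => s.pulls k - s.pullsBefore k
  { s with
    phase := s.phase + 1
    U := if o ∈ playSet i s then s.U else tie.keep i s.phase (argmaxSet {s.U, s.L} plays)
    L := if o ∈ playSet i s then s.L else o
    pullsBefore := s.pulls
    advice := tie.advice i s.phase (argmaxSet (playSet i s) plays) }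

/-- The information-pulling part of slot `t`: every agent completes all its phases that end with
slot `t`. An agent that is called recommends the arm it played most in the phase before the phase
of slot `t`. -/
def commStep {N K : ℕ} [NeZero K] (tie : TieBreaking N K) (w : Noise N K) (t : ℕ)
    (σ : Fin N → AgentState K) (i : Fin N) : AgentState K :=
  (fun s => finishPhase tie i (σ (w.call i s.phase)).advice s)^[
    phaseOf (w.len i) (t + 1) - (σ i).phase] (σ i)

/-- The state at the start. An agent that is called during its phase `0`, when it has no previous
phase, recommends some arm of its initial playing set. -/
def initState {N K : ℕ} [NeZero K] (tie : TieBreaking N K) (i : Fin N) : AgentState K :=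
  let u : Fin K := Fin.ofNat K ((i.val + 1) * stickySize N K)
  let l : Fin K := Fin.ofNat K ((i.val + 1) * stickySize N K + 1)
  { phase := 0
    U := u
    L := l
    pulls := fun _ => 0
    wins := fun _ => 0
    pullsBefore := fun _ => 0
    advice := tie.advice i 0 (sticky i ∪ {u, l}) }

/-- The states of all agents after slot `t`. -/
def states {N K : ℕ} [NeZero K] (α : ℝ) (tie : TieBreaking N K) (w : Noise N K) :
    ℕ → Fin N → AgentState K
  | 0 => commStep tie w 0 (initState tie)
  | t + 1 => commStep tie w (t + 1) fun i => pullStep α tie w i (t + 1) (states α tie w t i)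

/-- The regret of agent `i` after `T` slots. -/
def regret {N K : ℕ} [NeZero K] (α : ℝ) (μ : Fin K → ℝ) (tie : TieBreaking N K) (w : Noise N K)
    (i : Fin N) (T : ℕ) : ℝ :=
  ∑ t ∈ Finset.range T, (μ 0 - μ (pulledArm α tie i (t + 1) (states α tie w t i)))

/-! ### The randomness -/

/-- All the basic random variables as one family of `ℕ`-valued random variables. -/
def basicVars {Ω : Type*} {N K : ℕ} (W : Ω → Noise N K) :
    (Fin N × Fin K × ℕ) ⊕ (Fin N × ℕ) ⊕ (Fin N × ℕ) → Ω → ℕ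
  | .inl p, ω => ((W ω).reward p.1 p.2.1 p.2.2).toNat
  | .inr (.inl p), ω => ((W ω).call p.1 p.2).val
  | .inr (.inr p), ω => (W ω).len p.1 p.2

/-- The basic random variables are independent, the rewards of arm `k` are Bernoulli with mean
`μ k`, the calls of agent `i` have law `P i ·`, and the lengths of phase `j` are Poisson with mean
`(1 + δ / 2) (A_j - A_{j-1})`. -/
structure IsPoissonNoise {Ω : Type*} [MeasurableSpace Ω] (Pr : Measure Ω) {N K : ℕ}
    (μ : Fin K → ℝ) (P : Matrix (Fin N) (Fin N) ℝ) (A : ℕ → ℕ) (δ : ℝ) (W : Ω → Noise N K) :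
    Prop where
  measurable : ∀ p, Measurable (basicVars W p)
  indep : iIndepFun (basicVars W) Pr
  reward_law : ∀ i k n, Pr {ω | (W ω).reward i k n = true} = ENNReal.ofReal (μ k)
  call_law : ∀ i j m, Pr {ω | (W ω).call i j = m} = ENNReal.ofReal (P i m)
  len_law : ∀ i j, Pr.map (fun ω => (W ω).len i j) =
    poissonMeasure (Real.toNNReal ((1 + δ / 2) * incr A j))

/-! ### Rumor spreading -/

/-- The calls of a pull rumor spreading process: node `j` calls `C n j` in step `n`, independently
over nodes and steps, with law `P j ·`. -/
structure IsPullCalls {Ω : Type*} [MeasurableSpace Ω] (Pr : Measure Ω) {N : ℕ}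
    (P : Matrix (Fin N) (Fin N) ℝ) (C : ℕ → Fin N → Ω → Fin N) : Prop where
  measurable : ∀ n j, Measurable (C n j)
  indep : iIndepFun (fun p : ℕ × Fin N => C p.1 p.2) Pr
  law : ∀ n j m, Pr {ω | C n j ω = m} = ENNReal.ofReal (P j m)

/-- The nodes that have the rumor after `n` steps; the first node has it initially. -/
def informed {N : ℕ} [NeZero N] (c : ℕ → Fin N → Fin N) : ℕ → Finset (Fin N)
  | 0 => {0}
  | n + 1 => informed c n ∪ Finset.univ.filter fun j => c n j ∈ informed c n

/-- The spreading time: the first time at which all nodes have the rumor. -/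
def spreadTime {N : ℕ} [NeZero N] (c : ℕ → Fin N → Fin N) : ℕ∞ :=
  ⨅ n ∈ {n : ℕ | informed c n = Finset.univ}, (n : ℕ∞)

/-- `A_{c τ}` for an extended natural number `τ`, with value `∞` at `τ = ∞`. -/
def seqAt (A : ℕ → ℕ) (c : ℕ) : ℕ∞ → ℝ≥0∞
  | ⊤ => ⊤
  | (n : ℕ) => (A (c * n) : ℝ≥0∞)

/-! ### The terms of the bound -/

/-- `c(δ)`. -/
def cDelta (δ : ℝ) : ℝ :=
  min (δ / 2 + Real.log (1 + δ / 2))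
    ((1 + δ) * Real.log ((2 + 2 * δ) / (2 + δ)) - δ / 2)

/-- The constant `3 + 2δ + ln (4 + 2δ)`. -/
def dDelta (δ : ℝ) : ℝ := 3 + 2 * δ + Real.log (4 + 2 * δ)

/-- The first phase from which on the phases are long enough for the UCB estimates; `gap` is the
gap `Δ_2` between the two best arms. -/
def longPhase (N K : ℕ) (α gap : ℝ) (A : ℕ → ℕ) : ℕ :=
  sInf {j : ℕ | ∀ j', j ≤ j' →
    1 + 4 * α * Real.log (A j') / gap ^ 2 ≤ incr A j' / (2 + (stickySize N K : ℝ))}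

/-- The phase `j*`. -/
def jStar (N K : ℕ) (α gap : ℝ) (A : ℕ → ℕ) : ℕ :=
  2 * max
    (invSeq A (((N : ℝ) * (K.choose 2 : ℝ) * ((stickySize N K : ℝ) + 1)) ^
      (1 / (2 * α - 6))) + 1)
    (longPhase N K α gap A)

/-- The collaborative UCB regret; only arms that exist enter the sum of the `1 / Δ_j`. -/
def ucbTerm (N : ℕ) {K : ℕ} [NeZero K] (α : ℝ) (μ : Fin K → ℝ) (T : ℕ) : ℝ :=
  (∑ k : Fin K with 1 ≤ k.val ∧ k.val ≤ stickySize N K + 1, 1 / (μ 0 - μ k)) *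
    (4 * α * Real.log T) + (K : ℝ) / 4

/-- The term `ĝ₁`, with values in `[0, ∞]`; `J` stands for `j*`. -/
def gOne (α δ : ℝ) (A : ℕ → ℕ) (J : ℕ) : ℝ≥0∞ :=
  ENNReal.ofReal (2 * (1 + δ)) *
    ((A (2 * ⌈2 + δ⌉₊ * J) : ℝ≥0∞)
      + ENNReal.ofReal (2 / (2 * α - 3)) *
          ∑' l : {l : ℕ // 3 ≤ l}, ENNReal.ofReal ((A (2 * l) : ℝ) / (A (l - 1) : ℝ) ^ 3)
      + 2 * ∑' x : {x : ℕ // ⌈(J : ℝ) / 2⌉₊ ≤ x},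
          ENNReal.ofReal ((A (4 * ⌈2 + δ⌉₊ * x) : ℝ) ^ (2 * (2 * α - 6) + 2) *
            Real.exp (-cDelta δ * incr A (x + 1))))

/-- The term `ĝ₂`, with values in `[0, ∞]`. -/
def gTwo (N : ℕ) (δ : ℝ) (A : ℕ → ℕ) (θ : ℝ) (x₀ : ℕ) : ℝ≥0∞ :=
  2 * (ENNReal.ofReal ((A x₀ : ℝ) ^ 2 * Real.exp (-cDelta δ * incr A x₀))
      + ∑' x : {x : ℕ // 1 ≤ x},
          ENNReal.ofReal ((A x : ℝ) * Real.exp (-cDelta δ * (A x : ℝ) ^ θ)))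
    + ENNReal.ofReal (1 / cDelta δ)
    + ENNReal.ofReal (1 + δ) *
        (2 * ∑' x : {x : ℕ // 1 ≤ x},
            ENNReal.ofReal ((A (A x) : ℝ) * Real.exp (-cDelta δ * incr A x))
          + (N : ℝ≥0∞) * ∑' t : {t : ℕ // 1 ≤ t},
            ENNReal.ofReal (Real.exp (-dDelta δ * (invSeq A ((t : ℕ) : ℝ) : ℝ))))

end GossipBandit

end

/-!
The regret of an agent has three sources (`regret_le`): the slots before its playing set is frozen
with the best arm in it, the slots in which a confidence bound is violated, and the regret of UCB on
the frozen playing set, which has at most `⌈K / N⌉ + 2` arms. The last source gives the logarithmic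
term, and Hoeffding's inequality bounds the expected number of slots of the second kind by `K / 4`
(`IsPoissonNoise.sum_prob_confFail`). What remains is the probability that the playing set is not
yet frozen at a given time.

This probability is compared with rumor spreading. The sticky set of the first agent contains the
best arm. In a phase that is long compared with the logarithm of the time at its end, an agent that
has the best arm plays it most, so it recommends this arm in its next phase and keeps it
(`good_phase`). Hence an agent that calls an informed agent is informed from the end of the
following phase on. To obtain exactly the law of the pull process although the agents change their
phases at random times of their own, one fixes deterministic times `v 0 ≤ v 1 ≤ …` and lets an agent
use in round `k` the call at the end of the phase in progress at time `v k` (`spreads_of_informed`).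
The indices of these phases are functions of the phase lengths, which are independent of the calls.
If they increase with `k`, each agent uses every call at most once, and the calls used are
distributed as in the pull process (`IsPoissonNoise.prob_not_informed_le`).

The times `v k` must leave room for the rest of the phase in progress and the next phase. The end of
phase `p` is compared with the lower envelope `lamS (δ / 2) * (A p - 2 * I)`, where `I` is an
increment of the budget sequence `A`, and two consecutive phases together are compared with a
multiple of their budgets. The slack is chosen such that each of these estimates fails with
probability at most `exp (-(cBar (δ / 2) * I))` (`IsLens.prob_not_typical`, `IsLens.prob_short`),
where `c(δ) ≤ cBar (δ / 2)`. The condition on `D` forces `δ ≥ 7 / 4`, and then, by the convexity of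
`A`, there is room for `(l - 1) / ⌊2 + δ⌋` rounds before the time `(1 + δ / 2) * A (2 * l - 2)`
(`exists_clock_of_block`).

So at such a time the playing set is frozen unless some phase lengths are not typical, or a late
confidence bound fails, or the pull process has not reached all nodes within
`(l - 1) / ⌊2 + δ⌋` steps (`IsPoissonNoise.prob_not_settled_le`). Summed over the blocks of slots
between `κ * A (2 * l - 2)` and `κ * A (2 * l)`, with a whole number `κ` between `1 + δ / 2` and
`1 + δ`, the three probabilities give the last sum and the second sum in `gOne`, and the spreading
term (`IsPoissonNoise.sum_prob_not_settled_le`). The slots before the first block and the first pull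
of each arm are covered by the first term of `gOne`.
-/

open MeasureTheory ProbabilityTheory
open scoped ENNReal NNReal

namespace GossipBandit

/-! ### Numerical constants -/

/-- A Padé upper bound for the logarithm. -/
lemma log_one_add_le_pade {z : ℝ} (hz : 0 ≤ z) :
    Real.log (1 + z) ≤ z * (6 + z) / (6 + 4 * z) := by
  have key : MonotoneOn (fun z : ℝ => z * (6 + z) / (6 + 4 * z) - Real.log (1 + z))
      (Set.Ici 0) := by
    have hd : ∀ x : ℝ, 0 ≤ x →
        HasDerivAt (fun z : ℝ => z * (6 + z) / (6 + 4 * z) - Real.log (1 + z))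
          (((1 * (6 + x) + x * 1) * (6 + 4 * x) - x * (6 + x) * (4 * 1)) / (6 + 4 * x) ^ 2
            - 1 / (1 + x)) x := by
      intro x hx
      refine HasDerivAt.sub (HasDerivAt.div ?_ ?_ (by positivity)) ?_
      · exact (hasDerivAt_id x).mul ((hasDerivAt_id x).const_add 6)
      · exact ((hasDerivAt_id x).const_mul 4).const_add 6
      · exact ((hasDerivAt_id x).const_add 1).log (by simp only [id]; positivity)
    refine monotoneOn_of_deriv_nonneg (convex_Ici 0) ?_ ?_ ?_
    · exact fun x hx => (hd x hx).continuousAt.continuousWithinAt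
    · intro x hx
      rw [interior_Ici] at hx
      exact (hd x (le_of_lt hx)).differentiableAt.differentiableWithinAt
    · intro x hx
      rw [interior_Ici] at hx
      have hx : 0 < x := hx
      rw [(hd x hx.le).deriv, div_sub_div _ _ (by positivity) (by positivity)]
      apply div_nonneg _ (by positivity)
      have : 0 ≤ x ^ 3 := by positivity
      nlinarith
  have := key (Set.mem_Ici.2 le_rfl) (Set.mem_Ici.2 hz) hz
  simpa using this

/-- A rational upper bound for `c(δ)`, as a function of `u = δ / 2`. -/
noncomputable def cBar (u : ℝ) : ℝ := u ^ 2 * (3 + 4 * u) / ((1 + u) * (6 + 10 * u))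

/-- The slope of the lower envelope of the phase end times: slightly less than `1 + u`, the mean
phase length per unit of budget. The difference `cBar u / 3` is large enough for
`lower_tail_param`. -/
noncomputable def lamS (u : ℝ) : ℝ := 1 + u - cBar u / 3

lemma cDelta_le_cBar {u : ℝ} (hu : 0 ≤ u) : cDelta (2 * u) ≤ cBar u := by
  refine (min_le_right _ _).trans ?_
  have h1 : (2 + 2 * (2 * u)) / (2 + 2 * u) = 1 + u / (1 + u) := by
    field_simp; ring
  rw [h1]
  have h2 := log_one_add_le_pade (z := u / (1 + u)) (by positivity)
  have h3 : u / (1 + u) * (6 + u / (1 + u)) / (6 + 4 * (u / (1 + u)))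
      = u * (6 + 7 * u) / ((1 + u) * (6 + 10 * u)) := by
    field_simp; ring
  rw [h3] at h2
  calc (1 + 2 * u) * Real.log (1 + u / (1 + u)) - 2 * u / 2
      ≤ (1 + 2 * u) * (u * (6 + 7 * u) / ((1 + u) * (6 + 10 * u))) - 2 * u / 2 := by gcongr
    _ = cBar u := by unfold cBar; field_simp; ring

lemma cBar_nonneg {u : ℝ} (hu : 0 ≤ u) : 0 ≤ cBar u := by unfold cBar; positivity

lemma cBar_pos {u : ℝ} (hu : 0 < u) : 0 < cBar u := by unfold cBar; positivity

lemma cBar_le_linear {u : ℝ} (hu : 0 ≤ u) : cBar u ≤ 2 / 5 * u := by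
  unfold cBar
  rw [div_le_iff₀ (by positivity)]
  nlinarith [mul_nonneg hu hu]

lemma lamS_lower {u : ℝ} (hu : 7 / 8 ≤ u) : 9 / 5 ≤ lamS u := by
  unfold lamS cBar
  rw [div_div, le_sub_iff_add_le, ← le_sub_iff_add_le', div_le_iff₀ (by positivity)]
  nlinarith [mul_nonneg (sub_nonneg.2 hu) (sub_nonneg.2 hu),
    mul_nonneg (mul_nonneg (sub_nonneg.2 hu) (sub_nonneg.2 hu)) (sub_nonneg.2 hu)]

lemma lamS_le {u : ℝ} (hu : 0 ≤ u) : lamS u ≤ 1 + u := by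
  unfold lamS; linarith [cBar_nonneg hu]

/-- The condition on `D` forces `δ ≥ 7 / 4`. -/
lemma delta_lower {δ : ℝ} (hδ : 0 < δ)
    (hδD : ∃ D : ℝ, 0 < D ∧ 5 / 4 * D ≤ cDelta δ ∧ 5 / 4 * D⁻¹ ≤ dDelta δ) : 7 / 4 ≤ δ := by
  obtain ⟨D, hD, h1, h2⟩ := hδD
  by_contra hlt
  push Not at hlt
  have hc : cDelta δ ≤ 0.18 := by
    have := cDelta_le_cBar (u := δ / 2) (by linarith)
    rw [show 2 * (δ / 2) = δ by ring] at this
    refine this.trans ?_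
    unfold cBar
    have hu : 0 < δ / 2 := by linarith
    have hu' : δ / 2 < 7 / 8 := by linarith
    set u := δ / 2
    rw [div_le_iff₀ (by positivity)]
    nlinarith [mul_pos hu hu, mul_pos (mul_pos hu hu) (sub_pos.2 hu'), mul_pos hu (sub_pos.2 hu')]
  have hd : dDelta δ ≤ 8.52 := by
    unfold dDelta
    have : Real.log (4 + 2 * δ) ≤ 2.02 := by
      rw [Real.log_le_iff_le_exp (by linarith)]
      have e1 : Real.exp 2.02 = Real.exp 1 * Real.exp 1 * Real.exp 0.02 := by
        rw [← Real.exp_add, ← Real.exp_add]; norm_num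
      have e2 := Real.exp_one_gt_d9
      have e3 : (1.02 : ℝ) ≤ Real.exp 0.02 := by
        have := Real.add_one_le_exp (0.02 : ℝ); linarith
      rw [e1]
      have : (7.38 : ℝ) ≤ Real.exp 1 * Real.exp 1 := by nlinarith
      nlinarith
    linarith
  have h3 : (5 / 4 * D) * (5 / 4 * D⁻¹) = 25 / 16 := by field_simp; norm_num
  have h4 : (5 / 4 * D) * (5 / 4 * D⁻¹) ≤ 0.18 * 8.52 := by
    apply mul_le_mul (h1.trans hc) (h2.trans hd) (by positivity) (by norm_num)
  rw [h3] at h4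
  norm_num at h4

/-- The parameter `s = cBar u / (2 * lamS u)` of the exponential lower tail bound for the phase end
times: the Poisson exponent `(1 + u) * (1 - exp (-s))` per unit of budget pays for the slope
`lamS u`, and a shift of the envelope by `2` units gains `2 * s * lamS u = cBar u`. -/
lemma lower_tail_param {u : ℝ} (hu : 7 / 8 ≤ u) :
    lamS u * (cBar u / (2 * lamS u)) ≤
      (1 + u) * (1 - Real.exp (-(cBar u / (2 * lamS u)))) := by
  have hL := lamS_lower hu
  have hc := cBar_pos (u := u) (by linarith)
  have hc2 := cBar_le_linear (u := u) (by linarith)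
  set s := cBar u / (2 * lamS u) with hs
  have hs0 : 0 < s := by positivity
  -- `exp (-s) ≤ 1 - s + s ^ 2 / 2`
  have h1 : Real.exp (-s) ≤ 1 - s + s ^ 2 / 2 := by
    have hq := Real.quadratic_le_exp_of_nonneg hs0.le
    rw [Real.exp_neg, inv_le_comm₀ (Real.exp_pos _) (by nlinarith [sq_nonneg (s - 1)])]
    refine le_trans ?_ hq
    rw [inv_le_iff_one_le_mul₀ (by nlinarith [sq_nonneg (s - 1)])]
    nlinarith [sq_nonneg s, mul_pos hs0 hs0, sq_nonneg (s ^ 2)]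
  have h2 : s * lamS u = cBar u / 2 := by rw [hs]; field_simp
  have h3 : lamS u = 1 + u - cBar u / 3 := rfl
  have h5 : (1 + u) * s / 2 ≤ cBar u / 3 := by
    have : (1 + u) * 3 ≤ 4 * lamS u := by rw [h3]; linarith
    nlinarith
  have h6 : lamS u ≤ (1 + u) * (1 - s / 2) := by rw [h3]; linarith
  calc lamS u * s ≤ (1 + u) * (1 - s / 2) * s := by gcongr
    _ = (1 + u) * (1 - (1 - s + s ^ 2 / 2)) := by ring
    _ ≤ _ := by gcongr

lemma exp_half_neg_le : Real.exp (-(1 / 2)) ≤ 0.6066 := by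
  have h : Real.exp (-(1 / 2)) ^ 2 = Real.exp (-1) := by rw [← Real.exp_nat_mul]; norm_num
  have h2 := Real.exp_neg_one_lt_d9
  by_contra hc
  push Not at hc
  nlinarith

lemma exp_fifth_le : Real.exp (1 / 5) ≤ 1 + 1.1072 / 5 := by
  have h : Real.exp (1 / 5) ^ 5 = Real.exp 1 := by rw [← Real.exp_nat_mul]; norm_num
  have h2 := Real.exp_one_lt_d9
  by_contra hc
  push Not at hc
  have := pow_lt_pow_left₀ hc (by norm_num) (n := 5) (by norm_num)
  rw [h] at this
  norm_num at this h2
  linarith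

lemma exp_two_fifths_le : Real.exp (2 / 5) ≤ 1 + 1.2298 * (2 / 5) := by
  have h : Real.exp (2 / 5) ^ 5 = Real.exp 1 * Real.exp 1 := by
    rw [← Real.exp_nat_mul, ← Real.exp_add]; norm_num
  have h2 := Real.exp_one_lt_d9
  have h3 : Real.exp 1 * Real.exp 1 ≤ 7.3891 := by nlinarith [Real.exp_pos 1]
  by_contra hc
  push Not at hc
  have := pow_lt_pow_left₀ hc (by norm_num) (n := 5) (by norm_num)
  rw [h] at this
  norm_num at this h3
  linarith

lemma log_540_ge : (6.2 : ℝ) ≤ Real.log 540 := by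
  rw [Real.le_log_iff_exp_le (by norm_num)]
  have e1 : Real.exp 6.2 = Real.exp 1 ^ 6 * Real.exp (1 / 5) := by
    rw [← Real.exp_nat_mul, ← Real.exp_add]; norm_num
  have h2 : Real.exp 1 ^ 6 ≤ 2.7183 ^ 6 :=
    pow_le_pow_left₀ (Real.exp_pos _).le (by have := Real.exp_one_lt_d9; linarith) _
  rw [e1]
  calc Real.exp 1 ^ 6 * Real.exp (1 / 5) ≤ 2.7183 ^ 6 * (1 + 1.1072 / 5) := by
        gcongr; exact exp_fifth_le
    _ ≤ 540 := by norm_num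

/-- The choice of the exponential parameter for the event that a phase is too short for the UCB
estimates: `X` is the budget of the phase, `a` the logarithm of the budget up to its end. The
parameter is `1 / 2` for `u ≤ 3` and `1` for larger `u`. -/
lemma short_phase_param {u a X C ε : ℝ} (hu : 7 / 8 ≤ u) (ha : 6.2 ≤ a) (hC : 0 ≤ C)
    (hX : C * a ≤ X) (hε : ε ≤ 1 / 10) :
    ∃ s : ℝ, 0 < s ∧ s ≤ 1 ∧
      -(X * ((1 + u) * (1 - Real.exp (-s)) - s)) + s * C * (Real.log (1 + u) + s * ε)
        ≤ -(cBar u * X) := by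
  have hX' : C * 6.2 ≤ X := le_trans (by gcongr) hX
  have hu0 : 0 ≤ u := by linarith
  rcases le_total u 3 with h3 | h3
  · refine ⟨1 / 2, by norm_num, by norm_num, ?_⟩
    -- with `exp (-1 / 2) ≤ 0.6066` and the Padé bound, the claim is a polynomial inequality in `u`
    have hlog := log_one_add_le_pade hu0
    have hexp := exp_half_neg_le
    have hnum : (1 / 2) * (u * (6 + u) / (6 + 4 * u) + 0.05) ≤
        6.2 * ((1 + u) * 0.3934 - 1 / 2 - cBar u) := by
      have hp : 0 < (6 + 4 * u) * ((1 + u) * (6 + 10 * u)) := by positivity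
      rw [← sub_nonneg]
      have : 6.2 * ((1 + u) * 0.3934 - 1 / 2 - cBar u)
          - (1 / 2) * (u * (6 + u) / (6 + 4 * u) + 0.05)
          = (6.2 * (((1 + u) * 0.3934 - 1 / 2) * ((6 + 4 * u) * ((1 + u) * (6 + 10 * u)))
              - u ^ 2 * (3 + 4 * u) * (6 + 4 * u))
            - (1 / 2) * (u * (6 + u) * ((1 + u) * (6 + 10 * u))
              + 0.05 * ((6 + 4 * u) * ((1 + u) * (6 + 10 * u)))))
            / ((6 + 4 * u) * ((1 + u) * (6 + 10 * u))) := by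
        unfold cBar; field_simp
      rw [this]
      apply div_nonneg _ hp.le
      obtain ⟨v, rfl⟩ : ∃ v, u = 7 / 8 + v := ⟨u - 7 / 8, by ring⟩
      have hv : 0 ≤ v := by linarith
      have hv2 : v ≤ 17 / 8 := by linarith
      ring_nf
      nlinarith [mul_nonneg hv hv, mul_nonneg (mul_nonneg hv hv) hv,
        mul_nonneg (mul_nonneg (mul_nonneg hv hv) hv) hv,
        mul_nonneg (mul_nonneg hv hv) (sub_nonneg.2 hv2),
        mul_nonneg (mul_nonneg (mul_nonneg hv hv) hv) (sub_nonneg.2 hv2),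
        mul_nonneg hv (sub_nonneg.2 hv2)]
    have hg : 0 ≤ (1 + u) * 0.3934 - 1 / 2 - cBar u := by
      have : 0 ≤ u * (6 + u) / (6 + 4 * u) := by positivity
      linarith
    have h1 : X * ((1 + u) * 0.3934 - 1 / 2 - cBar u) ≥
        C * 6.2 * ((1 + u) * 0.3934 - 1 / 2 - cBar u) := by gcongr
    have h2 : C * ((1 / 2) * (u * (6 + u) / (6 + 4 * u) + 0.05)) ≤
        C * (6.2 * ((1 + u) * 0.3934 - 1 / 2 - cBar u)) := by gcongr
    have h3 : C * (Real.log (1 + u) + 1 / 2 * ε) ≤ C * (u * (6 + u) / (6 + 4 * u) + 0.05) := by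
      gcongr; linarith
    have hX0 : 0 ≤ X := le_trans (by positivity) hX'
    have h4 : X * ((1 + u) * 0.3934) ≤ X * ((1 + u) * (1 - Real.exp (-(1 / 2)))) := by
      gcongr; linarith
    nlinarith
  · refine ⟨1, by norm_num, le_rfl, ?_⟩
    have hexp : Real.exp (-1) ≤ 0.368 := by have := Real.exp_neg_one_lt_d9; linarith
    have hc := cBar_le_linear hu0
    -- tangent of the logarithm at `4`
    have hlog : Real.log (1 + u) ≤ u / 2 := by
      have e : (1 + u) = 4 * (1 + (u - 3) / 4) := by ring
      have l4 : Real.log 4 ≤ 1.4 := by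
        have : (4 : ℝ) = 2 ^ 2 := by norm_num
        rw [this, Real.log_pow]
        have := Real.log_two_lt_d9
        push_cast; linarith
      have l5 := Real.log_le_sub_one_of_pos (x := 1 + (u - 3) / 4) (by linarith)
      rw [e, Real.log_mul (by norm_num) (by linarith)]
      linarith
    have hX0 : 0 ≤ X := le_trans (by positivity) hX'
    have hg : 0 ≤ (1 + u) * 0.632 - 1 - cBar u := by linarith
    have h1 : C * 6.2 * ((1 + u) * 0.632 - 1 - cBar u)
        ≤ X * ((1 + u) * 0.632 - 1 - cBar u) := by gcongr
    have h2 : C * (Real.log (1 + u) + 1 * ε) ≤ C * (6.2 * ((1 + u) * 0.632 - 1 - cBar u)) := by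
      gcongr; linarith
    have h4 : X * ((1 + u) * 0.632) ≤ X * ((1 + u) * (1 - Real.exp (-1))) := by
      gcongr; linarith
    nlinarith

/-! ### The budget sequence -/

/-- The properties of the budget sequence `A` that the analysis uses: it starts at `1`, it is
convex (with the convention `A_{-1} = 0`), and from phase `h` on the phases are long compared with
the number `(q + 2) (1 + c ln A_p)` of slots that the UCB rule needs to find the best of `q + 2`
arms. Here `q` is the size of the sticky sets and `c = 4 α / Δ₂ ^ 2`, which is at least `12` since
`α > 3` and `Δ₂ ≤ 1`. -/
structure IsBudget (A : ℕ → ℕ) (q h : ℕ) (c : ℝ) : Prop where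
  zero : A 0 = 1
  two_le : 2 ≤ incr A 1
  incr_mono : Monotone (incr A)
  q_pos : 1 ≤ q
  c_ge : 12 ≤ c
  h_pos : 1 ≤ h
  long : ∀ p, h ≤ p → ((q : ℝ) + 2) * (1 + c * Real.log (A p)) ≤ incr A p

lemma commSeq_zero {B : ℕ → ℝ} (hB : ∀ t, 0 ≤ B t) (ε : ℝ) : commSeq B ε 0 = 1 := by
  have : sInf {t : ℕ | ((0 : ℕ) : ℝ) ≤ B t} = 0 := by
    apply Nat.sInf_eq_zero.2
    left
    simpa using hB 0
  unfold commSeq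
  rw [this]
  simp

lemma succ_le_commSeq (B : ℕ → ℝ) {ε : ℝ} (hε : 0 < ε) (x : ℕ) : x + 1 ≤ commSeq B ε x := by
  unfold commSeq
  refine le_max_of_le_right ?_
  have : ((x + 1 : ℕ) : ℝ) ≤ (1 + (x : ℝ)) ^ (1 + ε) := by
    have h1 : (1 : ℝ) ≤ 1 + x := by linarith [Nat.cast_nonneg (α := ℝ) x]
    calc ((x + 1 : ℕ) : ℝ) = (1 + (x : ℝ)) ^ (1 : ℝ) := by push_cast; rw [Real.rpow_one]; ring
      _ ≤ _ := Real.rpow_le_rpow_of_exponent_le h1 (by linarith)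
  exact_mod_cast this.trans (Nat.le_ceil _)

lemma three_le_commSeq_one (B : ℕ → ℝ) {ε : ℝ} (hε : 0 < ε) : 3 ≤ commSeq B ε 1 := by
  unfold commSeq
  refine le_max_of_le_right ?_
  have : (2 : ℝ) < (1 + ((1 : ℕ) : ℝ)) ^ (1 + ε) := by
    calc (2 : ℝ) = 2 ^ (1 : ℝ) := by simp
      _ < 2 ^ (1 + ε) := Real.rpow_lt_rpow_of_exponent_lt (by norm_num) (by linarith)
      _ = _ := by norm_num
  have h2 : ((2 : ℕ) : ℝ) < (1 + ((1 : ℕ) : ℝ)) ^ (1 + ε) := by exact_mod_cast this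
  exact Nat.lt_ceil.2 h2

lemma incr_le_self (A : ℕ → ℕ) (x : ℕ) : incr A x ≤ A x := by
  unfold incr
  linarith [Nat.cast_nonneg (α := ℝ) (prevVal A x)]

lemma incr_succ (A : ℕ → ℕ) (x : ℕ) : incr A (x + 1) = A (x + 1) - A x := rfl

lemma incr_commSeq_mono {B : ℕ → ℝ} {ε : ℝ} (hε : 0 < ε) (hB : ∀ t, 0 ≤ B t)
    (hA : AssumptionA2 B ε) : Monotone (incr (commSeq B ε)) := by
  apply monotone_nat_of_le_succ
  intro x
  rcases x with _ | x
  · have h1 := commSeq_zero hB ε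
    have h2 : ((3 : ℕ) : ℝ) ≤ commSeq B ε 1 := by exact_mod_cast three_le_commSeq_one B hε
    simp only [incr, prevVal, h1, zero_add]
    push_cast at *
    linarith
  · have h := hA.convex x (x + 2) (1 / 2) (by norm_num) (by norm_num)
    have : ⌊(1 / 2 : ℝ) * (x : ℝ) + (1 - 1 / 2) * ((x + 2 : ℕ) : ℝ)⌋₊ = x + 1 := by
      have : (1 / 2 : ℝ) * (x : ℝ) + (1 - 1 / 2) * ((x + 2 : ℕ) : ℝ) = ((x + 1 : ℕ) : ℝ) := by
        push_cast; ring
      rw [this, Nat.floor_natCast]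
    rw [this] at h
    rw [incr_succ, incr_succ]
    linarith

/-- Beyond `invSeq A v` the sequence exceeds `v`; the supremum in `invSeq` is one of a bounded set
since `A` grows at least linearly. -/
lemma invSeq_spec {A : ℕ → ℕ} (hA : ∀ y, y + 1 ≤ A y) {v : ℝ} {y : ℕ}
    (hy : invSeq A v + 1 ≤ y) : v < A y := by
  by_contra hc
  push Not at hc
  have hb : BddAbove {y : ℕ | (A y : ℝ) ≤ v} := by
    refine ⟨⌈v⌉₊, fun z hz => ?_⟩
    have h1 : ((z + 1 : ℕ) : ℝ) ≤ v := le_trans (by exact_mod_cast hA z) hz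
    have h2 : ((z + 1 : ℕ) : ℝ) ≤ (⌈v⌉₊ : ℝ) := h1.trans (Nat.le_ceil _)
    have h3 : z + 1 ≤ ⌈v⌉₊ := by exact_mod_cast h2
    omega
  have : y ≤ invSeq A v := le_csSup hb hc
  omega

/-- The set that defines `longPhase` is not empty, since `A_x ≤ A_{x-1} ^ 3` for large `x`. -/
lemma longPhase_spec {B : ℕ → ℝ} {ε : ℝ} (hε : 0 < ε) (hB : ∀ t, 0 ≤ B t)
    (hA : AssumptionA2 B ε) {θ : ℝ} (hθ : 0 < θ) {x₀ : ℕ}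
    (hx₀ : ∀ x, x₀ ≤ x → (prevVal (commSeq B ε) x : ℝ) ^ θ ≤ incr (commSeq B ε) x)
    (N K : ℕ) {α gap : ℝ} (hα : 0 ≤ α) {j : ℕ} (hj : longPhase N K α gap (commSeq B ε) ≤ j) :
    1 + 4 * α * Real.log (commSeq B ε j) / gap ^ 2 ≤
      incr (commSeq B ε) j / (2 + (stickySize N K : ℝ)) := by
  set A := commSeq B ε with hAdef
  have hne : {j : ℕ | ∀ j', j ≤ j' →
    1 + 4 * α * Real.log (A j') / gap ^ 2 ≤ incr A j' / (2 + (stickySize N K : ℝ))}.Nonempty := by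
    have hsucc := fun y => succ_le_commSeq B hε y
    have hmono : Monotone A := by
      apply monotone_nat_of_le_succ
      intro n
      have h0 : incr A 0 ≤ incr A (n + 1) := incr_commSeq_mono hε hB hA (Nat.zero_le _)
      rw [incr_succ] at h0
      have h1 : incr A 0 = 1 := by simp [incr, prevVal, hAdef, commSeq_zero hB ε]
      rw [h1] at h0
      have : (A n : ℝ) ≤ A (n + 1) := by linarith
      exact_mod_cast this
    -- the terms `A (2 l) / A (l - 1) ^ 3` of a convergent series are eventually less than `1`
    have hcube : ∀ᶠ l in Filter.atTop, (A (l + 2) : ℝ) ≤ (A (l + 1) : ℝ) ^ 3 := by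
      have h0 := hA.summable.tendsto_atTop_zero
      filter_upwards [h0.eventually (gt_mem_nhds (zero_lt_one))] with l hl
      have hp : (0 : ℝ) < (A (l + 1) : ℝ) ^ 3 := by
        have : 0 < A (l + 1) := lt_of_lt_of_le (Nat.succ_pos _) (hsucc (l + 1))
        positivity
      rw [div_lt_one hp] at hl
      refine le_trans ?_ hl.le
      exact_mod_cast hmono (by omega : l + 2 ≤ 2 * (l + 2))
    have htend : Filter.Tendsto (fun l => (A (l + 1) : ℝ)) Filter.atTop Filter.atTop := by
      refine tendsto_natCast_atTop_atTop.comp ?_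
      refine Filter.tendsto_atTop_mono (fun l => ?_) Filter.tendsto_id
      have := hsucc (l + 1)
      simp only [id, hAdef] at *
      omega
    set q2 : ℝ := 2 + (stickySize N K : ℝ) with hq2
    have hq : 0 < q2 := by positivity
    set c : ℝ := 4 * α / gap ^ 2 with hc
    have hc0 : 0 ≤ c := by positivity
    -- a power grows faster than the logarithm
    have hlo : ∀ᶠ z : ℝ in Filter.atTop, q2 * (1 + 3 * c * Real.log z) ≤ z ^ θ := by
      have h1 := (isLittleO_log_rpow_atTop hθ).bound
        (c := 1 / (2 * (q2 * (3 * c) + 1))) (by positivity)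
      have h2 := (tendsto_rpow_atTop hθ).eventually_ge_atTop (2 * q2)
      filter_upwards [h1, h2, Filter.eventually_ge_atTop 1] with z hz1 hz2 hz3
      have hz0 : 0 ≤ z := by linarith
      have hl : 0 ≤ Real.log z := Real.log_nonneg hz3
      have hr : 0 ≤ z ^ θ := Real.rpow_nonneg hz0 _
      rw [Real.norm_of_nonneg hl, Real.norm_of_nonneg hr, div_mul_eq_mul_div, one_mul,
        le_div_iff₀ (by positivity)] at hz1
      nlinarith [mul_nonneg hq.le hc0]
    obtain ⟨l₀, hl₀⟩ := Filter.eventually_atTop.1 (hcube.and (htend.eventually hlo))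
    refine ⟨l₀ + 2 + x₀, fun j' hj' => ?_⟩
    obtain ⟨l, rfl⟩ : ∃ l, j' = l + 2 := ⟨j' - 2, by omega⟩
    obtain ⟨h1, h2⟩ := hl₀ l (by omega)
    have h3 := hx₀ (l + 2) (by omega)
    change ((A (l + 1) : ℕ) : ℝ) ^ θ ≤ _ at h3
    rw [le_div_iff₀ hq]
    have hpos : (0 : ℝ) < A (l + 2) := by
      have := hsucc (l + 2)
      exact_mod_cast lt_of_lt_of_le (Nat.succ_pos _) this
    have hlog : Real.log (A (l + 2)) ≤ 3 * Real.log (A (l + 1)) := by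
      have := Real.log_le_log hpos h1
      rw [Real.log_pow] at this
      exact_mod_cast this
    calc (1 + 4 * α * Real.log (A (l + 2)) / gap ^ 2) * q2
        = q2 * (1 + c * Real.log (A (l + 2))) := by rw [hc]; ring
      _ ≤ q2 * (1 + c * (3 * Real.log (A (l + 1)))) := by gcongr
      _ = q2 * (1 + 3 * c * Real.log (A (l + 1))) := by ring
      _ ≤ _ := h2.trans h3
  exact Nat.sInf_mem hne j hj

namespace IsBudget

variable {A : ℕ → ℕ} {q h : ℕ} {c : ℝ}

lemma incr_zero (hA : IsBudget A q h c) : incr A 0 = 1 := by simp [incr, prevVal, hA.zero]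

lemma one_le_incr (hA : IsBudget A q h c) (p : ℕ) : 1 ≤ incr A p := by
  rw [← hA.incr_zero]; exact hA.incr_mono (Nat.zero_le p)

lemma incr_nonneg (hA : IsBudget A q h c) (p : ℕ) : 0 ≤ incr A p :=
  zero_le_one.trans (hA.one_le_incr p)

lemma strictMono (hA : IsBudget A q h c) : StrictMono A := by
  apply strictMono_nat_of_lt_succ
  intro n
  have h1 := hA.one_le_incr (n + 1)
  rw [incr_succ] at h1
  have : (A n : ℝ) < A (n + 1) := by linarith
  exact_mod_cast this

lemma mono (hA : IsBudget A q h c) : Monotone A := hA.strictMono.monotone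

lemma succ_le (hA : IsBudget A q h c) (y : ℕ) : y + 1 ≤ A y := by
  induction y with
  | zero => rw [hA.zero]
  | succ n ih =>
    have := hA.strictMono (Nat.lt_succ_self n)
    simp only [Nat.succ_eq_add_one] at *
    omega

lemma pos (hA : IsBudget A q h c) (y : ℕ) : 0 < A y :=
  lt_of_lt_of_le (Nat.succ_pos _) (hA.succ_le y)

lemma one_le (hA : IsBudget A q h c) (y : ℕ) : (1 : ℝ) ≤ A y := by exact_mod_cast hA.pos y

lemma sum_incr (hA : IsBudget A q h c) (p : ℕ) :
    ∑ y ∈ Finset.range (p + 1), incr A y = A p := by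
  induction p with
  | zero => simp [hA.incr_zero, hA.zero]
  | succ n ih => rw [Finset.sum_range_succ, ih, incr_succ]; ring

lemma le_incr_mul (hA : IsBudget A q h c) (p : ℕ) : (A p : ℝ) ≤ (p + 1) * incr A p := by
  rw [← hA.sum_incr p]
  calc ∑ y ∈ Finset.range (p + 1), incr A y ≤ ∑ y ∈ Finset.range (p + 1), incr A p :=
        Finset.sum_le_sum fun y hy => hA.incr_mono (Nat.lt_succ_iff.1 (Finset.mem_range.1 hy))
    _ = _ := by simp

/-- Convexity: above `a`, the sequence stays above the line of slope `incr A (a + 1)`. -/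
lemma add_mul_le (hA : IsBudget A q h c) {a b : ℕ} (hab : a ≤ b) :
    (A a : ℝ) + (b - a) * incr A (a + 1) ≤ A b := by
  induction b, hab using Nat.le_induction with
  | base => simp
  | succ n hn ih =>
    have h1 := hA.incr_mono (by omega : a + 1 ≤ n + 1)
    rw [incr_succ A n] at h1
    push_cast
    linarith

/-- The lower bound for the increments bootstraps itself: `A h ≥ exp a` gives
`incr A h ≥ 3 * (1 + 12 * a)`, and this is a lower bound for `A h` again. -/
lemma large (hA : IsBudget A q h c) : 180 ≤ incr A h := by
  have h0 : ∀ a : ℝ, 0 ≤ a → Real.exp a ≤ A h → 3 * (1 + 12 * a) ≤ incr A h := by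
    intro a ha hexp
    have h1 := hA.long h le_rfl
    have h2 : a ≤ Real.log (A h) := by
      rw [Real.le_log_iff_exp_le (by linarith [hA.one_le h])]; exact hexp
    have h3 : (1 : ℝ) ≤ q := by exact_mod_cast hA.q_pos
    refine le_trans ?_ h1
    have h4 := hA.c_ge
    gcongr
    linarith
  have h1 : (3 : ℝ) ≤ A h := by
    have := hA.mono hA.h_pos
    have h2 := hA.two_le
    rw [incr_succ A 0, hA.zero] at h2
    have h3 : (A 1 : ℝ) ≤ A h := by exact_mod_cast this
    push_cast at h2
    linarith
  have he := Real.exp_one_lt_d9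
  have hp : ∀ n : ℕ, Real.exp n ≤ 2.7183 ^ n := by
    intro n
    have : Real.exp n = Real.exp 1 ^ n := by rw [← Real.exp_nat_mul]; simp
    rw [this]
    exact pow_le_pow_left₀ (Real.exp_pos _).le (by linarith) _
  have s1 := h0 1 (by norm_num) (by linarith)
  have s2 := h0 3 (by norm_num) (by
    have := hp 3; push_cast at this; have := incr_le_self A h; norm_num at *; linarith)
  have s3 := h0 4 (by norm_num) (by
    have := hp 4; push_cast at this; have := incr_le_self A h; norm_num at *; linarith)
  have s4 := h0 (4 + 4 / 5) (by norm_num) (by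
    have h4 := hp 4
    have : Real.exp (4 + 4 / 5) = Real.exp (4 : ℕ) * (Real.exp (2 / 5) * Real.exp (2 / 5)) := by
      rw [← Real.exp_add, ← Real.exp_add]; norm_num
    have h5 := exp_two_fifths_le
    have h6 : Real.exp (2 / 5) * Real.exp (2 / 5) ≤
        (1 + 1.2298 * (2 / 5)) * (1 + 1.2298 * (2 / 5)) :=
      mul_le_mul h5 h5 (Real.exp_pos _).le (by norm_num)
    have h7 : Real.exp (4 : ℕ) * (Real.exp (2 / 5) * Real.exp (2 / 5)) ≤
        2.7183 ^ 4 * ((1 + 1.2298 * (2 / 5)) * (1 + 1.2298 * (2 / 5))) :=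
      mul_le_mul h4 h6 (by positivity) (by norm_num)
    rw [this]
    have := incr_le_self A h; norm_num at *; linarith)
  have s5 := h0 5 (by norm_num) (by
    have := hp 5; push_cast at this; have := incr_le_self A h; norm_num at *; linarith)
  linarith

lemma large_of_le (hA : IsBudget A q h c) {p : ℕ} (hp : h ≤ p) : 180 ≤ incr A p :=
  hA.large.trans (hA.incr_mono hp)

/-- After `h`, each phase adds at least `180` to the budget. -/
lemma large_add (hA : IsBudget A q h c) (m : ℕ) : 180 * ((m : ℝ) + 1) ≤ A (h + m) := by
  have h1 := hA.add_mul_le (Nat.le_add_right h m)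
  have h2 := hA.large_of_le (Nat.le_succ h)
  have h3 := hA.large.trans (incr_le_self A h)
  have : (0 : ℝ) ≤ m := Nat.cast_nonneg _
  push_cast at h1
  nlinarith

end IsBudget

/-- The budget sequence of the algorithm, with `h = j* / 2`. -/
lemma isBudget_commSeq {B : ℕ → ℝ} {ε : ℝ} (hε : 0 < ε) (hB : ∀ t, 0 ≤ B t)
    (hA : AssumptionA2 B ε) {θ : ℝ} (hθ : 0 < θ) {x₀ : ℕ}
    (hx₀ : ∀ x, x₀ ≤ x → (prevVal (commSeq B ε) x : ℝ) ^ θ ≤ incr (commSeq B ε) x)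
    {N K : ℕ} (hN : 0 < N) (hK : 0 < K) {α gap : ℝ} (hα : 3 < α) (hg : 0 < gap) (hg1 : gap ≤ 1)
    {h : ℕ} (hh : jStar N K α gap (commSeq B ε) = 2 * h) :
    IsBudget (commSeq B ε) (stickySize N K) h (4 * α / gap ^ 2) ∧
      (N : ℝ) * (K.choose 2 : ℝ) * ((stickySize N K : ℝ) + 1) ≤
        (commSeq B ε h : ℝ) ^ (2 * α - 6) := by
  have hh' : h = max (invSeq (commSeq B ε) (((N : ℝ) * (K.choose 2 : ℝ) *
      ((stickySize N K : ℝ) + 1)) ^ (1 / (2 * α - 6))) + 1)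
      (longPhase N K α gap (commSeq B ε)) := by
    unfold jStar at hh; omega
  refine ⟨⟨commSeq_zero hB ε, ?_, incr_commSeq_mono hε hB hA, ?_, ?_, ?_, ?_⟩, ?_⟩
  · have h2 : ((3 : ℕ) : ℝ) ≤ commSeq B ε 1 := by exact_mod_cast three_le_commSeq_one B hε
    rw [incr_succ, commSeq_zero hB ε]
    push_cast at *
    linarith
  · unfold stickySize
    exact Nat.ceil_pos.2 (by positivity)
  · rw [le_div_iff₀ (by positivity)]
    nlinarith
  · rw [hh']; exact le_max_of_le_left (Nat.succ_le_succ (Nat.zero_le _))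
  · intro p hp
    have h1 := longPhase_spec hε hB hA hθ hx₀ N K (gap := gap) (by linarith : (0 : ℝ) ≤ α)
      (j := p) (le_trans (by rw [hh']; exact le_max_right _ _) hp)
    rw [le_div_iff₀ (by positivity)] at h1
    refine le_trans (le_of_eq ?_) h1
    ring
  · have h1 := invSeq_spec (fun y => succ_le_commSeq B hε y) (v := ((N : ℝ) * (K.choose 2 : ℝ) *
      ((stickySize N K : ℝ) + 1)) ^ (1 / (2 * α - 6))) (y := h) (by
        rw [hh']; exact le_max_left _ _)
    have h2 := Real.rpow_le_rpow (by positivity) h1.le (by linarith : (0 : ℝ) ≤ 2 * α - 6)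
    rwa [← Real.rpow_mul (by positivity), one_div_mul_cancel (by linarith), Real.rpow_one] at h2

/-! ### Phases and the dynamics of the algorithm -/

/-- The number of slots before phase `p`; phase `p` consists of the slots in
`(startTime len p, startTime len (p + 1)]`. -/
def startTime (len : ℕ → ℕ) (p : ℕ) : ℕ := ∑ y ∈ Finset.range p, len y

lemma startTime_succ (len : ℕ → ℕ) (p : ℕ) : startTime len (p + 1) = startTime len p + len p :=
  Finset.sum_range_succ _ _

lemma startTime_mono (len : ℕ → ℕ) : Monotone (startTime len) :=
  monotone_nat_of_le_succ fun n => by rw [startTime_succ]; omega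

lemma phaseEnd_eq (len : ℕ → ℕ) (p : ℕ) : phaseEnd len p = startTime len (p + 1) := rfl

/-- The phase lengths do not sum up to a finite number. -/
def Unbounded (len : ℕ → ℕ) : Prop := ∀ n, ∃ p, n < startTime len p

/-- Slot `t + 1` belongs to the phase `phaseOf len (t + 1)`. Unboundedness excludes that `phaseOf`
is the infimum of the empty set. -/
lemma phaseOf_spec {len : ℕ → ℕ} (hU : Unbounded len) (t : ℕ) :
    startTime len (phaseOf len (t + 1)) ≤ t ∧ t < startTime len (phaseOf len (t + 1) + 1) := by
  have hne : {r : ℕ | t + 1 ≤ phaseEnd len r}.Nonempty := by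
    obtain ⟨p, hp⟩ := hU t
    refine ⟨p, ?_⟩
    have := startTime_mono len (Nat.le_succ p)
    rw [Set.mem_ofPred_eq, phaseEnd_eq]
    simp only [Nat.succ_eq_add_one] at this
    omega
  constructor
  · rcases hr : phaseOf len (t + 1) with _ | r
    · simp [startTime]
    · have : r ∉ {r : ℕ | t + 1 ≤ phaseEnd len r} :=
        Nat.notMem_of_lt_sInf (by unfold phaseOf at hr; omega)
      rw [Set.mem_ofPred_eq, phaseEnd_eq] at this
      omega
  · have := Nat.sInf_mem hne
    exact this

lemma phaseOf_eq {len : ℕ → ℕ} {t p : ℕ} (h1 : startTime len p ≤ t)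
    (h2 : t < startTime len (p + 1)) : phaseOf len (t + 1) = p := by
  apply le_antisymm
  · exact Nat.sInf_le h2
  · by_contra hc
    push Not at hc
    have hm := Nat.sInf_mem (s := {r : ℕ | t + 1 ≤ phaseEnd len r}) ⟨p, h2⟩
    change t + 1 ≤ startTime len (phaseOf len (t + 1) + 1) at hm
    have := startTime_mono len (show phaseOf len (t + 1) + 1 ≤ p from hc)
    omega

lemma phaseOf_mono {len : ℕ → ℕ} (hU : Unbounded len) {t t' : ℕ} (h : t ≤ t') :
    phaseOf len (t + 1) ≤ phaseOf len (t' + 1) := by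
  have h1 := phaseOf_spec hU t
  have h2 := phaseOf_spec hU t'
  by_contra hc
  push Not at hc
  have := startTime_mono len (show phaseOf len (t' + 1) + 1 ≤ phaseOf len (t + 1) from hc)
  omega

section Dynamics

variable {N K : ℕ} [NeZero K] {α : ℝ} {tie : TieBreaking N K} {w : Noise N K}

lemma playSet_nonempty (i : Fin N) (s : AgentState K) : (playSet i s).Nonempty :=
  ⟨s.U, by simp [playSet]⟩

lemma card_playSet_le (i : Fin N) (s : AgentState K) :
    (playSet i s).card ≤ stickySize N K + 2 := by
  unfold playSet
  refine (Finset.card_union_le _ _).trans (Nat.add_le_add ?_ Finset.card_le_two)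
  exact Finset.card_image_le.trans (by simp)

lemma argmaxSet_nonempty {α β : Type*} [LinearOrder β] {s : Finset α} (hs : s.Nonempty)
    (f : α → β) : (argmaxSet s f).Nonempty := by
  obtain ⟨a, ha, h⟩ := s.exists_max_image f hs
  exact ⟨a, by simp only [argmaxSet, Finset.mem_filter]; exact ⟨ha, h⟩⟩

lemma mem_argmaxSet {α β : Type*} [LinearOrder β] {s : Finset α} {f : α → β} {a : α} :
    a ∈ argmaxSet s f ↔ a ∈ s ∧ ∀ b ∈ s, f b ≤ f a := by
  simp [argmaxSet]

/-- The completion of `n` phases at the same moment, when the agents called return the arms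
`f`. -/
noncomputable def finishPhases (tie : TieBreaking N K) (i : Fin N) (f : ℕ → Fin K) (n : ℕ)
    (s : AgentState K) : AgentState K :=
  (fun s => finishPhase tie i (f s.phase) s)^[n] s

lemma finishPhases_succ (i : Fin N) (f : ℕ → Fin K) (n : ℕ) (s : AgentState K) :
    finishPhases tie i f (n + 1) s =
      finishPhase tie i (f (finishPhases tie i f n s).phase) (finishPhases tie i f n s) := by
  unfold finishPhases
  rw [Function.iterate_succ_apply']

lemma finishPhases_phase (i : Fin N) (f : ℕ → Fin K) (n : ℕ) (s : AgentState K) :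
    (finishPhases tie i f n s).phase = s.phase + n := by
  induction n with
  | zero => rfl
  | succ n ih => rw [finishPhases_succ]; simp only [finishPhase, ih]; ring

lemma finishPhases_pulls (i : Fin N) (f : ℕ → Fin K) (n : ℕ) (s : AgentState K) :
    (finishPhases tie i f n s).pulls = s.pulls := by
  induction n with
  | zero => rfl
  | succ n ih => rw [finishPhases_succ]; exact ih

lemma finishPhases_wins (i : Fin N) (f : ℕ → Fin K) (n : ℕ) (s : AgentState K) :
    (finishPhases tie i f n s).wins = s.wins := by
  induction n with
  | zero => rfl
  | succ n ih => rw [finishPhases_succ]; exact ih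

lemma finishPhases_pullsBefore (i : Fin N) (f : ℕ → Fin K) {n : ℕ} (hn : 0 < n)
    (s : AgentState K) : (finishPhases tie i f n s).pullsBefore = s.pulls := by
  obtain ⟨m, rfl⟩ : ∃ m, n = m + 1 := ⟨n - 1, by omega⟩
  rw [finishPhases_succ]
  exact finishPhases_pulls i f m s

lemma playSet_finishPhase_of_mem {i : Fin N} {o : Fin K} {s : AgentState K}
    (h : o ∈ playSet i s) : playSet i (finishPhase tie i o s) = playSet i s := by
  simp [playSet, finishPhase] at *
  simp [h]

lemma mem_playSet_finishPhase (i : Fin N) (o : Fin K) (s : AgentState K) :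
    o ∈ playSet i (finishPhase tie i o s) := by
  by_cases h : o ∈ playSet i s
  · rw [playSet_finishPhase_of_mem h]; exact h
  · simp [playSet, finishPhase] at *
    simp [h]

lemma playSet_finishPhases {i : Fin N} {f : ℕ → Fin K} {a : Fin K} {s : AgentState K}
    (hf : ∀ p, f p = a) (ha : a ∈ playSet i s) (n : ℕ) :
    playSet i (finishPhases tie i f n s) = playSet i s := by
  induction n with
  | zero => rfl
  | succ n ih =>
    rw [finishPhases_succ, playSet_finishPhase_of_mem, ih]
    rw [ih, hf]; exact ha

/-- The state of agent `i` after the pull of slot `t + 1` and before the calls. -/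
noncomputable def midState (α : ℝ) (tie : TieBreaking N K) (w : Noise N K) (t : ℕ) (i : Fin N) :
    AgentState K :=
  pullStep α tie w i (t + 1) (states α tie w t i)

/-- The arm pulled by agent `i` in slot `t + 1`. -/
noncomputable def armAt (α : ℝ) (tie : TieBreaking N K) (w : Noise N K) (t : ℕ) (i : Fin N) :
    Fin K :=
  pulledArm α tie i (t + 1) (states α tie w t i)

lemma states_succ (t : ℕ) (i : Fin N) :
    states α tie w (t + 1) i =
      finishPhases tie i (fun p => (states α tie w t (w.call i p)).advice)
        (phaseOf (w.len i) (t + 2) - (states α tie w t i).phase) (midState α tie w t i) := rfl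

lemma states_phase (hU : ∀ i, Unbounded (w.len i)) (t : ℕ) (i : Fin N) :
    (states α tie w t i).phase = phaseOf (w.len i) (t + 1) := by
  induction t with
  | zero =>
    change (finishPhases tie i (fun p => (initState tie (w.call i p)).advice) _ _).phase = _
    rw [finishPhases_phase]
    simp [initState]
  | succ t ih =>
    rw [states_succ, finishPhases_phase]
    have hm : (midState α tie w t i).phase = (states α tie w t i).phase := rfl
    have h : phaseOf (w.len i) (t + 1) ≤ phaseOf (w.len i) (t + 2) :=
      phaseOf_mono (hU i) (Nat.le_succ t)
    rw [hm, ih]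
    change _ = phaseOf (w.len i) (t + 2)
    omega

lemma pulls_zero (i : Fin N) (k : Fin K) : (states α tie w 0 i).pulls k = 0 := by
  change (finishPhases tie i (fun p => (initState tie (w.call i p)).advice) _ _).pulls k = _
  rw [finishPhases_pulls]
  rfl

lemma pulls_succ (t : ℕ) (i : Fin N) (k : Fin K) :
    (states α tie w (t + 1) i).pulls k =
      (states α tie w t i).pulls k + if k = armAt α tie w t i then 1 else 0 := by
  rw [states_succ, finishPhases_pulls]
  change Function.update _ _ _ k = _
  by_cases h : k = armAt α tie w t i
  · subst h; simp [armAt]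
  · rw [if_neg h, add_zero]
    exact Function.update_of_ne h _ _

lemma pulls_mono (i : Fin N) (k : Fin K) : Monotone fun t => (states α tie w t i).pulls k :=
  monotone_nat_of_le_succ fun t => by rw [pulls_succ]; omega

lemma sum_pulls (t : ℕ) (i : Fin N) : ∑ k, (states α tie w t i).pulls k = t := by
  induction t with
  | zero => simp [pulls_zero]
  | succ t ih => simp [pulls_succ, Finset.sum_add_distrib, ih]

/-- The total reward of the first `n` pulls of arm `k` by agent `i`. -/
def rewardSum (w : Noise N K) (i : Fin N) (k : Fin K) (n : ℕ) : ℕ :=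
  ∑ j ∈ Finset.range n, (w.reward i k j).toNat

/-- The rewards of an arm are read off in the order of its pulls. -/
lemma wins_eq (t : ℕ) (i : Fin N) (k : Fin K) :
    (states α tie w t i).wins k = rewardSum w i k ((states α tie w t i).pulls k) := by
  induction t with
  | zero =>
    rw [pulls_zero]
    change (finishPhases tie i (fun p => (initState tie (w.call i p)).advice) _ _).wins k = _
    rw [finishPhases_wins]
    rfl
  | succ t ih =>
    rw [pulls_succ, states_succ, finishPhases_wins]
    change Function.update _ _ _ k = _
    by_cases h : k = armAt α tie w t i
    · subst h
      simp only [armAt, Function.update_self, if_true]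
      unfold rewardSum
      rw [Finset.sum_range_succ]
      exact congrArg (· + _) ih
    · rw [if_neg h, add_zero, ← ih]
      exact Function.update_of_ne h _ _

lemma armAt_mem_argmax (t : ℕ) (i : Fin N) :
    armAt α tie w t i ∈ argmaxSet (playSet i (states α tie w t i))
      (ucbIndex α (t + 1) (states α tie w t i)) :=
  tie.pull_mem _ _ _ (argmaxSet_nonempty (playSet_nonempty _ _) _)

lemma armAt_mem (t : ℕ) (i : Fin N) :
    armAt α tie w t i ∈ playSet i (states α tie w t i) :=
  (mem_argmaxSet.1 (armAt_mem_argmax t i)).1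

/-- The confidence bounds of agent `i` are violated in slot `t`: for some sample size, the upper
confidence bound of the best arm is below its mean, or the lower confidence bound of another arm is
above its mean. -/
def ConfFail (α : ℝ) (μ : Fin K → ℝ) (w : Noise N K) (i : Fin N) (t : ℕ) : Prop :=
  ∃ s : ℕ, 1 ≤ s ∧ s < t ∧
    ((rewardSum w i 0 s : ℝ) / s + Real.sqrt (α * Real.log t / s) < μ 0 ∨
      ∃ k, k ≠ 0 ∧ μ k + Real.sqrt (α * Real.log t / s) < (rewardSum w i k s : ℝ) / s)

/-- The standard UCB estimate: while the confidence bounds hold and the best arm is available, a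
suboptimal arm is only pulled if it was not pulled often before. -/
lemma pulls_le_of_armAt {μ : Fin K → ℝ} (hα : 0 ≤ α) {t : ℕ} {i : Fin N} {k : Fin K} (hk : k ≠ 0)
    (hμ : μ k < μ 0) (h0 : 0 ∈ playSet i (states α tie w t i)) (hf : ¬ ConfFail α μ w i (t + 1))
    (harm : armAt α tie w t i = k) :
    ((states α tie w t i).pulls k : ℝ) ≤ 4 * α * Real.log (t + 1 : ℕ) / (μ 0 - μ k) ^ 2 := by
  have hmax := (mem_argmaxSet.1 (armAt_mem_argmax (α := α) (tie := tie) (w := w) t i)).2 0 h0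
  rw [harm] at hmax
  have hg : 0 < μ 0 - μ k := by linarith
  have hlog : 0 ≤ Real.log (t + 1 : ℕ) := Real.log_natCast_nonneg _
  rcases Nat.eq_zero_or_pos ((states α tie w t i).pulls k) with hp | hp
  · rw [hp]; simp only [Nat.cast_zero]; positivity
  have hlt : ∀ k', (states α tie w t i).pulls k' < t + 1 := by
    intro k'
    have h1 := Finset.single_le_sum (f := fun k => (states α tie w t i).pulls k)
      (fun _ _ => Nat.zero_le _) (Finset.mem_univ k')
    have h2 := sum_pulls (α := α) (tie := tie) (w := w) t i
    have h3 : (states α tie w t i).pulls k' ≤ ∑ k, (states α tie w t i).pulls k := h1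
    omega
  -- an arm that was never pulled has index `⊤`, so the best arm was pulled before
  have hp0 : (states α tie w t i).pulls 0 ≠ 0 := by
    intro h
    unfold ucbIndex at hmax
    rw [if_pos h, if_neg hp.ne', top_le_iff] at hmax
    exact EReal.coe_ne_top _ hmax
  unfold ucbIndex at hmax
  rw [if_neg hp0, if_neg hp.ne', EReal.coe_le_coe_iff, wins_eq, wins_eq] at hmax
  set n := (states α tie w t i).pulls k with hn
  unfold ConfFail at hf
  push Not at hf
  have h1 := (hf _ (Nat.pos_of_ne_zero hp0) (hlt 0)).1
  have h2 := (hf n hp (hlt k)).2 k hk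
  have h3 : μ 0 - μ k ≤ 2 * Real.sqrt (α * Real.log (t + 1 : ℕ) / n) := by linarith
  have hn0 : (0 : ℝ) < n := by exact_mod_cast hp
  have h4 : (μ 0 - μ k) ^ 2 ≤ 4 * (α * Real.log (t + 1 : ℕ) / n) := by
    calc (μ 0 - μ k) ^ 2 ≤ (2 * Real.sqrt (α * Real.log (t + 1 : ℕ) / n)) ^ 2 := by gcongr
      _ = _ := by rw [mul_pow, Real.sq_sqrt (by positivity)]; norm_num
  rw [le_div_iff₀ (by positivity)]
  have h5 : 4 * (α * Real.log (t + 1 : ℕ) / n) * n = 4 * α * Real.log (t + 1 : ℕ) := by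
    field_simp
  nlinarith

/-- Inside a phase nothing but the counts changes. -/
lemma states_const (hU : ∀ i, Unbounded (w.len i)) {i : Fin N} {p t : ℕ}
    (h1 : startTime (w.len i) p ≤ t) (h2 : t < startTime (w.len i) (p + 1)) :
    playSet i (states α tie w t i) = playSet i (states α tie w (startTime (w.len i) p) i) ∧
    (states α tie w t i).advice = (states α tie w (startTime (w.len i) p) i).advice ∧
    (states α tie w t i).pullsBefore =
      (states α tie w (startTime (w.len i) p) i).pullsBefore ∧
    ({(states α tie w t i).U, (states α tie w t i).L} : Finset (Fin K)) =
      {(states α tie w (startTime (w.len i) p) i).U,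
        (states α tie w (startTime (w.len i) p) i).L} := by
  induction t, h1 using Nat.le_induction with
  | base => simp
  | succ t ht ih =>
    have e : states α tie w (t + 1) i = midState α tie w t i := by
      rw [states_succ, states_phase hU, phaseOf_eq (p := p) ht (by omega),
        phaseOf_eq (p := p) (t := t + 1) (by omega) h2, Nat.sub_self]
      rfl
    rw [e]
    exact ih (by omega)

/-- At the beginning of a phase all pulls are pulls of previous phases. -/
lemma pullsBefore_startTime (hU : ∀ i, Unbounded (w.len i)) {i : Fin N} {p : ℕ}
    (h0 : 0 < startTime (w.len i) p) (h1 : 0 < w.len i p) :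
    (states α tie w (startTime (w.len i) p) i).pullsBefore =
      (states α tie w (startTime (w.len i) p) i).pulls := by
  obtain ⟨t, ht⟩ : ∃ t, startTime (w.len i) p = t + 1 := ⟨startTime (w.len i) p - 1, by omega⟩
  rw [ht, states_succ, finishPhases_pullsBefore, finishPhases_pulls]
  rw [states_phase hU]
  have h2 : phaseOf (w.len i) (t + 2) = p :=
    phaseOf_eq (t := t + 1) ht.le (by rw [startTime_succ]; omega)
  rw [h2]
  have h3 := (phaseOf_spec (hU i) t).1
  have : phaseOf (w.len i) (t + 1) < p := by
    by_contra hc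
    push Not at hc
    have := startTime_mono (w.len i) hc
    omega
  omega

/-- The end of a phase. -/
lemma states_phase_end (hU : ∀ i, Unbounded (w.len i)) {i : Fin N} {p : ℕ}
    (h1 : 0 < w.len i p) (h2 : 0 < w.len i (p + 1)) :
    states α tie w (startTime (w.len i) (p + 1)) i =
      finishPhase tie i
        (states α tie w (startTime (w.len i) (p + 1) - 1) (w.call i p)).advice
        (midState α tie w (startTime (w.len i) (p + 1) - 1) i) := by
  obtain ⟨t, ht⟩ : ∃ t, startTime (w.len i) (p + 1) = t + 1 :=
    ⟨startTime (w.len i) (p + 1) - 1, by rw [startTime_succ]; omega⟩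
  have e1 : phaseOf (w.len i) (t + 1) = p :=
    phaseOf_eq (by rw [startTime_succ] at ht; omega) (by omega)
  have e2 : phaseOf (w.len i) (t + 2) = p + 1 :=
    phaseOf_eq (t := t + 1) ht.le (by rw [startTime_succ]; omega)
  have hph := states_phase (α := α) (tie := tie) hU t i
  rw [ht, Nat.add_sub_cancel, states_succ, hph, e1, e2, Nat.add_sub_cancel_left]
  change finishPhase tie i (states α tie w t (w.call i (states α tie w t i).phase)).advice _ = _
  rw [hph, e1]

/-- The arm recommended by the agent called at the end of a phase enters the playing set. -/
lemma mem_playSet_phase_end (hU : ∀ i, Unbounded (w.len i)) {i : Fin N} {p : ℕ}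
    (h1 : 0 < w.len i p) (h2 : 0 < w.len i (p + 1)) :
    (states α tie w (startTime (w.len i) (p + 1) - 1) (w.call i p)).advice ∈
      playSet i (states α tie w (startTime (w.len i) (p + 1)) i) := by
  rw [states_phase_end hU h1 h2]
  exact mem_playSet_finishPhase _ _ _

/-- Bookkeeping inside a phase: only arms of the playing set are pulled, and suboptimal arms are
pulled rarely if the best arm is available and the confidence bounds hold. -/
lemma pulls_in_phase {μ : Fin K → ℝ} (hα : 0 ≤ α) {gap : ℝ} (hgap : 0 < gap)
    (hμ : ∀ k, k ≠ 0 → gap ≤ μ 0 - μ k)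
    (hU : ∀ i, Unbounded (w.len i)) {i : Fin N} {p : ℕ}
    (h0 : 0 ∈ playSet i (states α tie w (startTime (w.len i) p) i))
    (hf : ∀ t, startTime (w.len i) p < t → t ≤ startTime (w.len i) (p + 1) →
      ¬ ConfFail α μ w i t) {t : ℕ}
    (ht1 : startTime (w.len i) p ≤ t) (ht2 : t ≤ startTime (w.len i) (p + 1)) :
    (∀ k, k ∉ playSet i (states α tie w (startTime (w.len i) p) i) →
      (states α tie w t i).pulls k = (states α tie w (startTime (w.len i) p) i).pulls k) ∧
    (∀ k, k ≠ 0 → ((states α tie w t i).pulls k : ℝ) -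
      (states α tie w (startTime (w.len i) p) i).pulls k ≤
        1 + 4 * α / gap ^ 2 * Real.log (startTime (w.len i) (p + 1))) := by
  have hlog : 0 ≤ Real.log (startTime (w.len i) (p + 1)) := Real.log_natCast_nonneg _
  induction t, ht1 using Nat.le_induction with
  | base =>
    refine ⟨fun _ _ => rfl, fun k _ => ?_⟩
    rw [sub_self]
    positivity
  | succ t ht ih =>
    obtain ⟨ih1, ih2⟩ := ih (by omega)
    have hps := (states_const (α := α) (tie := tie) hU ht (by omega)).1
    have harm := armAt_mem (α := α) (tie := tie) (w := w) t i
    rw [hps] at harm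
    refine ⟨fun k hk => ?_, fun k hk => ?_⟩
    · rw [pulls_succ, if_neg (by rintro rfl; exact hk harm), add_zero, ih1 k hk]
    · rw [pulls_succ]
      by_cases h : k = armAt α tie w t i
      · rw [if_pos h]
        have hg := hμ k hk
        have h3 := pulls_le_of_armAt hα hk (by linarith) (by rw [hps]; exact h0)
          (hf (t + 1) (by omega) ht2) h.symm
        have h4 : 4 * α * Real.log (t + 1 : ℕ) / (μ 0 - μ k) ^ 2 ≤
            4 * α / gap ^ 2 * Real.log (startTime (w.len i) (p + 1)) := by
          rw [div_mul_eq_mul_div]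
          have : Real.log (t + 1 : ℕ) ≤ Real.log (startTime (w.len i) (p + 1)) :=
            Real.log_le_log (by positivity) (by exact_mod_cast ht2)
          gcongr
        have h5 : (0 : ℝ) ≤ (states α tie w (startTime (w.len i) p) i).pulls k :=
          Nat.cast_nonneg _
        push_cast at *
        linarith
      · rw [if_neg h, add_zero]
        exact ih2 k hk

/-- In a long phase in which the best arm is available and the confidence bounds hold, the best arm
is played most. So it is recommended during the next phase, and it stays in the playing set. -/
lemma good_phase {μ : Fin K → ℝ} (hα : 0 ≤ α) {gap : ℝ} (hgap : 0 < gap)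
    (hμ : ∀ k, k ≠ 0 → gap ≤ μ 0 - μ k)
    (hU : ∀ i, Unbounded (w.len i)) {i : Fin N} {p : ℕ}
    (hS : 0 < startTime (w.len i) p) (h2 : 0 < w.len i (p + 1))
    (hlen : ((stickySize N K : ℝ) + 2) *
      (1 + 4 * α / gap ^ 2 * Real.log (startTime (w.len i) (p + 1))) < w.len i p)
    (h0 : 0 ∈ playSet i (states α tie w (startTime (w.len i) p) i))
    (hf : ∀ t, startTime (w.len i) p < t → t ≤ startTime (w.len i) (p + 1) →
      ¬ ConfFail α μ w i t) :
    (states α tie w (startTime (w.len i) (p + 1)) i).advice = 0 ∧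
      0 ∈ playSet i (states α tie w (startTime (w.len i) (p + 1)) i) := by
  have hlog : 0 ≤ Real.log (startTime (w.len i) (p + 1)) := Real.log_natCast_nonneg _
  have hb0 : 0 ≤ 1 + 4 * α / gap ^ 2 * Real.log (startTime (w.len i) (p + 1)) := by positivity
  have h1 : 0 < w.len i p := by
    have : (0 : ℝ) < w.len i p := lt_of_le_of_lt (by positivity) hlen
    exact_mod_cast this
  set s₀ := states α tie w (startTime (w.len i) p) i with hs₀
  set e := startTime (w.len i) (p + 1) with he
  have hee : e = startTime (w.len i) p + w.len i p := startTime_succ _ _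
  obtain ⟨hout, hfew⟩ := pulls_in_phase hα hgap hμ hU (tie := tie) h0 hf (t := e)
    (by omega) le_rfl
  have hmono : ∀ k, s₀.pulls k ≤ (states α tie w e i).pulls k := fun k =>
    pulls_mono (α := α) (tie := tie) (w := w) i k (by omega : startTime (w.len i) p ≤ e)
  set plays : Fin K → ℕ := fun k => (states α tie w e i).pulls k - s₀.pulls k with hplays
  have hsum : ∑ k ∈ playSet i s₀, plays k = w.len i p := by
    have a1 : ∑ k ∈ playSet i s₀, plays k = ∑ k, plays k := by
      apply Finset.sum_subset (Finset.subset_univ _)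
      intro k _ hk
      simp only [hplays, hout k hk]
      exact Nat.sub_self _
    rw [a1]
    have a2 := sum_pulls (α := α) (tie := tie) (w := w) e i
    have a3 := sum_pulls (α := α) (tie := tie) (w := w) (startTime (w.len i) p) i
    have a4 : ∑ k, plays k + ∑ k, s₀.pulls k = ∑ k, (states α tie w e i).pulls k := by
      rw [← Finset.sum_add_distrib]
      exact Finset.sum_congr rfl fun k _ => Nat.sub_add_cancel (hmono k)
    rw [← hs₀] at a3
    omega
  -- the best arm is the unique most played arm, else all arms would be played rarely
  have hmost : ∀ k, k ≠ 0 → plays k < plays 0 := by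
    intro k hk
    by_contra hc
    push Not at hc
    have hb : ∀ k', (plays k' : ℝ) ≤ 1 + 4 * α / gap ^ 2 * Real.log e := by
      have b1 : ∀ k', k' ≠ 0 → (plays k' : ℝ) ≤ 1 + 4 * α / gap ^ 2 * Real.log e := by
        intro k' hk'
        have := hfew k' hk'
        rwa [← Nat.cast_sub (hmono k')] at this
      intro k'
      by_cases hk' : k' = 0
      · subst hk'
        exact le_trans (by exact_mod_cast hc) (b1 k hk)
      · exact b1 k' hk'
    have : (w.len i p : ℝ) ≤ ((stickySize N K : ℝ) + 2) *
        (1 + 4 * α / gap ^ 2 * Real.log e) := by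
      rw [← hsum]
      push_cast
      calc ∑ k ∈ playSet i s₀, (plays k : ℝ)
          ≤ ∑ k ∈ playSet i s₀, (1 + 4 * α / gap ^ 2 * Real.log e) :=
            Finset.sum_le_sum fun k _ => hb k
        _ = (playSet i s₀).card * (1 + 4 * α / gap ^ 2 * Real.log e) := by
            rw [Finset.sum_const, nsmul_eq_mul]
        _ ≤ _ := by
          gcongr
          exact_mod_cast card_playSet_le i s₀
    linarith
  -- the state right before the calls at the end of the phase
  have hend := states_phase_end (α := α) (tie := tie) hU h1 h2
  obtain ⟨hc1, hc2, hc3, hc4⟩ := states_const (α := α) (tie := tie) hU (i := i) (p := p)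
    (t := e - 1) (by omega) (by omega)
  set m := midState α tie w (e - 1) i with hm
  have hmplay : playSet i m = playSet i s₀ := hc1
  have hmUL : ({m.U, m.L} : Finset (Fin K)) = {s₀.U, s₀.L} := hc4
  have hmbefore : m.pullsBefore = s₀.pulls := by
    have : m.pullsBefore = s₀.pullsBefore := hc3
    rw [this]
    exact pullsBefore_startTime hU hS h1
  have hmpulls : m.pulls = (states α tie w e i).pulls := by
    rw [he, hend]
    rfl
  have hmplays : (fun k => m.pulls k - m.pullsBefore k) = plays := by
    funext k
    rw [hmbefore, hmpulls]
  -- so every choice among most played arms, with any tie-breaking, is the best arm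
  have huniq : ∀ s : Finset (Fin K), 0 ∈ s → ∀ a ∈ argmaxSet s plays, a = 0 := by
    intro s hs a ha
    by_contra hne
    have := (mem_argmaxSet.1 ha).2 0 hs
    exact absurd (hmost a hne) (not_lt.2 this)
  rw [hend]
  refine ⟨?_, ?_⟩
  · change tie.advice i m.phase (argmaxSet (playSet i m) fun k => m.pulls k - m.pullsBefore k) = 0
    rw [hmplays, hmplay]
    exact huniq _ h0 _ (tie.advice_mem _ _ _ (argmaxSet_nonempty ⟨0, h0⟩ _))
  · set o := (states α tie w (e - 1) (w.call i p)).advice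
    by_cases ho : o ∈ playSet i m
    · rw [playSet_finishPhase_of_mem ho, hmplay]; exact h0
    -- the playing set changes: the best arm is sticky or is the one of `U` and `L` that is kept
    · by_cases hst : (0 : Fin K) ∈ sticky (K := K) i
      · exact Finset.mem_union_left _ hst
      · have hUL : (0 : Fin K) ∈ ({m.U, m.L} : Finset (Fin K)) := by
          rw [hmUL]
          exact (Finset.mem_union.1 h0).resolve_left hst
        have hk : tie.keep i m.phase (argmaxSet {m.U, m.L} plays) = 0 :=
          huniq _ hUL _ (tie.keep_mem _ _ _ (argmaxSet_nonempty ⟨0, hUL⟩ _))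
        have hU' : (finishPhase tie i o m).U = 0 := by
          change (if o ∈ playSet i m then m.U else tie.keep i m.phase
            (argmaxSet {m.U, m.L} fun k => m.pulls k - m.pullsBefore k)) = 0
          rw [if_neg ho, hmplays, hk]
        refine Finset.mem_union_right _ ?_
        rw [hU']
        exact Finset.mem_insert_self _ _

/-- Agent `i` plays the best arm and recommends it, in all slots after `t`. -/
def Spreads (α : ℝ) (tie : TieBreaking N K) (w : Noise N K) (t : ℕ) (i : Fin N) : Prop :=
  ∀ t', t ≤ t' → (states α tie w t' i).advice = 0 ∧ 0 ∈ playSet i (states α tie w t' i)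

/-- All phases of all agents from phase `x + 1` on are long. -/
def LongPhases (α gap : ℝ) (w : Noise N K) (x : ℕ) : Prop :=
  ∀ i p, x + 1 ≤ p → ((stickySize N K : ℝ) + 2) *
      (1 + 4 * α / gap ^ 2 * Real.log (startTime (w.len i) (p + 1))) < w.len i p

lemma LongPhases.pos {gap : ℝ} {x : ℕ} (hα : 0 ≤ α) (h : LongPhases (K := K) α gap w x) {i : Fin N}
    {p : ℕ} (hp : x + 1 ≤ p) : 0 < w.len i p := by
  have : (0 : ℝ) < w.len i p := by
    refine lt_of_le_of_lt ?_ (h i p hp)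
    have : 0 ≤ Real.log (startTime (w.len i) (p + 1)) := Real.log_natCast_nonneg _
    positivity
  exact_mod_cast this

lemma LongPhases.unbounded {gap : ℝ} {x : ℕ} (hα : 0 ≤ α) (h : LongPhases (K := K) α gap w x)
    (i : Fin N) : Unbounded (w.len i) := by
  intro n
  refine ⟨x + 1 + (n + 1), ?_⟩
  suffices ∀ m, m ≤ startTime (w.len i) (x + 1 + m) from
    lt_of_lt_of_le (Nat.lt_succ_self n) (this _)
  intro m
  induction m with
  | zero => exact Nat.zero_le _
  | succ m ih =>
    have := h.pos hα (i := i) (p := x + 1 + m) (by omega)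
    rw [← add_assoc, startTime_succ]
    omega

/-- An agent that has the best arm at the beginning of a phase, after which all phases are long and
all confidence bounds hold, spreads it from the next phase on. -/
lemma spreads_of_mem {μ : Fin K → ℝ} (hα : 0 ≤ α) {gap : ℝ} (hgap : 0 < gap)
    (hμ : ∀ k, k ≠ 0 → gap ≤ μ 0 - μ k) {x m : ℕ} (hm : 0 < m)
    (hl : LongPhases (K := K) α gap w x) {i : Fin N}
    (hf : ∀ t, m < t → ¬ ConfFail α μ w i t) {p : ℕ} (hp : x + 1 ≤ p)
    (hmp : m ≤ startTime (w.len i) p)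
    (h0 : 0 ∈ playSet i (states α tie w (startTime (w.len i) p) i)) :
    Spreads α tie w (startTime (w.len i) (p + 1)) i := by
  have hU := fun i => hl.unbounded hα i
  have key : ∀ p', p ≤ p' → (p < p' → (states α tie w (startTime (w.len i) p') i).advice = 0) ∧
      0 ∈ playSet i (states α tie w (startTime (w.len i) p') i) := by
    intro p' hp'
    induction p', hp' using Nat.le_induction with
    | base => exact ⟨fun h => absurd h (lt_irrefl _), h0⟩
    | succ p' hp' ih =>
      have hmp' := hmp.trans (startTime_mono (w.len i) hp')
      have := good_phase hα hgap hμ hU (tie := tie) (i := i) (p := p') (by omega)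
        (hl.pos hα (by omega)) (hl i p' (by omega)) ih.2 (fun t ht _ => hf t (by omega))
      exact ⟨fun _ => this.1, this.2⟩
  intro t ht
  obtain ⟨s1, s2⟩ := phaseOf_spec (hU i) t
  set r := phaseOf (w.len i) (t + 1)
  have hr : p + 1 ≤ r := by
    by_contra hc
    push Not at hc
    have := startTime_mono (w.len i) (show r + 1 ≤ p + 1 by omega)
    omega
  obtain ⟨c1, c2, -⟩ := states_const (α := α) (tie := tie) hU s1 s2
  rw [c1, c2]
  exact ⟨(key r (by omega)).1 (by omega), (key r (by omega)).2⟩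

/-- Once all agents spread the best arm, no playing set changes. -/
lemma playSet_const_of_spreads {t : ℕ} (h : ∀ i, Spreads α tie w t i) (i : Fin N) {t' : ℕ}
    (ht : t ≤ t') : playSet i (states α tie w t' i) = playSet i (states α tie w t i) := by
  induction t', ht using Nat.le_induction with
  | base => rfl
  | succ t' ht ih =>
    rw [states_succ]
    exact (playSet_finishPhases (s := midState α tie w t' i) (a := 0) (fun p => (h _ t' ht).1)
      (h i t' ht).2 _).trans ih

/-- The coupling with rumor spreading: if along the times `v 0 ≤ v 1 ≤ …` each agent completes the
phase in progress at `v k` and one further phase before `v (k + 1)`, then the best arm spreads at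
least as fast as a rumor along the calls made at the ends of the phases in progress at the `v k`. -/
lemma spreads_of_informed [NeZero N] {μ : Fin K → ℝ} (hα : 0 ≤ α) {gap : ℝ} (hgap : 0 < gap)
    (hμ : ∀ k, k ≠ 0 → gap ≤ μ 0 - μ k) {x m : ℕ} (hm : 0 < m)
    (hl : LongPhases (K := K) α gap w x)
    (hf : ∀ i t, m < t → ¬ ConfFail α μ w i t) {v : ℕ → ℕ} (hv : Monotone v) (hmv : m ≤ v 0)
    (h0 : Spreads α tie w (v 0) 0) {n : ℕ}
    (hphase : ∀ k < n, ∀ j, x + 1 ≤ phaseOf (w.len j) (v k + 1) ∧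
      startTime (w.len j) (phaseOf (w.len j) (v k + 1) + 2) ≤ v (k + 1))
    {k : ℕ} (hk : k ≤ n) {j : Fin N}
    (hj : j ∈ informed (fun k j => w.call j (phaseOf (w.len j) (v k + 1))) k) :
    Spreads α tie w (v k) j := by
  have hU := fun i => hl.unbounded hα i
  induction k generalizing j with
  | zero =>
    simp only [informed, Finset.mem_singleton] at hj
    subst hj
    exact h0
  | succ k ih =>
    simp only [informed, Finset.mem_union, Finset.mem_filter, Finset.mem_univ, true_and] at hj
    rcases hj with hj | hj
    · intro t ht
      exact ih (by omega) hj t ((hv (Nat.le_succ k)).trans ht)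
    · obtain ⟨hx, hle⟩ := hphase k (by omega) j
      obtain ⟨s1, s2⟩ := phaseOf_spec (hU j) (v k)
      have hc := ih (by omega) hj
      set r := phaseOf (w.len j) (v k + 1)
      have hmem := mem_playSet_phase_end (α := α) (tie := tie) hU (i := j) (p := r)
        (hl.pos hα hx) (hl.pos hα (by omega))
      rw [(hc (startTime (w.len j) (r + 1) - 1) (by omega)).1] at hmem
      have hs := spreads_of_mem hα hgap hμ hm hl (hf j) (p := r + 1) (by omega)
        (by have := hv (Nat.zero_le k); omega) hmem
      intro t ht
      exact hs t (hle.trans ht)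

end Dynamics

/-! ### Decomposition of the regret -/

section Decomposition

variable {N K : ℕ} [NeZero K] {α : ℝ} {tie : TieBreaking N K} {w : Noise N K}

/-- From slot `t` on the playing set of agent `i` is frozen and contains the best arm. -/
def Settled (α : ℝ) (tie : TieBreaking N K) (w : Noise N K) (i : Fin N) (t : ℕ) : Prop :=
  ∀ t', t ≤ t' → 0 ∈ playSet i (states α tie w t' i) ∧
    playSet i (states α tie w t' i) = playSet i (states α tie w t i)

lemma Settled.mono {i : Fin N} {t t' : ℕ} (h : Settled α tie w i t) (ht : t ≤ t') :
    Settled α tie w i t' := fun s hs =>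
  ⟨(h s (ht.trans hs)).1, (h s (ht.trans hs)).2.trans (h t' ht).2.symm⟩

lemma settled_of_spreads {t : ℕ} (h : ∀ i, Spreads α tie w t i) (i : Fin N) :
    Settled α tie w i t := fun t' ht =>
  ⟨(h i t' ht).2, playSet_const_of_spreads h i ht⟩

/-- The inverse gaps of at most `n` suboptimal arms sum up to at most the inverse gaps of the `n`
best suboptimal arms. -/
lemma sum_inv_gap_le {μ : Fin K → ℝ} (hμ : IsArmMeans μ) {n : ℕ} {s : Finset (Fin K)}
    (hs : ∀ k ∈ s, k ≠ 0) (hn : s.card ≤ n) :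
    ∑ k ∈ s, 1 / (μ 0 - μ k) ≤
      ∑ k : Fin K with 1 ≤ k.val ∧ k.val ≤ n, 1 / (μ 0 - μ k) := by
  classical
  set G : Finset (Fin K) := Finset.univ.filter fun k => 1 ≤ k.val ∧ k.val ≤ n with hG
  have hpos : ∀ k : Fin K, k ≠ 0 → 1 ≤ k.val := fun k hk => by
    have : k.val ≠ 0 := fun h => hk (Fin.ext (by simpa using h))
    omega
  have hne : ∀ k ∈ G, k ≠ 0 := by
    rintro k hk rfl
    simp [hG] at hk
  have hnn : ∀ k : Fin K, k ≠ 0 → 0 ≤ 1 / (μ 0 - μ k) := fun k hk => by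
    have := hμ.best k hk
    exact one_div_nonneg.2 (by linarith)
  rw [← Finset.sum_inter_add_sum_sdiff s G, ← Finset.sum_inter_add_sum_sdiff G s,
    Finset.inter_comm G s]
  -- exchange the arms outside the `n` best ones for arms among them, with smaller gaps
  refine add_le_add le_rfl ?_
  by_cases hnK : K ≤ n + 1
  · have : s \ G = ∅ := by
      rw [Finset.sdiff_eq_empty_iff_subset]
      intro k hk
      have := k.isLt
      simp only [hG, Finset.mem_filter, Finset.mem_univ, true_and]
      exact ⟨hpos k (hs k hk), by omega⟩
    rw [this, Finset.sum_empty]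
    exact Finset.sum_nonneg fun k hk => hnn k (hne k (Finset.mem_sdiff.1 hk).1)
  push Not at hnK
  rcases Nat.eq_zero_or_pos n with rfl | hn0
  · have : s = ∅ := Finset.card_eq_zero.1 (by omega)
    subst this
    simpa using Finset.sum_nonneg fun k hk => hnn k (hne k hk)
  set a : Fin K := ⟨n, by omega⟩ with ha
  have ha0 : a ≠ 0 := fun h => by
    have := congrArg Fin.val h
    simp [ha] at this
    omega
  have hcardG : G.card = n := by
    have : G = (Finset.univ : Finset (Fin n)).image
        (fun m : Fin n => (⟨m.val + 1, by omega⟩ : Fin K)) := by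
      ext k
      simp only [hG, Finset.mem_filter, Finset.mem_univ, true_and, Finset.mem_image]
      constructor
      · rintro ⟨h1, h2⟩
        exact ⟨⟨k.val - 1, by omega⟩, Fin.ext (by simp only; omega)⟩
      · rintro ⟨m, rfl⟩
        simp only
        omega
    rw [this, Finset.card_image_of_injective, Finset.card_univ, Fintype.card_fin]
    intro m m' hmm
    have := congrArg Fin.val hmm
    simp only at this
    exact Fin.ext (by omega)
  have hcard : (s \ G).card ≤ (G \ s).card := by
    have h1 := Finset.card_sdiff_add_card_inter s G
    have h2 := Finset.card_sdiff_add_card_inter G s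
    rw [Finset.inter_comm G s] at h2
    omega
  have hanti : ∀ k k' : Fin K, k ≠ 0 → k ≤ k' → 1 / (μ 0 - μ k') ≤ 1 / (μ 0 - μ k) := by
    intro k k' hk hkk
    have h1 := hμ.best k hk
    have h2 := hμ.anti hkk
    exact one_div_le_one_div_of_le (by linarith) (by linarith)
  calc ∑ k ∈ s \ G, 1 / (μ 0 - μ k) ≤ ∑ k ∈ s \ G, 1 / (μ 0 - μ a) := by
        refine Finset.sum_le_sum fun k hk => hanti a k ha0 ?_
        obtain ⟨h1, h2⟩ := Finset.mem_sdiff.1 hk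
        simp only [hG, Finset.mem_filter, Finset.mem_univ, true_and, not_and, not_le] at h2
        exact Fin.le_def.2 (h2 (hpos k (hs k h1))).le
    _ ≤ ∑ k ∈ G \ s, 1 / (μ 0 - μ a) := by
        simp only [Finset.sum_const, nsmul_eq_mul]
        have := hnn a ha0
        gcongr
    _ ≤ _ := by
        refine Finset.sum_le_sum fun k hk => ?_
        obtain ⟨h1, -⟩ := Finset.mem_sdiff.1 hk
        refine hanti k a (hne k h1) (Fin.le_def.2 ?_)
        simp only [hG, Finset.mem_filter, Finset.mem_univ, true_and] at h1
        exact h1.2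

open Classical in
/-- The regret is at most the number of slots before the playing set is frozen, plus the number of
slots with violated confidence bounds, plus the regret of UCB on the frozen playing set. -/
lemma regret_le {μ : Fin K → ℝ} (hμ : IsArmMeans μ) (hα : 0 ≤ α) (i : Fin N) (T : ℕ) :
    regret α μ tie w i T ≤
      ∑ t ∈ Finset.range T, (if Settled α tie w i t then (0 : ℝ) else 1) +
      ∑ t ∈ Finset.range T, (if ConfFail α μ w i (t + 1) then (1 : ℝ) else 0) +
      (stickySize N K + 1 : ℕ) +
      (∑ k : Fin K with 1 ≤ k.val ∧ k.val ≤ stickySize N K + 1, 1 / (μ 0 - μ k)) *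
        (4 * α * Real.log T) := by
  have hgap : ∀ k : Fin K, μ 0 - μ k ≤ 1 := fun k => by linarith [hμ.nonneg k, hμ.lt_one]
  have hgap0 : ∀ k : Fin K, 0 ≤ μ 0 - μ k := fun k => by
    linarith [hμ.anti (Fin.zero_le k)]
  have hlogT : 0 ≤ Real.log T := Real.log_natCast_nonneg _
  have hG0 : 0 ≤ ∑ k : Fin K with 1 ≤ k.val ∧ k.val ≤ stickySize N K + 1, 1 / (μ 0 - μ k) :=
    Finset.sum_nonneg fun k _ => one_div_nonneg.2 (hgap0 k)
  -- if the playing set is not frozen before `T`, the first sum alone bounds the regret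
  by_cases hex : ∃ t₀ < T, Settled α tie w i t₀
  swap
  · push Not at hex
    have h1 : regret α μ tie w i T ≤
        ∑ t ∈ Finset.range T, (if Settled α tie w i t then (0 : ℝ) else 1) := by
      refine Finset.sum_le_sum fun t ht => ?_
      rw [if_neg (hex t (Finset.mem_range.1 ht))]
      exact hgap _
    have h2 : 0 ≤ ∑ t ∈ Finset.range T, (if ConfFail α μ w i (t + 1) then (1 : ℝ) else 0) :=
      Finset.sum_nonneg fun t _ => by split_ifs <;> norm_num
    have h3 : (0 : ℝ) ≤ (stickySize N K + 1 : ℕ) := Nat.cast_nonneg _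
    have h4 := mul_nonneg hG0 (by positivity : 0 ≤ 4 * α * Real.log T)
    linarith
  obtain ⟨t₀, ht₀, hset⟩ := hex
  set S := (playSet i (states α tie w t₀ i)).erase 0 with hS
  have h0S : 0 ∈ playSet i (states α tie w t₀ i) := (hset t₀ le_rfl).1
  have hplay : ∀ t, Settled α tie w i t →
      playSet i (states α tie w t i) = playSet i (states α tie w t₀ i) := by
    intro t ht
    rcases le_total t t₀ with h | h
    · exact ((ht t₀ h).2).symm
    · exact (hset t h).2
  have hcardS : S.card ≤ stickySize N K + 1 := by
    rw [hS, Finset.card_erase_of_mem h0S]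
    have := card_playSet_le i (states α tie w t₀ i)
    omega
  set good : Fin K → ℕ → Prop := fun k t =>
    Settled α tie w i t ∧ ¬ ConfFail α μ w i (t + 1) ∧ armAt α tie w t i = k with hgood
  have hpt : ∀ t, μ 0 - μ (armAt α tie w t i) ≤
      (if Settled α tie w i t then (0 : ℝ) else 1) +
      (if ConfFail α μ w i (t + 1) then (1 : ℝ) else 0) +
      ∑ k ∈ S, (if good k t then μ 0 - μ k else 0) := by
    intro t
    have h3 : 0 ≤ ∑ k ∈ S, (if good k t then μ 0 - μ k else 0) :=
      Finset.sum_nonneg fun k _ => by split_ifs; exacts [hgap0 k, le_rfl]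
    by_cases h1 : Settled α tie w i t
    swap
    · rw [if_neg h1]
      have := hgap (armAt α tie w t i)
      split_ifs <;> linarith
    by_cases h2 : ConfFail α μ w i (t + 1)
    · rw [if_pos h1, if_pos h2]
      have := hgap (armAt α tie w t i)
      linarith
    rw [if_pos h1, if_neg h2]
    by_cases ha : armAt α tie w t i = 0
    · have : μ (armAt α tie w t i) = μ 0 := congrArg μ ha
      linarith
    have hmem : armAt α tie w t i ∈ S :=
      Finset.mem_erase.2 ⟨ha, by rw [← hplay t h1]; exact armAt_mem t i⟩
    have := Finset.single_le_sum (f := fun k => if good k t then μ 0 - μ k else 0)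
      (fun k _ => by split_ifs; exacts [hgap0 k, le_rfl]) hmem
    rw [if_pos (show good _ t from ⟨h1, h2, rfl⟩)] at this
    linarith
  have hcount : ∀ k ∈ S, ∑ t ∈ Finset.range T, (if good k t then μ 0 - μ k else 0) ≤
      1 + 1 / (μ 0 - μ k) * (4 * α * Real.log T) := by
    intro k hk
    have hk0 : k ≠ 0 := (Finset.mem_erase.1 hk).1
    have hg : 0 < μ 0 - μ k := by linarith [hμ.best k hk0]
    set M : ℝ := 4 * α * Real.log T / (μ 0 - μ k) ^ 2 with hM
    have hM0 : 0 ≤ M := by positivity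
    -- distinct slots in which `k` is pulled have distinct pull counts, which are at most `M`
    have hc : ((Finset.range T).filter (good k)).card ≤ ⌊M⌋₊ + 1 := by
      rw [← Finset.card_range (⌊M⌋₊ + 1)]
      refine Finset.card_le_card_of_injOn (fun t => (states α tie w t i).pulls k) ?_ ?_
      · intro t ht
        obtain ⟨h1, h2, h3, h4⟩ := Finset.mem_filter.1 ht
        have h5 := pulls_le_of_armAt hα hk0 (hμ.best k hk0) (h2 t le_rfl).1 h3 h4
        have h6 : 4 * α * Real.log (t + 1 : ℕ) / (μ 0 - μ k) ^ 2 ≤ M := by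
          have : Real.log (t + 1 : ℕ) ≤ Real.log T :=
            Real.log_le_log (by positivity) (by
              have := Finset.mem_range.1 h1
              exact_mod_cast this)
          rw [hM]
          gcongr
        have := Nat.le_floor (h5.trans h6)
        simp only [Finset.coe_range, Set.mem_Iio]
        omega
      · have hlt : ∀ t t', good k t → t < t' →
            (states α tie w t i).pulls k < (states α tie w t' i).pulls k := by
          intro t t' ht htt
          have h1 := pulls_succ (α := α) (tie := tie) (w := w) t i k
          rw [if_pos ht.2.2.symm] at h1
          have h2 := pulls_mono (α := α) (tie := tie) (w := w) i k (Nat.succ_le_of_lt htt)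
          simp only [Nat.succ_eq_add_one] at h2
          omega
        intro t ht t' ht' h
        have g1 := (Finset.mem_filter.1 ht).2
        have g2 := (Finset.mem_filter.1 ht').2
        simp only at h
        rcases lt_trichotomy t t' with hl | hl | hl
        · have := hlt t t' g1 hl; omega
        · exact hl
        · have := hlt t' t g2 hl; omega
    rw [← Finset.sum_filter, Finset.sum_const, nsmul_eq_mul]
    have h7 : (((Finset.range T).filter (good k)).card : ℝ) ≤ M + 1 := by
      calc (((Finset.range T).filter (good k)).card : ℝ) ≤ ((⌊M⌋₊ + 1 : ℕ) : ℝ) := by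
            exact_mod_cast hc
        _ ≤ M + 1 := by push_cast; linarith [Nat.floor_le hM0]
    calc _ ≤ (M + 1) * (μ 0 - μ k) := by gcongr
      _ = (μ 0 - μ k) + 1 / (μ 0 - μ k) * (4 * α * Real.log T) := by
        rw [hM]; field_simp; ring
      _ ≤ _ := by linarith [hgap k]
  have hsum : ∑ k ∈ S, (1 + 1 / (μ 0 - μ k) * (4 * α * Real.log T)) ≤
      (stickySize N K + 1 : ℕ) +
      (∑ k : Fin K with 1 ≤ k.val ∧ k.val ≤ stickySize N K + 1, 1 / (μ 0 - μ k)) *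
        (4 * α * Real.log T) := by
    rw [Finset.sum_add_distrib, ← Finset.sum_mul]
    refine add_le_add ?_ ?_
    · simp only [Finset.sum_const, nsmul_eq_mul, mul_one]
      exact_mod_cast hcardS
    · refine mul_le_mul_of_nonneg_right ?_ (by positivity)
      exact sum_inv_gap_le hμ (fun k hk => (Finset.mem_erase.1 hk).1) hcardS
  calc regret α μ tie w i T
      ≤ ∑ t ∈ Finset.range T, ((if Settled α tie w i t then (0 : ℝ) else 1) +
        (if ConfFail α μ w i (t + 1) then (1 : ℝ) else 0) +
        ∑ k ∈ S, (if good k t then μ 0 - μ k else 0)) :=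
        Finset.sum_le_sum fun t _ => hpt t
    _ = ∑ t ∈ Finset.range T, (if Settled α tie w i t then (0 : ℝ) else 1) +
      ∑ t ∈ Finset.range T, (if ConfFail α μ w i (t + 1) then (1 : ℝ) else 0) +
      ∑ k ∈ S, ∑ t ∈ Finset.range T, (if good k t then μ 0 - μ k else 0) := by
        rw [Finset.sum_add_distrib, Finset.sum_add_distrib, Finset.sum_comm (s := S)]
    _ ≤ _ := by
        have := (Finset.sum_le_sum hcount).trans hsum
        linarith

end Decomposition

/-! ### Deterministic times for the rounds of the rumor -/

/-- The budget sequence, interpolated linearly on a grid of tenths: `interp A (10 * m) = A m`. -/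
noncomputable def interp (A : ℕ → ℕ) (g : ℕ) : ℝ :=
  1 + ∑ j ∈ Finset.range g, incr A (j / 10 + 1) / 10

lemma interp_succ (A : ℕ → ℕ) (g : ℕ) :
    interp A (g + 1) = interp A g + incr A (g / 10 + 1) / 10 := by
  unfold interp
  rw [Finset.sum_range_succ]
  ring

section Clock

variable {A : ℕ → ℕ} {q h : ℕ} {c : ℝ}

lemma interp_add_le (hA : IsBudget A q h c) (g n : ℕ) :
    interp A g + n * (incr A (g / 10 + 1) / 10) ≤ interp A (g + n) := by
  induction n with
  | zero => simp
  | succ n ih =>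
    rw [← add_assoc, interp_succ]
    have := hA.incr_mono (show g / 10 + 1 ≤ (g + n) / 10 + 1 by omega)
    push_cast
    linarith

lemma interp_mono (hA : IsBudget A q h c) : Monotone (interp A) :=
  monotone_nat_of_le_succ fun g => by
    rw [interp_succ]
    linarith [hA.incr_nonneg (g / 10 + 1)]

lemma interp_add (A : ℕ → ℕ) (m r : ℕ) (hr : r ≤ 10) :
    interp A (10 * m + r) = interp A (10 * m) + r * (incr A (m + 1) / 10) := by
  induction r with
  | zero => simp
  | succ r ih =>
    rw [← add_assoc, interp_succ, ih (by omega), show (10 * m + r) / 10 = m by omega]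
    push_cast
    ring

lemma interp_ten_mul (hA : IsBudget A q h c) (m : ℕ) : interp A (10 * m) = A m := by
  induction m with
  | zero => simp [interp, hA.zero]
  | succ m ih =>
    rw [show 10 * (m + 1) = 10 * m + 10 by ring, interp_add A m 10 le_rfl, ih, incr_succ]
    push_cast
    ring

/-- Over at least two unit steps the interpolated sequence gains at least the average of the next
two increments per unit. -/
lemma interp_gain (hA : IsBudget A q h c) (g : ℕ) {ρ : ℕ} (hρ : 20 ≤ ρ) :
    interp A g + ρ / 20 * (incr A (g / 10 + 1) + incr A (g / 10 + 2)) ≤ interp A (g + ρ) := by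
  have h1 := interp_add_le hA g 10
  have h2 := interp_add_le hA (g + 10) (ρ - 10)
  rw [show g + 10 + (ρ - 10) = g + ρ by omega, show (g + 10) / 10 + 1 = g / 10 + 2 by omega,
    Nat.cast_sub (by omega)] at h2
  have h3 := hA.incr_mono (show g / 10 + 1 ≤ g / 10 + 2 by omega)
  have h4 : (20 : ℝ) ≤ ρ := by exact_mod_cast hρ
  push_cast at *
  nlinarith

/-- The typical behaviour of the phase lengths of one agent at level `x`: in units of the increment
`I = A_{x+1} - A_x`, the phases do not end too early, and pairs of consecutive phases, as well as
the initial phases together, are not too long. -/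
structure TypicalLens (A : ℕ → ℕ) (D x : ℕ) (ls l₁ ξ : ℝ) (len : ℕ → ℕ) : Prop where
  lower : ∀ p, p ≤ 4 * D * x →
    ls * (A p - 2 * incr A (x + 1)) ≤ startTime len (p + 1)
  pair : ∀ p, x + 1 ≤ p → p ≤ 4 * D * x + 1 →
    (len p + len (p + 1) : ℝ) ≤ l₁ * (incr A p + incr A (p + 1)) + ξ * incr A (x + 1)
  start : (startTime len (x + 2) : ℝ) ≤ l₁ * A (x + 1) + ξ * incr A (x + 1)

/-- A phase that has begun at the envelope time with index `g` is followed by the ends of itself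
and the next phase before the envelope time with index `g + ρ`. -/
lemma TypicalLens.step (hA : IsBudget A q h c) {D x : ℕ} {ls l₁ ξ : ℝ} {len : ℕ → ℕ}
    (hlen : TypicalLens A D x ls l₁ ξ len) (hls : 0 < ls) (hl₁ : 0 ≤ l₁) (hξ : 0 ≤ ξ)
    {kk : ℝ} (hkk : 0 < kk) {ρ : ℕ} (hρ : 20 ≤ ρ) (hB : l₁ + ξ / (2 * kk) ≤ ls * (ρ / 20)) {g ψ : ℕ}
    (hg : g / 10 + 1 ≤ 4 * D * x) (hkI : kk * incr A (x + 1) ≤ incr A (g / 10 + 1))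
    (hψ : x + 1 ≤ ψ) (hS : (startTime len ψ : ℝ) ≤ ls * (interp A g - 2 * incr A (x + 1))) :
    (startTime len (ψ + 2) : ℝ) ≤ ls * (interp A (g + ρ) - 2 * incr A (x + 1)) := by
  -- otherwise phase `g / 10 + 1` would have ended before the lower envelope permits
  have hle : ψ ≤ g / 10 + 1 := by
    by_contra hc
    push Not at hc
    have h1 := hlen.lower (g / 10 + 1) hg
    have h2 : (startTime len (g / 10 + 1 + 1) : ℝ) ≤ startTime len ψ := by
      exact_mod_cast startTime_mono len (show g / 10 + 1 + 1 ≤ ψ from hc)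
    have h3 : interp A g < A (g / 10 + 1) := by
      rw [← interp_ten_mul hA (g / 10 + 1)]
      have a1 := interp_add_le hA g 1
      have a2 := interp_mono hA (show g + 1 ≤ 10 * (g / 10 + 1) by omega)
      have a3 := hA.one_le_incr (g / 10 + 1)
      push_cast at a1
      linarith
    have h4 : ls * (interp A g - 2 * incr A (x + 1)) < ls * (A (g / 10 + 1) - 2 * incr A (x + 1)) :=
      mul_lt_mul_of_pos_left (by linarith) hls
    linarith
  have h1 := hlen.pair ψ hψ (by omega)
  have h2 := interp_gain hA g hρ
  have h3 := hA.incr_mono hle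
  have h4 := hA.incr_mono (show ψ + 1 ≤ g / 10 + 2 by omega)
  have h5 := hA.incr_mono (show g / 10 + 1 ≤ g / 10 + 2 by omega)
  rw [show ψ + 2 = ψ + 1 + 1 by ring, startTime_succ, startTime_succ]
  push_cast
  set V₁ := incr A (g / 10 + 1)
  set V₂ := incr A (g / 10 + 2)
  have hV : 0 ≤ V₁ + V₂ := add_nonneg (hA.incr_nonneg _) (hA.incr_nonneg _)
  have h6 : l₁ * (incr A ψ + incr A (ψ + 1)) ≤ l₁ * (V₁ + V₂) := by gcongr
  have h7 : ξ * incr A (x + 1) ≤ ξ / (2 * kk) * (V₁ + V₂) := by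
    calc ξ * incr A (x + 1) = ξ / (2 * kk) * (kk * incr A (x + 1) + kk * incr A (x + 1)) := by
          field_simp; ring
      _ ≤ _ := by gcongr; linarith
  have h8 : (l₁ + ξ / (2 * kk)) * (V₁ + V₂) ≤ ls * (ρ / 20) * (V₁ + V₂) := by gcongr
  have h9 : ls * (interp A g + ρ / 20 * (V₁ + V₂)) ≤ ls * interp A (g + ρ) := by gcongr
  linarith

/-- The deterministic times for `n` rounds, given the admissible parameters: the envelope times
with indices `g + ρ, g + 2 ρ, …, g + (n + 1) ρ`. -/
lemma exists_clock (hA : IsBudget A q h c) {D x : ℕ} {ls l₁ ξ : ℝ}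
    (hls : 0 < ls) (hl₁ : 0 ≤ l₁) (hξ : 0 ≤ ξ)
    {kk : ℝ} (hkk : 0 < kk) {ρ : ℕ} (hρ : 20 ≤ ρ) (hB : l₁ + ξ / (2 * kk) ≤ ls * (ρ / 20))
    {g m n e : ℕ} (hkI : kk * incr A (x + 1) ≤ incr A (g / 10 + 1))
    (hm : (m : ℝ) ≤ ls * (interp A g - 2 * incr A (x + 1)))
    (hC : l₁ * A (x + 1) + ξ * incr A (x + 1) ≤ ls * (interp A (g + ρ) - 2 * incr A (x + 1)))
    (hD : g + ρ * (n + 1) ≤ 10 * e) (he : e ≤ 4 * D * x) :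
    ∃ v : ℕ → ℕ, Monotone v ∧ m ≤ v 0 ∧ (v n : ℝ) ≤ ls * A e ∧
      ∀ len : ℕ → ℕ, Unbounded len → TypicalLens A D x ls l₁ ξ len →
        (∃ y, x + 1 ≤ y ∧ m ≤ startTime len y ∧ startTime len (y + 1) ≤ v 0) ∧
        ∀ k < n, x + 1 ≤ phaseOf len (v k + 1) ∧
          startTime len (phaseOf len (v k + 1) + 2) ≤ v (k + 1) := by
  set V : ℕ → ℝ := fun g' => ls * (interp A g' - 2 * incr A (x + 1)) with hV
  have hVmono : Monotone V := fun a b hab => by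
    have := interp_mono hA hab
    simp only [hV]
    gcongr
  have hV0 : ∀ k, 0 ≤ V (g + ρ + k * ρ) := fun k =>
    (Nat.cast_nonneg m).trans (hm.trans (hVmono (by omega)))
  have hle_n : ∀ k, k < n → g + ρ + k * ρ + ρ ≤ 10 * e := by
    intro k hk
    have : ρ * (k + 1 + 1) ≤ ρ * (n + 1) := Nat.mul_le_mul_left _ (by omega)
    have e1 : ρ * (k + 1 + 1) = ρ + k * ρ + ρ := by ring
    omega
  refine ⟨fun k => ⌊V (g + ρ + k * ρ)⌋₊, ?_, ?_, ?_, ?_⟩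
  · intro a b hab
    exact Nat.floor_le_floor (hVmono (Nat.add_le_add_left (Nat.mul_le_mul_right _ hab) _))
  · exact Nat.le_floor (hm.trans (hVmono (by omega)))
  · refine (Nat.floor_le (hV0 n)).trans ?_
    simp only [hV]
    have h1 := interp_mono hA (show g + ρ + n * ρ ≤ 10 * e by
      have : ρ * (n + 1) = ρ + n * ρ := by ring
      omega)
    rw [interp_ten_mul hA] at h1
    have := hA.incr_nonneg (x + 1)
    gcongr
    linarith
  · intro len hU hlen
    have hinc : ∀ g', g ≤ g' → kk * incr A (x + 1) ≤ incr A (g' / 10 + 1) := fun g' hg' =>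
      hkI.trans (hA.incr_mono (by omega))
    refine ⟨?_, fun k hk => ?_⟩
    -- the source uses the first phase after phase `x` that begins at time `m` or later
    · have hex : ∃ y, x + 1 ≤ y ∧ m ≤ startTime len y := by
        obtain ⟨p, hp⟩ := hU m
        exact ⟨max p (x + 1), le_max_right _ _,
          hp.le.trans (startTime_mono len (le_max_left _ _))⟩
      classical
      obtain ⟨hy1, hy2⟩ := Nat.find_spec hex
      set y := Nat.find hex with hy
      refine ⟨y, hy1, hy2, Nat.le_floor ?_⟩
      rw [Nat.zero_mul, Nat.add_zero]
      rcases Nat.eq_or_lt_of_le hy1 with heq | hlt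
      · rw [← heq]
        exact hlen.start.trans hC
      · have hmin := Nat.find_min hex (m := y - 1) (by omega)
        push Not at hmin
        have h1 := hmin (by omega)
        -- phase `y - 1` begins before `m`, so the two phases `y - 1` and `y` fit into one round
        have h2 : (startTime len (y - 1) : ℝ) ≤ V g :=
          le_trans (by exact_mod_cast h1.le) hm
        have h3 := hlen.step hA hls hl₁ hξ hkk hρ hB (g := g) (ψ := y - 1)
          (by
            have : ρ ≤ ρ * (n + 1) := Nat.le_mul_of_pos_right _ (Nat.succ_pos _)
            omega) hkI (by omega) h2
        rwa [show y - 1 + 2 = y + 1 by omega] at h3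
    · have hk' := hle_n k hk
      obtain ⟨s1, s2⟩ := phaseOf_spec hU ⌊V (g + ρ + k * ρ)⌋₊
      set r := phaseOf len (⌊V (g + ρ + k * ρ)⌋₊ + 1) with hr
      have hx : x + 1 ≤ r := by
        by_contra hc
        push Not at hc
        have h1 : startTime len (x + 2) ≤ ⌊V (g + ρ + k * ρ)⌋₊ :=
          Nat.le_floor (hlen.start.trans (hC.trans (hVmono (by omega))))
        have h2 := startTime_mono len (show r + 1 ≤ x + 2 by omega)
        omega
      refine ⟨hx, Nat.le_floor ?_⟩
      have h3 : (startTime len r : ℝ) ≤ V (g + ρ + k * ρ) :=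
        le_trans (by exact_mod_cast s1) (Nat.floor_le (hV0 k))
      have h4 := hlen.step hA hls hl₁ hξ hkk hρ hB (g := g + ρ + k * ρ) (ψ := r)
        (by omega) (hinc _ (by omega)) hx h3
      rwa [show g + ρ + k * ρ + ρ = g + ρ + (k + 1) * ρ by ring] at h4

end Clock

lemma lamS_ge_mul {u : ℝ} (hu : 0 ≤ u) : 13 / 15 * (1 + u) ≤ lamS u := by
  unfold lamS
  have := cBar_le_linear hu
  linarith

/-- The exponential parameter `s` of the upper tail bounds, and the resulting slope `l₁` and
tolerance `ξ`; the slack between `l₁` and `lamS` allows rounds of length `ρ / 10`, where the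
admissible `ρ` depends on the range of `u`. The parameter is `1 / 5` for `u < 1` and `2 / 5`
otherwise. -/
lemma exists_rates {u : ℝ} (hu : 7 / 8 ≤ u) :
    ∃ s l₁ ξ : ℝ, 0 < s ∧ 0 ≤ l₁ ∧ 0 ≤ ξ ∧ (1 + u) * (Real.exp s - 1) ≤ s * l₁ ∧ s * ξ = cBar u ∧
      l₁ ≤ 1.2298 * (1 + u) ∧ ξ ≤ 2 * (1 + u) ∧
      (u < 1 → l₁ + ξ / (2 * 6) ≤ lamS u * (24 / 20)) ∧
      (u ≤ 1 → l₁ + ξ / (2 * 1) ≤ lamS u * (29 / 20)) ∧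
      (u < 3 / 2 → l₁ + ξ / (2 * 1) ≤ lamS u * (31 / 20)) ∧
      (u < 2 → l₁ + ξ / (2 * 1) ≤ lamS u * (36 / 20)) ∧
      l₁ + ξ / (2 * 1) ≤ lamS u * (40 / 20) := by
  have hu0 : 0 ≤ u := by linarith
  have hc0 := cBar_nonneg hu0
  have hc1 := cBar_le_linear hu0
  have hls := lamS_ge_mul hu0
  rcases lt_or_ge u 1 with h1 | h1
  · have hc2 : cBar u ≤ 0.112 * (1 + u) := by
      unfold cBar
      rw [div_le_iff₀ (by positivity)]
      nlinarith [mul_nonneg hu0 hu0, mul_nonneg (mul_nonneg hu0 hu0) (sub_nonneg.2 h1.le),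
        mul_nonneg hu0 (sub_nonneg.2 h1.le)]
    refine ⟨1 / 5, 1.1072 * (1 + u), 5 * cBar u, by norm_num, by positivity, by positivity, ?_,
      by ring, by linarith, by linarith, ?_, ?_, ?_, ?_, ?_⟩
    · have := exp_fifth_le
      nlinarith
    all_goals (try intro _); unfold lamS; linarith
  · refine ⟨2 / 5, 1.2298 * (1 + u), 5 / 2 * cBar u, by norm_num, by positivity, by positivity, ?_,
      by ring, le_rfl, by linarith, ?_, ?_, ?_, ?_, ?_⟩
    · have := exp_two_fifths_le
      nlinarith
    · intro h; linarith
    · intro h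
      have : u = 1 := le_antisymm h h1
      subst this
      unfold lamS cBar
      norm_num
    · intro h
      have hc2 : cBar u ≤ 0.18 * (1 + u) := by
        unfold cBar
        rw [div_le_iff₀ (by positivity)]
        have h2 : 0 ≤ 3 / 2 - u := by linarith
        nlinarith [mul_nonneg hu0 hu0, mul_nonneg (mul_nonneg hu0 hu0) h2,
          mul_nonneg hu0 h2]
      unfold lamS; linarith
    · intro h
      unfold lamS; linarith
    · unfold lamS; linarith

section Clock

variable {A : ℕ → ℕ} {q h : ℕ} {c : ℝ}

lemma cast_div_eight_le (n : ℕ) : ((n / 8 + 1 : ℕ) : ℝ) ≤ n / 8 + 1 := by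
  have : ((n / 8 : ℕ) : ℝ) ≤ (n : ℝ) / 8 := Nat.cast_div_le
  push_cast
  linarith

/-- The envelope at the index `10 * l - 19` is beyond the time from which on the confidence bounds
hold. -/
lemma source_time_le (hA : IsBudget A q h c) {ls : ℝ} (hls : 9 / 5 ≤ ls) {l x : ℕ}
    (hx : h + 1 ≤ x) (hl : x + 7 ≤ l) :
    ((max (A (l - 1) / 8 + 1) (A h) : ℕ) : ℝ) ≤
      ls * (interp A (10 * l - 19) - 2 * incr A (x + 1)) := by
  obtain ⟨b, rfl⟩ : ∃ b, l = b + 2 := ⟨l - 2, by omega⟩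
  have h1 := interp_add A b 1 (by norm_num)
  rw [interp_ten_mul hA] at h1
  have h2 := hA.add_mul_le (show x ≤ b by omega)
  have h3 : (x : ℝ) + 5 ≤ b := by exact_mod_cast (by omega : x + 5 ≤ b)
  have h4 : (A h : ℝ) ≤ A x := by exact_mod_cast hA.mono (show h ≤ x by omega)
  have h5 := hA.one_le_incr (b + 1)
  have h6 := hA.large_of_le (show h ≤ x + 1 by omega)
  have h7 := incr_succ A b
  have h8 := hA.one_le x
  have h9 := cast_div_eight_le (A (b + 1))
  rw [show 10 * (b + 2) - 19 = 10 * b + 1 by omega, h1, show b + 2 - 1 = b + 1 by omega]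
  have h10 : (5 : ℝ) * incr A (x + 1) ≤ (b - x) * incr A (x + 1) := by gcongr; linarith
  have h11 : 9 / 5 * (A b + (1 : ℕ) * (incr A (b + 1) / 10) - 2 * incr A (x + 1)) ≤
      ls * (A b + (1 : ℕ) * (incr A (b + 1) / 10) - 2 * incr A (x + 1)) := by
    apply mul_le_mul_of_nonneg_right hls
    push_cast
    linarith
  refine le_trans ?_ h11
  rw [Nat.cast_max]
  push_cast at *
  refine max_le ?_ ?_ <;> linarith

/-- If the budget increments up to `l` are comparable, the time from which on the confidence bounds
hold is already reached at the index `10 * (l - 4)`. -/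
lemma source_time_le_of_slow (hA : IsBudget A q h c) {ls : ℝ} (hls : 9 / 5 ≤ ls) {l x : ℕ}
    (hx : h + 1 ≤ x) (hl : x + 8 ≤ l) (hslow : incr A (l - 1) ≤ 6 * incr A (x + 1)) :
    ((max (A (l - 1) / 8 + 1) (A h) : ℕ) : ℝ) ≤
      ls * (interp A (10 * (l - 4)) - 2 * incr A (x + 1)) := by
  obtain ⟨b, rfl⟩ : ∃ b, l = b + 4 := ⟨l - 4, by omega⟩
  rw [show b + 4 - 1 = b + 3 by omega] at *
  have h2 := hA.add_mul_le (show x ≤ b by omega)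
  have h3 : (x : ℝ) + 4 ≤ b := by exact_mod_cast (by omega : x + 4 ≤ b)
  have h4 : (A h : ℝ) ≤ A x := by exact_mod_cast hA.mono (show h ≤ x by omega)
  have h6 := hA.large_of_le (show h ≤ x + 1 by omega)
  have h7 := incr_succ A b
  have h71 : incr A (b + 2) = A (b + 2) - A (b + 1) := rfl
  have h72 : incr A (b + 3) = A (b + 3) - A (b + 2) := rfl
  have h73 := hA.incr_mono (show b + 1 ≤ b + 3 by omega)
  have h74 := hA.incr_mono (show b + 2 ≤ b + 3 by omega)
  have h8 := hA.one_le x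
  have h9 := cast_div_eight_le (A (b + 3))
  rw [show b + 4 - 4 = b by omega, interp_ten_mul hA]
  have h10 : (4 : ℝ) * incr A (x + 1) ≤ (b - x) * incr A (x + 1) := by gcongr; linarith
  have h11 : 9 / 5 * (A b - 2 * incr A (x + 1)) ≤ ls * (A b - 2 * incr A (x + 1)) := by
    apply mul_le_mul_of_nonneg_right hls
    linarith
  refine le_trans ?_ h11
  rw [Nat.cast_max]
  refine max_le ?_ ?_ <;> linarith

/-- The first rounds begin when the phases up to `x + 1` of all agents are over. -/
lemma start_le (hA : IsBudget A q h c) {lam ls l₁ ξ : ℝ} (hlam : 0 ≤ lam)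
    (hls : 13 / 15 * lam ≤ ls) (hl₁ : l₁ ≤ 1.2298 * lam) (hξ : ξ ≤ 2 * lam)
    {x a g : ℕ} (ha : x + 7 ≤ a) (ha' : 4 * x + 1 ≤ a) (hx : 2 ≤ x) (hg : 10 * a ≤ g) :
    l₁ * A (x + 1) + ξ * incr A (x + 1) ≤ ls * (interp A g - 2 * incr A (x + 1)) := by
  have h1 := interp_mono hA hg
  rw [interp_ten_mul hA] at h1
  have h2 := hA.add_mul_le (show x + 1 ≤ a by omega)
  have h3 := hA.incr_mono (show x + 1 ≤ x + 1 + 1 by omega)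
  have h4 := hA.le_incr_mul (x + 1)
  have h5 := hA.one_le (x + 1)
  set I := incr A (x + 1) with hI
  have hI1 : 1 ≤ I := hA.one_le_incr _
  have hax : (x : ℝ) + 7 ≤ a := by exact_mod_cast ha
  have hax' : 4 * (x : ℝ) + 1 ≤ a := by exact_mod_cast ha'
  have hx2 : (2 : ℝ) ≤ x := by exact_mod_cast hx
  have h6 : (A (x + 1) : ℝ) + (a - x - 3) * I ≤ interp A g - 2 * I := by
    have : ((a : ℝ) - ((x + 1 : ℕ) : ℝ)) * I ≤ (a - ((x + 1 : ℕ) : ℝ)) * incr A (x + 1 + 1) := by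
      apply mul_le_mul_of_nonneg_left h3
      push_cast; linarith
    push_cast at *
    linarith
  push_cast at h4
  have h7 : 0 ≤ (A (x + 1) : ℝ) + (a - x - 3) * I := by
    have : 0 ≤ ((a : ℝ) - x - 3) * I := mul_nonneg (by linarith) (by linarith)
    linarith
  have hnum : 0.36314 * ((x : ℝ) + 2) + 2 ≤ 13 / 15 * (a - x - 3) := by
    by_cases h2x : x = 2
    · subst h2x; push_cast at *; linarith
    · have : (3 : ℝ) ≤ x := by exact_mod_cast (by omega : 3 ≤ x)
      linarith
  have hI0 : 0 ≤ I := by linarith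
  have h10 : (0.36314 * ((x : ℝ) + 2) + 2) * I ≤ 13 / 15 * (a - x - 3) * I := by gcongr
  have h11 : 1.2298 * (A (x + 1) : ℝ) + 2 * I ≤ 13 / 15 * ((A (x + 1) : ℝ) + (a - x - 3) * I) := by
    nlinarith
  calc l₁ * A (x + 1) + ξ * I ≤ 1.2298 * lam * A (x + 1) + 2 * lam * I := by gcongr
    _ = lam * (1.2298 * (A (x + 1) : ℝ) + 2 * I) := by ring
    _ ≤ lam * (13 / 15 * ((A (x + 1) : ℝ) + (a - x - 3) * I)) := by gcongr
    _ = 13 / 15 * lam * ((A (x + 1) : ℝ) + (a - x - 3) * I) := by ring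
    _ ≤ ls * ((A (x + 1) : ℝ) + (a - x - 3) * I) := by gcongr
    _ ≤ _ := by
      have : 0 ≤ ls := le_trans (by positivity) hls
      gcongr

/-- The deterministic times for the block of slots with index `l`: the rumor has
`(l - 1) / ⌊2 + δ⌋` rounds, started after the time from which on the confidence bounds hold. -/
lemma exists_clock_of_block (hA : IsBudget A q h c) {δ : ℝ} (hδ : 7 / 4 ≤ δ) :
    ∃ s l₁ ξ : ℝ, 0 < s ∧ 0 ≤ l₁ ∧ 0 ≤ ξ ∧
      (1 + δ / 2) * (Real.exp s - 1) ≤ s * l₁ ∧ s * ξ = cBar (δ / 2) ∧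
      ∀ l x : ℕ, h + 1 ≤ x → 2 * ⌈2 + δ⌉₊ * (x - 1) + 1 ≤ l → l ≤ 2 * ⌈2 + δ⌉₊ * x →
        ∃ v : ℕ → ℕ, Monotone v ∧ max (A (l - 1) / 8 + 1) (A h) ≤ v 0 ∧
          (v ((l - 1) / ⌊2 + δ⌋₊) : ℝ) ≤ lamS (δ / 2) * A (2 * l - 2) ∧
          ∀ len : ℕ → ℕ, Unbounded len →
            TypicalLens A ⌈2 + δ⌉₊ x (lamS (δ / 2)) l₁ ξ len →
            (∃ y, x + 1 ≤ y ∧ max (A (l - 1) / 8 + 1) (A h) ≤ startTime len y ∧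
              startTime len (y + 1) ≤ v 0) ∧
            ∀ k < (l - 1) / ⌊2 + δ⌋₊, x + 1 ≤ phaseOf len (v k + 1) ∧
              startTime len (phaseOf len (v k + 1) + 2) ≤ v (k + 1) := by
  have hu : 7 / 8 ≤ δ / 2 := by linarith
  obtain ⟨s, l₁, ξ, hs, hl₁, hξ, hexp, hsξ, hl₁', hξ', r24, r29, r31, r36, r40⟩ := exists_rates hu
  refine ⟨s, l₁, ξ, hs, hl₁, hξ, hexp, hsξ, fun l x hx hl1 hl2 => ?_⟩
  have hls := lamS_lower hu
  have hls' := lamS_ge_mul (u := δ / 2) (by linarith)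
  have hlam : (0 : ℝ) ≤ 1 + δ / 2 := by linarith
  have hx2 : 2 ≤ x := by have := hA.h_pos; omega
  set D := ⌈2 + δ⌉₊ with hD
  set F := ⌊2 + δ⌋₊ with hF
  have hD4 : 4 ≤ D := by
    have : ((3 : ℕ) : ℝ) < 2 + δ := by push_cast; linarith
    exact Nat.lt_ceil.2 this
  have hF3 : 3 ≤ F := Nat.le_floor (by push_cast; linarith)
  have h8 : 8 * (x - 1) + 1 ≤ l := by
    have : 8 * (x - 1) ≤ 2 * D * (x - 1) := Nat.mul_le_mul_right _ (by omega)
    omega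
  have he : 2 * l - 2 ≤ 4 * D * x := by
    have : 4 * D * x = 2 * (2 * D * x) := by ring
    omega
  have hn : ∀ F', F' ≤ F → 0 < F' → (l - 1) / F ≤ (l - 1) / F' := fun F' h1 h2 =>
    Nat.div_le_div_left h1 h2
  by_contra hgoal
  -- except in one case, the clock starts at `g = 10 l - 19`; only the round length `ρ / 10` varies
  have fast : ∀ (ρ : ℕ) (kk : ℝ), 0 < kk → 29 ≤ ρ ∨ (20 ≤ ρ ∧ 10 ≤ l) →
      l₁ + ξ / (2 * kk) ≤ lamS (δ / 2) * (ρ / 20) → kk * incr A (x + 1) ≤ incr A (l - 1) →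
      10 * l - 19 + ρ * ((l - 1) / F + 1) ≤ 10 * (2 * l - 2) → False := by
    intro ρ kk hkk hρ hB hkI hD'
    refine hgoal (exists_clock hA (D := D) (x := x) (by linarith) hl₁ hξ hkk (by omega) hB
      (g := 10 * l - 19) ?_ (source_time_le hA hls hx (by omega)) ?_ hD' he)
    · rwa [show (10 * l - 19) / 10 + 1 = l - 1 by omega]
    · exact start_le hA hlam hls' hl₁' hξ' (a := if l = 9 then l + 1 else l)
        (by split_ifs <;> omega) (by split_ifs <;> omega) hx2 (by split_ifs <;> omega)
  have hI1 : 1 * incr A (x + 1) ≤ incr A (l - 1) := by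
    rw [one_mul]; exact hA.incr_mono (by omega)
  have hD2 : D ≤ 4 ∨ 11 ≤ l := by
    by_cases h : D ≤ 4
    · exact Or.inl h
    · right
      have : 2 * 5 * (x - 1) ≤ 2 * D * (x - 1) := Nat.mul_le_mul_right _ (by omega)
      omega
  have hδD : δ ≤ (D : ℝ) - 2 := by linarith [Nat.le_ceil (2 + δ)]
  -- for `l = 9`, the least possible index, necessarily `⌈2 + δ⌉ = 4`
  by_cases h9 : l = 9
  · have hD4' : D = 4 := by omega
    have hδ2 : δ ≤ 2 := by rw [hD4'] at hδD; push_cast at hδD; linarith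
    refine fast 29 1 one_pos (Or.inl le_rfl) ?_ hI1 ?_
    · have := r29 (by linarith); push_cast; linarith
    · have := hn 3 hF3 (by norm_num)
      subst h9
      omega
  have h10 : 10 ≤ l := by omega
  rcases lt_or_ge δ 2 with hδ2 | hδ2
  · have hn3 := hn 3 hF3 (by norm_num)
    -- a fast growth of the increments makes the term `ξ` negligible, which allows shorter rounds
    by_cases hfast : 6 * incr A (x + 1) ≤ incr A (l - 1)
    · refine fast 24 6 (by norm_num) (Or.inr ⟨by norm_num, h10⟩) ?_ hfast (by omega)
      have := r24 (by linarith); push_cast; linarith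
    · push Not at hfast
      refine hgoal (exists_clock hA (D := D) (x := x) (by linarith) hl₁ hξ one_pos (ρ := 30)
        (by norm_num) ?_ (g := 10 * (l - 4)) ?_
        (source_time_le_of_slow hA hls hx (by omega) hfast.le) ?_ (by omega) he)
      · have := r29 (by linarith)
        push_cast
        linarith
      · rw [one_mul]
        exact hA.incr_mono (by omega)
      · exact start_le hA hlam hls' hl₁' hξ' (a := l - 1)
          (by omega) (by omega) hx2 (by omega)
  · have hF4 : 4 ≤ F := Nat.le_floor (by push_cast; linarith)
    rcases lt_or_ge δ 3 with hδ3 | hδ3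
    · refine fast 31 1 one_pos (Or.inl (by norm_num)) ?_ hI1 ?_
      · have := r31 (by linarith); push_cast; linarith
      · have := hn 4 hF4 (by norm_num)
        omega
    have hF5 : 5 ≤ F := Nat.le_floor (by push_cast; linarith)
    have hD5 : 5 ≤ D := (Nat.floor_le_ceil _).trans' hF5
    rcases lt_or_ge δ 4 with hδ4 | hδ4
    · refine fast 36 1 one_pos (Or.inl (by norm_num)) ?_ hI1 ?_
      · have := r36 (by linarith); push_cast; linarith
      · have := hn 5 hF5 (by norm_num)
        omega
    · have hF6 : 6 ≤ F := Nat.le_floor (by push_cast; linarith)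
      refine fast 40 1 one_pos (Or.inl (by norm_num)) ?_ hI1 ?_
      · push_cast; linarith
      · have := hn 6 hF6 (by norm_num)
        omega

end Clock

/-! ### Tail bounds for the phase lengths -/

section Poisson

variable {Ω : Type*} [MeasurableSpace Ω] {Pr : Measure Ω}

open scoped Nat in
/-- The exponential moments of the Poisson distribution. -/
lemma lintegral_exp_poissonMeasure (r : ℝ≥0) (θ : ℝ) :
    ∫⁻ n : ℕ, ENNReal.ofReal (Real.exp (θ * n)) ∂(poissonMeasure r) =
      ENNReal.ofReal (Real.exp (r * (Real.exp θ - 1))) := by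
  rw [lintegral_countable']
  have hsum : HasSum (fun n : ℕ => Real.exp (-r) * ((r * Real.exp θ) ^ n / n !))
      (Real.exp (-r) * Real.exp (r * Real.exp θ)) := by
    have := (NormedSpace.expSeries_div_hasSum_exp ((r : ℝ) * Real.exp θ)).mul_left (Real.exp (-r))
    rwa [← Real.exp_eq_exp_ℝ] at this
  have e1 : ∀ n : ℕ, ENNReal.ofReal (Real.exp (θ * n)) * poissonMeasure r {n} =
      ENNReal.ofReal (Real.exp (-r) * ((r * Real.exp θ) ^ n / n !)) := by
    intro n
    rw [poissonMeasure_singleton, ← ENNReal.ofReal_mul (Real.exp_pos _).le]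
    congr 1
    rw [mul_comm θ, Real.exp_nat_mul]
    ring
  simp_rw [e1]
  rw [← ENNReal.ofReal_tsum_of_nonneg (fun n => by positivity) hsum.summable, hsum.tsum_eq,
    ← Real.exp_add]
  congr 2
  ring

/-- Chernoff's inequality for linear combinations of independent Poisson variables. -/
lemma poisson_chernoff {ι : Type*} {X : ι → Ω → ℕ} (hm : ∀ y, Measurable (X y))
    (hi : iIndepFun X Pr) {r : ι → ℝ} (hr : ∀ y, 0 ≤ r y)
    (hl : ∀ y, Pr.map (X y) = poissonMeasure (Real.toNNReal (r y)))
    (s : Finset ι) (θ : ι → ℝ) (b : ℝ) :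
    Pr {ω | b ≤ ∑ y ∈ s, θ y * X y ω} ≤
      ENNReal.ofReal (Real.exp (-b + ∑ y ∈ s, r y * (Real.exp (θ y) - 1))) := by
  set f : ι → Ω → ℝ≥0∞ := fun y ω => ENNReal.ofReal (Real.exp (θ y * X y ω)) with hf
  have hg : ∀ y, Measurable fun n : ℕ => ENNReal.ofReal (Real.exp (θ y * n)) :=
    fun y => measurable_from_nat
  have hfm : ∀ y, Measurable (f y) := fun y => (hg y).comp (hm y)
  have hfi : iIndepFun f Pr := hi.comp (fun y (n : ℕ) => ENNReal.ofReal (Real.exp (θ y * n))) hg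
  have hint : ∫⁻ ω, ∏ y ∈ s, f y ω ∂Pr =
      ENNReal.ofReal (Real.exp (∑ y ∈ s, r y * (Real.exp (θ y) - 1))) := by
    rw [lintegral_prod_eq_prod_lintegral_of_indepFun s f hfi hfm, Real.exp_sum,
      ENNReal.ofReal_prod_of_nonneg (fun y _ => (Real.exp_pos _).le)]
    refine Finset.prod_congr rfl fun y _ => ?_
    have := lintegral_map (μ := Pr) (hg y) (hm y)
    rw [hl y, lintegral_exp_poissonMeasure, Real.coe_toNNReal _ (hr y)] at this
    exact this.symm
  have hmk := mul_meas_ge_le_lintegral (μ := Pr) (f := fun ω => ∏ y ∈ s, f y ω)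
    (Finset.measurable_prod _ fun y _ => hfm y) (ENNReal.ofReal (Real.exp b))
  rw [hint] at hmk
  have hsub : {ω | b ≤ ∑ y ∈ s, θ y * X y ω} ⊆
      {ω | ENNReal.ofReal (Real.exp b) ≤ ∏ y ∈ s, f y ω} := by
    intro ω hω
    have hω' : b ≤ ∑ y ∈ s, θ y * X y ω := hω
    change ENNReal.ofReal (Real.exp b) ≤ ∏ y ∈ s, f y ω
    simp only [hf]
    rw [← ENNReal.ofReal_prod_of_nonneg (fun y _ => (Real.exp_pos _).le), ← Real.exp_sum]
    exact ENNReal.ofReal_le_ofReal (Real.exp_le_exp.2 hω')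
  refine (measure_mono hsub).trans ?_
  rw [Real.exp_add, ENNReal.ofReal_mul (Real.exp_pos _).le, Real.exp_neg,
    ENNReal.ofReal_inv_of_pos (Real.exp_pos _), ← ENNReal.div_eq_inv_mul]
  rw [ENNReal.le_div_iff_mul_le (Or.inl (by simp [Real.exp_pos])) (Or.inl ENNReal.ofReal_ne_top),
    mul_comm]
  exact hmk

/-- The phase lengths of one agent: independent Poisson variables whose means are `1 + u` times the
increments of the budget. -/
structure IsLens (Pr : Measure Ω) (A : ℕ → ℕ) (u : ℝ) (len : Ω → ℕ → ℕ) : Prop where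
  measurable : ∀ y, Measurable fun ω => len ω y
  indep : iIndepFun (fun y ω => len ω y) Pr
  law : ∀ y, Pr.map (fun ω => len ω y) = poissonMeasure (Real.toNNReal ((1 + u) * incr A y))

variable {A : ℕ → ℕ} {q h : ℕ} {c u : ℝ} {len : Ω → ℕ → ℕ}

lemma IsLens.chernoff (hlen : IsLens Pr A u len) (hA : IsBudget A q h c) (hu : 0 ≤ u)
    (s : Finset ℕ) (θ : ℕ → ℝ) {b e : ℝ}
    (he : -b + ∑ y ∈ s, (1 + u) * incr A y * (Real.exp (θ y) - 1) ≤ e) :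
    Pr {ω | b ≤ ∑ y ∈ s, θ y * len ω y} ≤ ENNReal.ofReal (Real.exp e) :=
  (poisson_chernoff hlen.measurable hlen.indep
    (fun y => mul_nonneg (by linarith) (hA.incr_nonneg y)) hlen.law s θ b).trans
    (ENNReal.ofReal_le_ofReal (Real.exp_le_exp.2 he))

/-- A phase ends before the lower envelope, shifted by `2 * I`, with small probability. -/
lemma IsLens.prob_early (hlen : IsLens Pr A u len) (hA : IsBudget A q h c) (hu : 7 / 8 ≤ u)
    (p : ℕ) (I : ℝ) :
    Pr {ω | ¬ lamS u * (A p - 2 * I) ≤ startTime (len ω) (p + 1)} ≤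
      ENNReal.ofReal (Real.exp (-(cBar u * I))) := by
  have hls : 0 < lamS u := by linarith [lamS_lower hu]
  set s := cBar u / (2 * lamS u) with hs
  have hs0 : 0 < s := div_pos (cBar_pos (by linarith)) (by linarith)
  have h2 : 2 * (s * lamS u) = cBar u := by rw [hs]; field_simp
  have hpar := lower_tail_param hu
  refine le_trans (measure_mono fun ω hω => ?_)
    (hlen.chernoff hA (by linarith) (Finset.range (p + 1)) (fun _ => -s)
      (b := -s * (lamS u * (A p - 2 * I))) ?_)
  · have hω' : (startTime (len ω) (p + 1) : ℝ) ≤ lamS u * (A p - 2 * I) := (not_le.1 hω).le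
    change (_ : ℝ) ≤ _
    rw [← Finset.mul_sum]
    have e : (startTime (len ω) (p + 1) : ℝ) = ∑ y ∈ Finset.range (p + 1), (len ω y : ℝ) := by
      unfold startTime; push_cast; rfl
    rw [← e]
    nlinarith
  · have e : ∑ y ∈ Finset.range (p + 1), (1 + u) * incr A y * (Real.exp (-s) - 1) =
        (1 + u) * A p * (Real.exp (-s) - 1) := by
      rw [← Finset.sum_mul, ← Finset.mul_sum, hA.sum_incr]
    rw [e, ← h2]
    have : lamS u * s * A p ≤ (1 + u) * (1 - Real.exp (-s)) * A p :=
      mul_le_mul_of_nonneg_right hpar (Nat.cast_nonneg _)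
    nlinarith

/-- The phases with indices in `Y` are too long in total with small probability. -/
lemma IsLens.prob_late (hlen : IsLens Pr A u len) (hA : IsBudget A q h c) (hu : 0 ≤ u)
    {s l₁ ξ : ℝ} (hs : 0 < s) (hexp : (1 + u) * (Real.exp s - 1) ≤ s * l₁)
    (hsξ : s * ξ = cBar u) (Y : Finset ℕ) (I : ℝ) :
    Pr {ω | ¬ ∑ y ∈ Y, (len ω y : ℝ) ≤ l₁ * ∑ y ∈ Y, incr A y + ξ * I} ≤
      ENNReal.ofReal (Real.exp (-(cBar u * I))) := by
  refine le_trans (measure_mono fun ω hω => ?_)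
    (hlen.chernoff hA hu Y (fun _ => s) (b := s * (l₁ * ∑ y ∈ Y, incr A y + ξ * I)) ?_)
  · have hω' := (not_le.1 hω).le
    change (_ : ℝ) ≤ _
    rw [← Finset.mul_sum]
    gcongr
  · rw [← Finset.sum_mul, ← Finset.mul_sum, ← hsξ]
    have h0 : 0 ≤ ∑ y ∈ Y, incr A y := Finset.sum_nonneg fun y _ => hA.incr_nonneg y
    have := mul_le_mul_of_nonneg_right hexp h0
    nlinarith

lemma exp_le_quadratic {z : ℝ} (h0 : 0 ≤ z) (h1 : z ≤ 1) : Real.exp z - 1 ≤ z * (1 + z) := by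
  have := Real.abs_exp_sub_one_sub_id_le (x := z) (by rwa [abs_of_nonneg h0])
  have := (abs_le.1 this).2
  nlinarith

/-- A phase is too short for the UCB estimates with small probability. The logarithm of its end
time is bounded by a linear function of the end time, which turns this into an event about a linear
combination of the phase lengths. -/
lemma IsLens.prob_short (hlen : IsLens Pr A u len) (hA : IsBudget A q h c) (hu : 7 / 8 ≤ u)
    {p : ℕ} (hp : h + 2 ≤ p) :
    Pr {ω | ¬ ((q : ℝ) + 2) * (1 + c * Real.log (startTime (len ω) (p + 1))) < len ω p} ≤
      ENNReal.ofReal (Real.exp (-(cBar u * incr A p))) := by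
  set C : ℝ := ((q : ℝ) + 2) * c with hC
  have hC0 : 0 < C := by have := hA.c_ge; positivity
  set X := incr A p with hX
  set a := Real.log (A p) with ha
  have hAp0 : (0 : ℝ) < A p := by exact_mod_cast hA.pos p
  have ha1 : 6.2 ≤ a := by
    refine log_540_ge.trans (Real.log_le_log (by norm_num) ?_)
    have h1 := hA.large_add 2
    have h2 : (A (h + 2) : ℝ) ≤ A p := by exact_mod_cast hA.mono hp
    push_cast at h1
    linarith
  have hlong : ((q : ℝ) + 2) + C * a ≤ X := by
    have := hA.long p (by omega)
    rw [hC]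
    linarith
  have hX0 : 0 < X := by
    have : 0 ≤ C * a := by positivity
    have h2 : (0 : ℝ) < (q : ℝ) + 2 := by positivity
    linarith
  have hXA : X ≤ A p := incr_le_self A p
  have hlam : 0 < 1 + u := by linarith
  have hlog1 : 0 ≤ Real.log (1 + u) := Real.log_nonneg (by linarith)
  set ε := C / ((1 + u) * A p) with hε
  have hε0 : 0 ≤ ε := by positivity
  have hε1 : ε ≤ 1 / 10 := by
    rw [hε, div_le_iff₀ (by positivity)]
    have h1 : C * 6.2 ≤ A p := by
      have : C * 6.2 ≤ C * a := by gcongr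
      have h2 : (0 : ℝ) < (q : ℝ) + 2 := by positivity
      linarith
    have h2 : (1.875 : ℝ) * (C * 6.2) ≤ (1 + u) * A p := by
      apply mul_le_mul _ h1 (by positivity) hlam.le
      linarith
    linarith
  have hεA : ε * ((1 + u) * A p) = C := by rw [hε]; field_simp
  obtain ⟨s, hs0, hs1, hs⟩ := short_phase_param hu ha1 hC0.le
    (show C * a ≤ X by have h2 : (0 : ℝ) < (q : ℝ) + 2 := by positivity
                       linarith) hε1
  refine le_trans (measure_mono fun ω hω => ?_)
    (hlen.chernoff hA (by linarith) (Finset.range (p + 1))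
      -- the end time, with its coefficient in the linearised logarithm, is the sum of all lengths
      (fun y => if y = p then -(s * (1 - ε)) else s * ε)
      (b := -(s * (((q : ℝ) + 2) + C * (a + Real.log (1 + u) - 1)))) ?_)
  · have hω' : (len ω p : ℝ) ≤
        ((q : ℝ) + 2) * (1 + c * Real.log (startTime (len ω) (p + 1))) := not_lt.1 hω
    set T : ℝ := (startTime (len ω) (p + 1) : ℝ) with hT
    have hT0 : 0 ≤ T := Nat.cast_nonneg _
    -- tangent of the logarithm at the mean `(1 + u) * A p`; for `T = 0` the logarithm is `0`
    have hlogT : Real.log T ≤ a + T / ((1 + u) * A p) + Real.log (1 + u) - 1 := by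
      rcases hT0.eq_or_lt with h0 | h0
      · rw [← h0, Real.log_zero]
        simp only [zero_div]
        linarith
      · have h1 := Real.log_le_sub_one_of_pos (x := T / ((1 + u) * A p)) (by positivity)
        rw [Real.log_div h0.ne' (by positivity), Real.log_mul hlam.ne' hAp0.ne'] at h1
        linarith
    have h3 : (len ω p : ℝ) ≤ ((q : ℝ) + 2) + C * (a + Real.log (1 + u) - 1) + ε * T := by
      have h4 : C * Real.log T ≤ C * (a + T / ((1 + u) * A p) + Real.log (1 + u) - 1) := by gcongr
      have h5 : C * (T / ((1 + u) * A p)) = ε * T := by rw [hε]; ring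
      rw [hC] at *
      linarith
    have hsumT : T = ∑ y ∈ Finset.range p, (len ω y : ℝ) + len ω p := by
      rw [hT, startTime_succ]
      unfold startTime
      push_cast
      rfl
    change (_ : ℝ) ≤ _
    rw [Finset.sum_range_succ, if_pos rfl]
    have e : ∑ y ∈ Finset.range p, (if y = p then -(s * (1 - ε)) else s * ε) * (len ω y : ℝ) =
        s * ε * ∑ y ∈ Finset.range p, (len ω y : ℝ) := by
      rw [Finset.mul_sum]
      refine Finset.sum_congr rfl fun y hy => ?_
      rw [if_neg (Finset.mem_range.1 hy).ne]
    rw [e]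
    rw [hsumT] at h3
    have h6 := mul_le_mul_of_nonneg_left h3 hs0.le
    linarith
  · rw [Finset.sum_range_succ, if_pos rfl]
    have e : ∑ y ∈ Finset.range p, (1 + u) * incr A y *
          (Real.exp (if y = p then -(s * (1 - ε)) else s * ε) - 1) =
        (1 + u) * (A p - X) * (Real.exp (s * ε) - 1) := by
      have : (A p : ℝ) - X = ∑ y ∈ Finset.range p, incr A y := by
        rw [← hA.sum_incr p, Finset.sum_range_succ]
        ring
      rw [this, Finset.mul_sum, Finset.sum_mul]
      refine Finset.sum_congr rfl fun y hy => ?_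
      rw [if_neg (Finset.mem_range.1 hy).ne]
    rw [e]
    refine le_trans ?_ hs
    have hz0 : 0 ≤ s * ε := by positivity
    have hz1 : s * ε ≤ 1 := by nlinarith
    have hq := exp_le_quadratic hz0 hz1
    have hge : 0 ≤ Real.exp (s * ε) - 1 := by linarith [Real.add_one_le_exp (s * ε)]
    have e2 : Real.exp (-(s * (1 - ε))) = Real.exp (-s) * Real.exp (s * ε) := by
      rw [← Real.exp_add]; congr 1; ring
    have hle1 : Real.exp (-s) ≤ 1 := by rw [Real.exp_le_one_iff]; linarith
    have e3 : (1 + u) * X * (Real.exp (-(s * (1 - ε))) - 1) ≤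
        (1 + u) * X * (Real.exp (-s) - 1) + (1 + u) * X * (Real.exp (s * ε) - 1) := by
      rw [e2, ← mul_add]
      apply mul_le_mul_of_nonneg_left _ (by positivity)
      nlinarith [Real.exp_pos (-s)]
    have e4 : (1 + u) * A p * (Real.exp (s * ε) - 1) ≤ s * C * (1 + s * ε) := by
      calc (1 + u) * A p * (Real.exp (s * ε) - 1) ≤ (1 + u) * A p * (s * ε * (1 + s * ε)) := by
            gcongr
        _ = s * (ε * ((1 + u) * A p)) * (1 + s * ε) := by ring
        _ = _ := by rw [hεA]
    have e5 : s * (((q : ℝ) + 2) + C * a) ≤ s * X := by gcongr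
    linarith

/-- The phase lengths of an agent behave typically at level `x` with large probability. -/
lemma IsLens.prob_not_typical (hlen : IsLens Pr A u len) (hA : IsBudget A q h c) (hu : 7 / 8 ≤ u)
    {s l₁ ξ : ℝ} (hs : 0 < s) (hexp : (1 + u) * (Real.exp s - 1) ≤ s * l₁)
    (hsξ : s * ξ = cBar u) (D x : ℕ) :
    Pr {ω | ¬ TypicalLens A D x (lamS u) l₁ ξ (len ω)} ≤
      (8 * D * x + 3 : ℕ) * ENNReal.ofReal (Real.exp (-(cBar u * incr A (x + 1)))) := by
  set I := incr A (x + 1)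
  set E := ENNReal.ofReal (Real.exp (-(cBar u * I)))
  set S₁ : ℕ → Set Ω := fun p =>
    {ω | ¬ lamS u * (A p - 2 * I) ≤ startTime (len ω) (p + 1)} with hS₁
  set S₂ : Finset ℕ → Set Ω := fun Y =>
    {ω | ¬ ∑ y ∈ Y, (len ω y : ℝ) ≤ l₁ * ∑ y ∈ Y, incr A y + ξ * I} with hS₂
  have hsub : {ω | ¬ TypicalLens A D x (lamS u) l₁ ξ (len ω)} ⊆
      ((⋃ p ∈ Finset.range (4 * D * x + 1), S₁ p) ∪
        ⋃ p ∈ Finset.range (4 * D * x + 1), S₂ {p + 1, p + 2}) ∪ S₂ (Finset.range (x + 2)) := by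
    intro ω hω
    by_contra hc
    simp only [Set.mem_union, Set.mem_iUnion, not_or, not_exists, hS₁, hS₂, Set.mem_ofPred_eq,
      not_not, Finset.mem_range] at hc
    obtain ⟨⟨h1, h2⟩, h3⟩ := hc
    refine hω ⟨fun p hp => h1 p (by omega), fun p hp1 hp2 => ?_, ?_⟩
    · have := h2 (p - 1) (by omega)
      rw [show p - 1 + 1 = p by omega, show p - 1 + 2 = p + 1 by omega,
        Finset.sum_pair (by omega), Finset.sum_pair (by omega)] at this
      exact this
    · have e : (startTime (len ω) (x + 2) : ℝ) = ∑ y ∈ Finset.range (x + 2), (len ω y : ℝ) := by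
        unfold startTime; push_cast; rfl
      rw [e, ← hA.sum_incr (x + 1)]
      exact h3
  refine (measure_mono hsub).trans ?_
  refine (measure_union_le _ _).trans ((add_le_add (measure_union_le _ _) le_rfl).trans ?_)
  have b1 : Pr (⋃ p ∈ Finset.range (4 * D * x + 1), S₁ p) ≤ (4 * D * x + 1 : ℕ) * E := by
    refine (measure_biUnion_finset_le _ _).trans ?_
    refine (Finset.sum_le_sum fun p _ => hlen.prob_early hA hu p I).trans ?_
    rw [Finset.sum_const, Finset.card_range, nsmul_eq_mul]
  have b2 : Pr (⋃ p ∈ Finset.range (4 * D * x + 1), S₂ {p + 1, p + 2}) ≤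
      (4 * D * x + 1 : ℕ) * E := by
    refine (measure_biUnion_finset_le _ _).trans ?_
    refine (Finset.sum_le_sum fun p _ =>
      hlen.prob_late hA (by linarith) hs hexp hsξ {p + 1, p + 2} I).trans ?_
    rw [Finset.sum_const, Finset.card_range, nsmul_eq_mul]
  have b3 : Pr (S₂ (Finset.range (x + 2))) ≤ E :=
    hlen.prob_late hA (by linarith) hs hexp hsξ _ I
  refine (add_le_add (add_le_add b1 b2) b3).trans (le_of_eq ?_)
  push_cast
  ring

end Poisson

/-! ### The confidence bounds -/

/-- Comparison of a power with the increments of an antiderivative. -/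
lemma rpow_neg_le_telescope {p : ℝ} (hp : 0 < p) {t : ℕ} (ht : 1 ≤ t) :
    ((t + 1 : ℕ) : ℝ) ^ (-(p + 1)) ≤
      ((t : ℝ) ^ (-p) - ((t + 1 : ℕ) : ℝ) ^ (-p)) / p := by
  have ht0 : (0 : ℝ) < t := by exact_mod_cast ht
  have ht1 : (0 : ℝ) < ((t + 1 : ℕ) : ℝ) := by positivity
  set z : ℝ := ((t + 1 : ℕ) : ℝ) with hz
  have hzt : (t : ℝ) = z - 1 := by rw [hz]; push_cast; ring
  have h1 : z ^ (-p) * (1 + p / z) ≤ (t : ℝ) ^ (-p) := by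
    have hlog : Real.log t ≤ Real.log z - 1 / z := by
      have := Real.log_le_sub_one_of_pos (x := (t : ℝ) / z) (by positivity)
      rw [Real.log_div ht0.ne' ht1.ne'] at this
      have e : (t : ℝ) / z - 1 = -(1 / z) := by rw [hzt]; field_simp; ring
      linarith
    rw [Real.rpow_def_of_pos ht0, Real.rpow_def_of_pos ht1]
    calc Real.exp (Real.log z * -p) * (1 + p / z)
        ≤ Real.exp (Real.log z * -p) * Real.exp (p / z) := by
          gcongr
          linarith [Real.add_one_le_exp (p / z)]
      _ = Real.exp (Real.log z * -p + p / z) := (Real.exp_add _ _).symm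
      _ ≤ _ := by
          rw [Real.exp_le_exp]
          have : p * Real.log t ≤ p * (Real.log z - 1 / z) := by gcongr
          have e : p * (1 / z) = p / z := by ring
          linarith
  have h2 : z ^ (-(p + 1)) = z ^ (-p) / z := by
    rw [show -(p + 1) = -p - 1 by ring, Real.rpow_sub_one ht1.ne']
  rw [h2, le_div_iff₀ hp]
  have : z ^ (-p) * (1 + p / z) = z ^ (-p) + z ^ (-p) / z * p := by ring
  linarith

lemma sum_rpow_neg_le {p : ℝ} (hp : 0 < p) {m : ℕ} (hm : 1 ≤ m) (n : ℕ) :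
    ∑ j ∈ Finset.range n, ((m + 1 + j : ℕ) : ℝ) ^ (-(p + 1)) ≤ (m : ℝ) ^ (-p) / p := by
  have key : ∑ j ∈ Finset.range n, ((m + 1 + j : ℕ) : ℝ) ^ (-(p + 1)) ≤
      ((m : ℝ) ^ (-p) - ((m + n : ℕ) : ℝ) ^ (-p)) / p := by
    induction n with
    | zero => simp
    | succ n ih =>
      rw [Finset.sum_range_succ]
      have := rpow_neg_le_telescope hp (t := m + n) (by omega)
      rw [show m + n + 1 = m + 1 + n by ring] at this
      refine (add_le_add ih this).trans (le_of_eq ?_)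
      rw [show m + (n + 1) = m + 1 + n by ring]
      ring
  refine key.trans ?_
  have : 0 ≤ ((m + n : ℕ) : ℝ) ^ (-p) := Real.rpow_nonneg (Nat.cast_nonneg _) _
  gcongr
  linarith

section Reward

variable {Ω : Type*} [MeasurableSpace Ω] {Pr : Measure Ω} [IsProbabilityMeasure Pr]
variable {N K : ℕ} {μ : Fin K → ℝ} {P : Matrix (Fin N) (Fin N) ℝ} {A : ℕ → ℕ} {δ : ℝ}
  {W : Ω → Noise N K}

lemma IsPoissonNoise.isLens (hW : IsPoissonNoise Pr μ P A δ W) (i : Fin N) :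
    IsLens Pr A (δ / 2) fun ω => (W ω).len i where
  measurable y := hW.measurable (.inr (.inr (i, y)))
  indep := iIndepFun.precomp (g := fun y : ℕ =>
    (.inr (.inr (i, y)) : (Fin N × Fin K × ℕ) ⊕ (Fin N × ℕ) ⊕ (Fin N × ℕ)))
    (fun y y' h => by simpa using h) hW.indep
  law y := hW.len_law i y

lemma IsPoissonNoise.measurableSet_reward (hW : IsPoissonNoise Pr μ P A δ W) (i : Fin N)
    (k : Fin K) (n : ℕ) : MeasurableSet {ω | (W ω).reward i k n = true} := by
  have h := hW.measurable (.inl (i, k, n)) (measurableSet_singleton 1)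
  convert h using 1
  ext ω
  simp [basicVars, Bool.toNat_eq_one]

/-- The two-sided Hoeffding bound for the rewards of one arm of one agent. -/
lemma IsPoissonNoise.hoeffding (hμ : ∀ k, 0 ≤ μ k) (hW : IsPoissonNoise Pr μ P A δ W)
    (i : Fin N) (k : Fin K) {n : ℕ} (hn : 1 ≤ n) {b : ℝ} (hb : 0 ≤ b) :
    Pr {ω | (rewardSum (W ω) i k n : ℝ) / n + Real.sqrt (b / n) ≤ μ k} ≤
        ENNReal.ofReal (Real.exp (-(2 * b))) ∧
      Pr {ω | μ k + Real.sqrt (b / n) ≤ (rewardSum (W ω) i k n : ℝ) / n} ≤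
        ENNReal.ofReal (Real.exp (-(2 * b))) := by
  set X : ℕ → Ω → ℝ := fun j ω => (((W ω).reward i k j).toNat : ℝ) with hX
  have hmeas : ∀ j, Measurable (X j) := fun j =>
    (measurable_from_nat (f := fun n : ℕ => (n : ℝ))).comp (hW.measurable (.inl (i, k, j)))
  have hindN : iIndepFun (fun (j : ℕ) (ω : Ω) => ((W ω).reward i k j).toNat) Pr :=
    iIndepFun.precomp (g := fun j : ℕ =>
      (.inl (i, k, j) : (Fin N × Fin K × ℕ) ⊕ (Fin N × ℕ) ⊕ (Fin N × ℕ)))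
      (fun j j' h => by simpa using h) hW.indep
  have hmem : ∀ j, ∀ᵐ ω ∂Pr, X j ω ∈ Set.Icc (0 : ℝ) 1 := fun j => by
    refine Filter.Eventually.of_forall fun ω => ?_
    simp only [hX]
    cases (W ω).reward i k j <;> simp
  have hmean : ∀ j, Pr[X j] = μ k := by
    intro j
    have e : X j = Set.indicator {ω | (W ω).reward i k j = true} 1 := by
      funext ω
      simp only [hX, Set.indicator, Set.mem_ofPred_eq, Pi.one_apply]
      cases (W ω).reward i k j <;> simp
    rw [e, integral_indicator_one (hW.measurableSet_reward i k j), measureReal_def,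
      hW.reward_law, ENNReal.toReal_ofReal (hμ k)]
  have hsub : ∀ j, HasSubgaussianMGF (fun ω => X j ω - μ k) (1 / 4) Pr := by
    intro j
    have := hasSubgaussianMGF_of_mem_Icc (hmeas j).aemeasurable (hmem j)
    rw [hmean j] at this
    convert this using 1
    norm_num
  have hn0 : (0 : ℝ) < n := by exact_mod_cast hn
  have hsum : ∀ ω, (rewardSum (W ω) i k n : ℝ) = ∑ j ∈ Finset.range n, X j ω := fun ω => by
    simp [rewardSum, hX]
  set r := Real.sqrt (b / n) with hr
  have hr0 : 0 ≤ r := Real.sqrt_nonneg _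
  have hε : -(n * r) ^ 2 / (2 * n * ((1 / 4 : ℝ≥0) : ℝ)) = -(2 * b) := by
    rw [mul_pow, hr, Real.sq_sqrt (by positivity)]
    push_cast
    field_simp
    ring
  have conv : ∀ S : Set Ω, Pr.real S ≤ Real.exp (-(2 * b)) →
      Pr S ≤ ENNReal.ofReal (Real.exp (-(2 * b))) := fun S hS => by
    rw [measureReal_def] at hS
    exact (ENNReal.le_ofReal_iff_toReal_le (measure_ne_top _ _) (Real.exp_pos _).le).2 hS
  constructor
  · have hind : iIndepFun (fun j ω => -(X j ω - μ k)) Pr :=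
      hindN.comp (fun _ (n : ℕ) => -((n : ℝ) - μ k)) (fun _ => measurable_from_nat)
    have := HasSubgaussianMGF.measure_sum_range_ge_le_of_iIndepFun hind (n := n) (ε := n * r)
      (fun j _ => (hsub j).neg) (by positivity)
    rw [hε] at this
    refine le_trans (measure_mono fun ω hω => ?_) (conv _ this)
    have hω' : (rewardSum (W ω) i k n : ℝ) / n + r ≤ μ k := hω
    change (_ : ℝ) ≤ _
    rw [Finset.sum_neg_distrib, Finset.sum_sub_distrib, ← hsum ω, Finset.sum_const,
      Finset.card_range, nsmul_eq_mul]
    have h2 : (rewardSum (W ω) i k n : ℝ) = n * ((rewardSum (W ω) i k n : ℝ) / n) := by field_simp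
    rw [h2]
    nlinarith
  · have hind : iIndepFun (fun j ω => X j ω - μ k) Pr :=
      hindN.comp (fun _ (n : ℕ) => (n : ℝ) - μ k) (fun _ => measurable_from_nat)
    have := HasSubgaussianMGF.measure_sum_range_ge_le_of_iIndepFun hind (n := n) (ε := n * r)
      (fun j _ => hsub j) (by positivity)
    rw [hε] at this
    refine le_trans (measure_mono fun ω hω => ?_) (conv _ this)
    have hω' : μ k + r ≤ (rewardSum (W ω) i k n : ℝ) / n := hω
    change (_ : ℝ) ≤ _
    rw [Finset.sum_sub_distrib, ← hsum ω, Finset.sum_const,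
      Finset.card_range, nsmul_eq_mul]
    have h2 : (rewardSum (W ω) i k n : ℝ) = n * ((rewardSum (W ω) i k n : ℝ) / n) := by field_simp
    rw [h2]
    nlinarith

/-- Hoeffding's inequality and the union bound over the sample sizes and the arms. -/
lemma IsPoissonNoise.prob_confFail [NeZero K] (hμ : ∀ k, 0 ≤ μ k)
    (hW : IsPoissonNoise Pr μ P A δ W) {α : ℝ} (hα : 0 ≤ α) (i : Fin N) (t : ℕ) :
    Pr {ω | ConfFail α μ (W ω) i t} ≤
      ENNReal.ofReal ((t - 1 : ℕ) * (K * (t : ℝ) ^ (-(2 * α)))) := by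
  rcases Nat.eq_zero_or_pos t with rfl | ht
  · have : {ω | ConfFail α μ (W ω) i 0} = ∅ := by
      ext ω
      simp [ConfFail]
    rw [this]
    simp
  set b := α * Real.log t with hb
  have hb0 : 0 ≤ b := mul_nonneg hα (Real.log_natCast_nonneg _)
  have hexp : Real.exp (-(2 * b)) = (t : ℝ) ^ (-(2 * α)) := by
    rw [Real.rpow_def_of_pos (by exact_mod_cast ht), hb]
    congr 1
    ring
  set E := ENNReal.ofReal (Real.exp (-(2 * b)))
  have hsub : {ω | ConfFail α μ (W ω) i t} ⊆ ⋃ s ∈ Finset.Ico 1 t, ⋃ k ∈ Finset.univ,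
      {ω | if k = 0 then (rewardSum (W ω) i k s : ℝ) / s + Real.sqrt (b / s) ≤ μ k
        else μ k + Real.sqrt (b / s) ≤ (rewardSum (W ω) i k s : ℝ) / s} := by
    rintro ω ⟨s, hs1, hs2, h⟩
    simp only [Set.mem_iUnion, Finset.mem_Ico, Finset.mem_univ]
    rcases h with h | ⟨k, hk, h⟩
    · refine ⟨s, ⟨hs1, hs2⟩, 0, trivial, ?_⟩
      rw [Set.mem_ofPred_eq, if_pos rfl]
      exact h.le
    · refine ⟨s, ⟨hs1, hs2⟩, k, trivial, ?_⟩
      rw [Set.mem_ofPred_eq, if_neg hk]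
      exact h.le
  refine (measure_mono hsub).trans ((measure_biUnion_finset_le _ _).trans ?_)
  have h1 : ∀ s ∈ Finset.Ico 1 t, Pr (⋃ k ∈ Finset.univ,
      {ω | if k = 0 then (rewardSum (W ω) i k s : ℝ) / s + Real.sqrt (b / s) ≤ μ k
        else μ k + Real.sqrt (b / s) ≤ (rewardSum (W ω) i k s : ℝ) / s}) ≤ K * E := by
    intro s hs
    refine (measure_biUnion_finset_le _ _).trans ?_
    calc _ ≤ ∑ k : Fin K, E := by
          refine Finset.sum_le_sum fun k _ => ?_
          have := hW.hoeffding hμ i k (Finset.mem_Ico.1 hs).1 hb0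
          split_ifs
          exacts [this.1, this.2]
      _ = _ := by simp
  refine (Finset.sum_le_sum h1).trans ?_
  rw [Finset.sum_const, Nat.card_Ico, nsmul_eq_mul, ENNReal.ofReal_mul (Nat.cast_nonneg _),
    ENNReal.ofReal_mul (Nat.cast_nonneg _), ENNReal.ofReal_natCast, ENNReal.ofReal_natCast, ← hexp]

lemma IsPoissonNoise.prob_confFail_le [NeZero K] (hμ : ∀ k, 0 ≤ μ k)
    (hW : IsPoissonNoise Pr μ P A δ W) {α : ℝ} (hα : 0 ≤ α) (i : Fin N) {t : ℕ} (ht : 1 ≤ t) :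
    Pr {ω | ConfFail α μ (W ω) i t} ≤
      ENNReal.ofReal (K * (t : ℝ) ^ (-(2 * α - 2 + 1))) := by
  refine (hW.prob_confFail hμ hα i t).trans (ENNReal.ofReal_le_ofReal ?_)
  have ht0 : (0 : ℝ) < t := by exact_mod_cast ht
  have h1 : ((t - 1 : ℕ) : ℝ) ≤ t := by exact_mod_cast Nat.sub_le t 1
  have h2 : (t : ℝ) ^ (-(2 * α - 2 + 1)) = t * (t : ℝ) ^ (-(2 * α)) := by
    rw [show -(2 * α - 2 + 1) = 1 + -(2 * α) by ring, Real.rpow_add ht0, Real.rpow_one]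
  have h3 : 0 ≤ (t : ℝ) ^ (-(2 * α)) := Real.rpow_nonneg ht0.le _
  rw [h2]
  have : (0 : ℝ) ≤ K := Nat.cast_nonneg _
  calc ((t - 1 : ℕ) : ℝ) * (K * (t : ℝ) ^ (-(2 * α))) ≤ t * (K * (t : ℝ) ^ (-(2 * α))) := by gcongr
    _ = _ := by ring

/-- The expected number of slots in which the confidence bounds of an agent are violated. -/
lemma IsPoissonNoise.sum_prob_confFail [NeZero K] (hμ : ∀ k, 0 ≤ μ k)
    (hW : IsPoissonNoise Pr μ P A δ W) {α : ℝ} (hα : 3 ≤ α) (i : Fin N) (T : ℕ) :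
    ∑ t ∈ Finset.range T, Pr {ω | ConfFail α μ (W ω) i (t + 1)} ≤ ENNReal.ofReal (K / 4) := by
  rcases T with _ | T
  · simp
  rw [Finset.sum_range_succ']
  have h0 : Pr {ω | ConfFail α μ (W ω) i (0 + 1)} = 0 := by
    refine le_antisymm ((hW.prob_confFail hμ (by linarith) i 1).trans ?_) bot_le
    simp
  rw [h0, add_zero]
  have h1 : ∀ t ∈ Finset.range T, Pr {ω | ConfFail α μ (W ω) i (t + 1 + 1)} ≤
      ENNReal.ofReal (K * ((1 + 1 + t : ℕ) : ℝ) ^ (-((4 : ℝ) + 1))) := by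
    intro t _
    refine (hW.prob_confFail_le hμ (by linarith) i (by omega)).trans (ENNReal.ofReal_le_ofReal ?_)
    rw [show t + 1 + 1 = 1 + 1 + t by ring]
    have : (1 : ℝ) ≤ ((1 + 1 + t : ℕ) : ℝ) := by exact_mod_cast (by omega : 1 ≤ 1 + 1 + t)
    gcongr
    linarith
  refine (Finset.sum_le_sum h1).trans ?_
  rw [← ENNReal.ofReal_sum_of_nonneg (fun t _ => by positivity)]
  refine ENNReal.ofReal_le_ofReal ?_
  rw [← Finset.mul_sum]
  have := sum_rpow_neg_le (p := 4) (by norm_num) (m := 1) le_rfl T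
  norm_num at this ⊢
  have hK : (0 : ℝ) ≤ K := Nat.cast_nonneg _
  calc _ ≤ (K : ℝ) * (1 / 4) := by gcongr
    _ = _ := by ring

/-- All confidence bounds of all agents hold after slot `m`, up to a small probability. -/
lemma IsPoissonNoise.prob_exists_confFail [NeZero K] (hμ : ∀ k, 0 ≤ μ k)
    (hW : IsPoissonNoise Pr μ P A δ W) {α : ℝ} (hα : 3 < α) {m : ℕ} (hm : 1 ≤ m) :
    Pr {ω | ∃ i t, m < t ∧ ConfFail α μ (W ω) i t} ≤
      ENNReal.ofReal (N * K * ((m : ℝ) ^ (-(2 * α - 2)) / (2 * α - 2))) := by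
  have hsub : {ω | ∃ i t, m < t ∧ ConfFail α μ (W ω) i t} ⊆
      ⋃ i ∈ (Finset.univ : Finset (Fin N)), ⋃ j : ℕ, {ω | ConfFail α μ (W ω) i (m + 1 + j)} := by
    rintro ω ⟨i, t, ht, h⟩
    simp only [Set.mem_iUnion]
    refine ⟨i, Finset.mem_univ _, t - (m + 1), ?_⟩
    rw [show m + 1 + (t - (m + 1)) = t by omega]
    exact h
  refine (measure_mono hsub).trans ((measure_biUnion_finset_le _ _).trans ?_)
  have h1 : ∀ i ∈ (Finset.univ : Finset (Fin N)),
      Pr (⋃ j : ℕ, {ω | ConfFail α μ (W ω) i (m + 1 + j)}) ≤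
        ENNReal.ofReal (K * ((m : ℝ) ^ (-(2 * α - 2)) / (2 * α - 2))) := by
    intro i _
    refine (measure_iUnion_le _).trans ?_
    refine ENNReal.tsum_le_of_sum_range_le fun n => ?_
    refine (Finset.sum_le_sum fun j _ =>
      hW.prob_confFail_le hμ (by linarith) i (by omega)).trans ?_
    rw [← ENNReal.ofReal_sum_of_nonneg (fun t _ => by positivity)]
    refine ENNReal.ofReal_le_ofReal ?_
    rw [← Finset.mul_sum]
    gcongr
    exact sum_rpow_neg_le (by linarith) hm n
  refine (Finset.sum_le_sum h1).trans (le_of_eq ?_)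
  rw [Finset.sum_const, Finset.card_univ, Fintype.card_fin, nsmul_eq_mul, mul_assoc,
    ENNReal.ofReal_mul (Nat.cast_nonneg N), ENNReal.ofReal_natCast]

end Reward

/-! ### The calls at the ends of randomly chosen phases -/

section Calls

lemma informed_congr {N : ℕ} [NeZero N] {c c' : ℕ → Fin N → Fin N} {n : ℕ}
    (h : ∀ k < n, ∀ j, c k j = c' k j) : informed c n = informed c' n := by
  induction n with
  | zero => rfl
  | succ n ih =>
    have e := ih fun k hk => h k (by omega)
    ext j
    simp only [informed, e, h n (Nat.lt_succ_self n)]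

/-- Extension of the calls of `n` rounds to all rounds; in the later rounds, each agent calls
itself. -/
def extendCalls {N n : ℕ} (c : Fin n → Fin N → Fin N) : ℕ → Fin N → Fin N :=
  fun k j => if hk : k < n then c ⟨k, hk⟩ j else j

lemma informed_extendCalls {N n : ℕ} [NeZero N] {c : Fin n → Fin N → Fin N}
    {c' : ℕ → Fin N → Fin N} (h : ∀ k : Fin n, ∀ j, c' k j = c k j) :
    informed (extendCalls c) n = informed c' n :=
  informed_congr fun k hk j => by rw [extendCalls, dif_pos hk, ← h ⟨k, hk⟩ j]

lemma prob_forall_eq {Ω ι β : Type*} [MeasurableSpace Ω] [Fintype ι] [MeasurableSpace β]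
    [MeasurableSingletonClass β] {Pr : Measure Ω} {X : ι → Ω → β} (hi : iIndepFun X Pr)
    (c : ι → β) : Pr {ω | ∀ i, X i ω = c i} = ∏ i, Pr {ω | X i ω = c i} := by
  have := hi.measure_inter_preimage_eq_mul Finset.univ (sets := fun i => {c i})
    (fun i _ => measurableSet_singleton _)
  have e : {ω | ∀ i, X i ω = c i} = ⋂ i ∈ Finset.univ, X i ⁻¹' {c i} := by
    ext ω
    simp
  rw [e, this]
  rfl

/-- The event that for all `k` and `j`, the phase of agent `j` in progress at time `v k` is
`ψ k j`. -/
def phaseEvent {Ω : Type*} {N n : ℕ} (len : Ω → Fin N → ℕ → ℕ) (v : ℕ → ℕ)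
    (ψ : Fin n → Fin N → ℕ) : Set Ω :=
  {ω | ∀ k j, startTime (len ω j) (ψ k j) ≤ v k ∧ v k < startTime (len ω j) (ψ k j + 1)}

lemma measurableSet_phaseEvent {Ω : Type*} [MeasurableSpace Ω] {N n : ℕ}
    {len : Ω → Fin N → ℕ → ℕ} (hm : ∀ j y, Measurable fun ω => len ω j y) (v : ℕ → ℕ)
    (ψ : Fin n → Fin N → ℕ) : MeasurableSet (phaseEvent len v ψ) := by
  have hS : ∀ j p, Measurable fun ω => startTime (len ω j) p := fun j p =>
    Finset.measurable_sum _ fun y _ => hm j y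
  simp only [phaseEvent, Set.ofPred_forall]
  refine MeasurableSet.iInter fun k => MeasurableSet.iInter fun j => ?_
  exact (measurableSet_le (hS _ _) measurable_const).inter
    (measurableSet_lt measurable_const (hS _ _))

lemma pairwise_disjoint_phaseEvent {Ω : Type*} {N n : ℕ} (len : Ω → Fin N → ℕ → ℕ)
    (v : ℕ → ℕ) : Pairwise (Function.onFun Disjoint
      fun ψ : Fin n → Fin N → ℕ => phaseEvent len v ψ) := by
  intro ψ ψ' hne
  rw [Function.onFun, Set.disjoint_left]
  intro ω h h'
  apply hne
  funext k j
  rw [← phaseOf_eq (h k j).1 (h k j).2, ← phaseOf_eq (h' k j).1 (h' k j).2]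

variable {Ω : Type*} [MeasurableSpace Ω] {Pr : Measure Ω}
variable {N K : ℕ} {μ : Fin K → ℝ} {P : Matrix (Fin N) (Fin N) ℝ} {A : ℕ → ℕ} {δ : ℝ}
  {W : Ω → Noise N K}

/-- Calls at the ends of distinct phases are independent of the phase lengths, and they have the
law of a pull process. -/
lemma IsPoissonNoise.prob_phaseEvent_inter (hW : IsPoissonNoise Pr μ P A δ W) {n : ℕ}
    (v : ℕ → ℕ) {ψ : Fin n → Fin N → ℕ} (hψ : ∀ j, Function.Injective fun k => ψ k j)
    (c : Fin n → Fin N → Fin N) :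
    Pr (phaseEvent (fun ω => (W ω).len) v ψ ∩ {ω | ∀ k j, (W ω).call j (ψ k j) = c k j}) =
      Pr (phaseEvent (fun ω => (W ω).len) v ψ) *
        ∏ p : Fin n × Fin N, ENNReal.ofReal (P p.2 (c p.1 p.2)) := by
  set m : (Fin N × Fin K × ℕ) ⊕ (Fin N × ℕ) ⊕ (Fin N × ℕ) → MeasurableSpace Ω :=
    fun p => MeasurableSpace.comap (basicVars W p) ⊤ with hm
  set S : Set ((Fin N × Fin K × ℕ) ⊕ (Fin N × ℕ) ⊕ (Fin N × ℕ)) :=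
    Set.range fun p : Fin N × ℕ => Sum.inr (Sum.inr p)
  set S' : Set ((Fin N × Fin K × ℕ) ⊕ (Fin N × ℕ) ⊕ (Fin N × ℕ)) :=
    Set.range fun p : Fin N × ℕ => Sum.inr (Sum.inl p)
  have hdisj : Disjoint S S' := by
    rw [Set.disjoint_left]
    rintro _ ⟨p, rfl⟩ ⟨p', h⟩
    simp at h
  have hind := indep_iSup_of_disjoint (fun p => (hW.measurable p).comap_le) hW.indep.iIndep hdisj
  have hE : MeasurableSet[⨆ p ∈ S, m p] (phaseEvent (fun ω => (W ω).len) v ψ) := by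
    refine @measurableSet_phaseEvent Ω (⨆ p ∈ S, m p) N n _ (fun j y => ?_) v ψ
    have h1 : Measurable[m (.inr (.inr (j, y)))] fun ω => (W ω).len j y := comap_measurable _
    exact h1.mono (le_biSup m (show Sum.inr (Sum.inr (j, y)) ∈ S from ⟨(j, y), rfl⟩)) le_rfl
  have hC : MeasurableSet[⨆ p ∈ S', m p] {ω | ∀ k j, (W ω).call j (ψ k j) = c k j} := by
    simp only [Set.ofPred_forall]
    refine MeasurableSet.iInter fun k => MeasurableSet.iInter fun j => ?_
    have h1 : Measurable[m (.inr (.inl (j, ψ k j)))] fun ω => ((W ω).call j (ψ k j)).val :=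
      comap_measurable _
    have h2 := h1.mono (le_biSup m (show Sum.inr (Sum.inl (j, ψ k j)) ∈ S' from
      ⟨(j, ψ k j), rfl⟩)) le_rfl
    have h3 := h2 (measurableSet_singleton (c k j).val)
    convert h3 using 1
    ext ω
    simp [Fin.ext_iff]
  rw [(Indep_iff _ _ _).1 hind _ _ hE hC]
  congr 1
  have hcall : iIndepFun (fun (p : Fin n × Fin N) ω => ((W ω).call p.2 (ψ p.1 p.2)).val) Pr :=
    iIndepFun.precomp (g := fun p : Fin n × Fin N =>
      (.inr (.inl (p.2, ψ p.1 p.2)) : (Fin N × Fin K × ℕ) ⊕ (Fin N × ℕ) ⊕ (Fin N × ℕ)))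
      (fun p p' h => by
        simp only [Sum.inr.injEq, Sum.inl.injEq, Prod.mk.injEq] at h
        have h2 := h.2
        rw [← h.1] at h2
        exact Prod.ext (hψ p.2 h2) h.1) hW.indep
  have h4 := prob_forall_eq hcall fun p => (c p.1 p.2).val
  have e1 : {ω | ∀ k j, (W ω).call j (ψ k j) = c k j} =
      {ω | ∀ p : Fin n × Fin N, ((W ω).call p.2 (ψ p.1 p.2)).val = (c p.1 p.2).val} := by
    ext ω
    simp [Fin.ext_iff]
  rw [e1, h4]
  refine Finset.prod_congr rfl fun p _ => ?_
  rw [← hW.call_law p.2 (ψ p.1 p.2) (c p.1 p.2)]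
  congr 1
  ext ω
  simp [Fin.ext_iff]

lemma IsPullCalls.prob_eq {Ω' : Type*} [MeasurableSpace Ω'] {Pr' : Measure Ω'}
    {C : ℕ → Fin N → Ω' → Fin N} (hC : IsPullCalls Pr' P C) {n : ℕ} (c : Fin n → Fin N → Fin N) :
    Pr' {ω | ∀ k : Fin n, ∀ j, C k j ω = c k j} =
      ∏ p : Fin n × Fin N, ENNReal.ofReal (P p.2 (c p.1 p.2)) := by
  have hi : iIndepFun (fun (p : Fin n × Fin N) => C p.1 p.2) Pr' :=
    iIndepFun.precomp (g := fun p : Fin n × Fin N => ((p.1 : ℕ), p.2))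
      (fun p p' h => by
        simp only [Prod.mk.injEq] at h
        exact Prod.ext (Fin.ext h.1) h.2) hC.indep
  have h := prob_forall_eq hi fun p => c p.1 p.2
  simp only [Prod.forall] at h
  rw [h]
  exact Finset.prod_congr rfl fun p _ => hC.law p.1 p.2 _

/-- Along increasing phases, the calls of the algorithm spread a rumor like a pull process. -/
lemma IsPoissonNoise.prob_not_informed_le [NeZero N] [IsProbabilityMeasure Pr]
    (hW : IsPoissonNoise Pr μ P A δ W)
    {Ω' : Type*} [MeasurableSpace Ω'] {Pr' : Measure Ω'}
    {C : ℕ → Fin N → Ω' → Fin N} (hC : IsPullCalls Pr' P C) (v : ℕ → ℕ) (n : ℕ) :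
    Pr {ω | (∀ j, Unbounded ((W ω).len j)) ∧
        (∀ k k', k < k' → k' < n → ∀ j,
          phaseOf ((W ω).len j) (v k + 1) < phaseOf ((W ω).len j) (v k' + 1)) ∧
        informed (fun k j => (W ω).call j (phaseOf ((W ω).len j) (v k + 1))) n ≠ Finset.univ} ≤
      Pr' {ω | informed (fun k j => C k j ω) n ≠ Finset.univ} := by
  classical
  set E := fun ψ : Fin n → Fin N → ℕ => phaseEvent (fun ω => (W ω).len) v ψ with hE
  set bad : Finset (Fin n → Fin N → Fin N) :=
    Finset.univ.filter fun c => informed (extendCalls c) n ≠ Finset.univ with hbad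
  set pr := fun c : Fin n → Fin N → Fin N =>
    ∏ p : Fin n × Fin N, ENNReal.ofReal (P p.2 (c p.1 p.2)) with hpr
  have hsub : {ω | (∀ j, Unbounded ((W ω).len j)) ∧
        (∀ k k', k < k' → k' < n → ∀ j,
          phaseOf ((W ω).len j) (v k + 1) < phaseOf ((W ω).len j) (v k' + 1)) ∧
        informed (fun k j => (W ω).call j (phaseOf ((W ω).len j) (v k + 1))) n ≠ Finset.univ} ⊆
      ⋃ ψ : Fin n → Fin N → ℕ, ⋃ c ∈ bad,
        {ω | (∀ j, Function.Injective fun k => ψ k j) ∧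
          ω ∈ E ψ ∩ {ω | ∀ k j, (W ω).call j (ψ k j) = c k j}} := by
    rintro ω ⟨h1, h2, h3⟩
    simp only [Set.mem_iUnion]
    refine ⟨fun k j => phaseOf ((W ω).len j) (v k + 1),
      fun k j => (W ω).call j (phaseOf ((W ω).len j) (v k + 1)), ?_, ?_, ?_, ?_⟩
    · rw [hbad, Finset.mem_filter]
      refine ⟨Finset.mem_univ _, ?_⟩
      rw [informed_extendCalls (c' := fun k j =>
        (W ω).call j (phaseOf ((W ω).len j) (v k + 1))) (fun k j => rfl)]
      exact h3
    · intro j k k' hk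
      simp only at hk
      rcases lt_trichotomy k k' with h | h | h
      · have := h2 k k' h k'.isLt j; omega
      · exact h
      · have := h2 k' k h k.isLt j; omega
    · intro k j
      exact phaseOf_spec (h1 j) (v k)
    · intro k j
      rfl
  -- for fixed phases and calls, the phases are independent of the calls, which have the pull law
  have hbound : ∀ ψ : Fin n → Fin N → ℕ, ∀ c, Pr {ω | (∀ j, Function.Injective fun k => ψ k j) ∧
      ω ∈ E ψ ∩ {ω | ∀ k j, (W ω).call j (ψ k j) = c k j}} ≤ Pr (E ψ) * pr c := by
    intro ψ c
    by_cases hψ : ∀ j, Function.Injective fun k => ψ k j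
    · rw [← hW.prob_phaseEvent_inter v hψ c]
      exact measure_mono fun ω hω => hω.2
    · refine (measure_mono (t := ∅) fun ω hω => hψ hω.1).trans ?_
      simp
  -- the events that specify the phases are disjoint
  have hEsum : ∑' ψ, Pr (E ψ) ≤ 1 := by
    have hm : ∀ j y, Measurable fun ω => (W ω).len j y := fun j y =>
      hW.measurable (.inr (.inr (j, y)))
    rw [hE, ← measure_iUnion (pairwise_disjoint_phaseEvent _ v)
      (fun ψ => measurableSet_phaseEvent hm v ψ)]
    exact prob_le_one
  have hprsum : ∑ c ∈ bad, pr c ≤ Pr' {ω | informed (fun k j => C k j ω) n ≠ Finset.univ} := by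
    have e1 : ∑ c ∈ bad, pr c = ∑ c ∈ bad, Pr' {ω | ∀ k : Fin n, ∀ j, C k j ω = c k j} :=
      Finset.sum_congr rfl fun c _ => (hC.prob_eq c).symm
    rw [e1, ← measure_biUnion_finset]
    · refine measure_mono ?_
      intro ω hω
      simp only [Set.mem_iUnion] at hω
      obtain ⟨c, hc, h⟩ := hω
      have := (Finset.mem_filter.1 hc).2
      rwa [informed_extendCalls (c' := fun k j => C k j ω) h] at this
    · intro c _ c' _ hne
      rw [Function.onFun, Set.disjoint_left]
      intro ω h h'
      exact hne (funext fun k => funext fun j => (h k j).symm.trans (h' k j))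
    · intro c _
      simp only [Set.ofPred_forall]
      exact MeasurableSet.iInter fun k => MeasurableSet.iInter fun j =>
        hC.measurable k j (measurableSet_singleton _)
  calc _ ≤ ∑' ψ : Fin n → Fin N → ℕ, Pr (⋃ c ∈ bad,
        {ω | (∀ j, Function.Injective fun k => ψ k j) ∧
          ω ∈ E ψ ∩ {ω | ∀ k j, (W ω).call j (ψ k j) = c k j}}) :=
        (measure_mono hsub).trans (measure_iUnion_le _)
    _ ≤ ∑' ψ : Fin n → Fin N → ℕ, Pr (E ψ) * ∑ c ∈ bad, pr c := by
        refine ENNReal.tsum_le_tsum fun ψ => ?_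
        refine (measure_biUnion_finset_le _ _).trans ?_
        rw [Finset.mul_sum]
        exact Finset.sum_le_sum fun c _ => hbound ψ c
    _ = (∑' ψ, Pr (E ψ)) * ∑ c ∈ bad, pr c := ENNReal.tsum_mul_right
    _ ≤ 1 * ∑ c ∈ bad, pr c := by gcongr
    _ ≤ _ := by rw [one_mul]; exact hprsum

end Calls

/-! ### The probability that the playing set is not yet frozen -/

section Settling

variable {N K : ℕ} [NeZero N] [NeZero K] {α : ℝ} {tie : TieBreaking N K}

lemma zero_mem_sticky (hq : 1 ≤ stickySize N K) : (0 : Fin K) ∈ sticky (0 : Fin N) := by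
  refine Finset.mem_image.2 ⟨0, Finset.mem_range.2 hq, ?_⟩
  simp

/-- The playing set of every agent is frozen after the last round, if the rumor has reached all
agents by then. -/
lemma settled_of_informed {w : Noise N K} {μ : Fin K → ℝ} (hq : 1 ≤ stickySize N K) (hα : 0 ≤ α)
    {gap : ℝ} (hgap : 0 < gap) (hμ : ∀ k, k ≠ 0 → gap ≤ μ 0 - μ k) {x m n : ℕ} (hm : 0 < m)
    (hl : LongPhases (K := K) α gap w x) (hf : ∀ i t, m < t → ¬ ConfFail α μ w i t)
    {v : ℕ → ℕ} (hv : Monotone v) (hmv : m ≤ v 0)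
    (hsource : ∃ y, x + 1 ≤ y ∧ m ≤ startTime (w.len 0) y ∧ startTime (w.len 0) (y + 1) ≤ v 0)
    (hphase : ∀ k < n, ∀ j, x + 1 ≤ phaseOf (w.len j) (v k + 1) ∧
      startTime (w.len j) (phaseOf (w.len j) (v k + 1) + 2) ≤ v (k + 1))
    (hinf : informed (fun k j => w.call j (phaseOf (w.len j) (v k + 1))) n = Finset.univ)
    (i : Fin N) : Settled α tie w i (v n) := by
  obtain ⟨y, hy1, hy2, hy3⟩ := hsource
  have h0 : Spreads α tie w (v 0) 0 := by
    have := spreads_of_mem (tie := tie) hα hgap hμ hm hl (hf 0) hy1 hy2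
      (Finset.mem_union_left _ (zero_mem_sticky hq))
    exact fun t ht => this t (hy3.trans ht)
  refine settled_of_spreads (fun j => ?_) i
  exact spreads_of_informed hα hgap hμ hm hl hf hv hmv h0 hphase le_rfl
    (by rw [hinf]; exact Finset.mem_univ j)

lemma phaseOf_lt_of_clock {len : ℕ → ℕ} (hU : Unbounded len) {v : ℕ → ℕ} (hv : Monotone v) {n : ℕ}
    (hphase : ∀ k < n, startTime len (phaseOf len (v k + 1) + 2) ≤ v (k + 1)) {k k' : ℕ}
    (hk : k < k') (hk' : k' < n) : phaseOf len (v k + 1) < phaseOf len (v k' + 1) := by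
  have h1 := (hphase k (by omega)).trans (hv (Nat.succ_le_of_lt hk))
  have h2 := phaseOf_spec hU (v k')
  by_contra hc
  push Not at hc
  have := startTime_mono len (show phaseOf len (v k' + 1) + 1 ≤ phaseOf len (v k + 1) + 2 by omega)
  omega

variable {Ω : Type*} [MeasurableSpace Ω] {Pr : Measure Ω} [IsProbabilityMeasure Pr]
variable {μ : Fin K → ℝ} {P : Matrix (Fin N) (Fin N) ℝ} {A : ℕ → ℕ} {δ : ℝ}
  {W : Ω → Noise N K} {h : ℕ} {gap : ℝ}

/-- From the slot `m ≥ max (A_{l-1} / 8) A_h` on all confidence bounds hold, up to a probability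
that is summable against `A_{2l}`. -/
lemma IsPoissonNoise.prob_exists_confFail_le (hμ : ∀ k, 0 ≤ μ k) (hW : IsPoissonNoise Pr μ P A δ W)
    (hα : 3 < α) (hK : 2 ≤ K)
    (hNK : (N : ℝ) * (K.choose 2 : ℝ) * ((stickySize N K : ℝ) + 1) ≤ (A h : ℝ) ^ (2 * α - 6))
    (hq : 1 ≤ stickySize N K) (hAh : 1 ≤ A h) {l m : ℕ} (hl : 1024 ≤ A (l - 1))
    (hm1 : (A (l - 1) : ℝ) / 8 ≤ m) (hm2 : A h ≤ m) :
    Pr {ω | ∃ i t, m < t ∧ ConfFail α μ (W ω) i t} ≤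
      ENNReal.ofReal (4 / (2 * α - 3) / (A (l - 1) : ℝ) ^ 3) := by
  have hm0 : 1 ≤ m := hAh.trans hm2
  refine (hW.prob_exists_confFail hμ hα hm0).trans (ENNReal.ofReal_le_ofReal ?_)
  have hm : (0 : ℝ) < m := by exact_mod_cast hm0
  have hA : (1024 : ℝ) ≤ A (l - 1) := by exact_mod_cast hl
  have h1 : (N : ℝ) * K ≤ (m : ℝ) ^ (2 * α - 6) := by
    have hK1 : (K : ℝ) ≤ (K.choose 2 : ℝ) * ((stickySize N K : ℝ) + 1) := by
      rw [Nat.cast_choose_two]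
      have hq' : (1 : ℝ) ≤ stickySize N K := by exact_mod_cast hq
      have hK' : (2 : ℝ) ≤ K := by exact_mod_cast hK
      have : (0 : ℝ) ≤ (K : ℝ) * (K - 1) / 2 := by
        apply div_nonneg (mul_nonneg _ _) <;> linarith
      nlinarith
    calc (N : ℝ) * K ≤ N * ((K.choose 2 : ℝ) * ((stickySize N K : ℝ) + 1)) := by gcongr
      _ = (N : ℝ) * (K.choose 2 : ℝ) * ((stickySize N K : ℝ) + 1) := by ring
      _ ≤ (A h : ℝ) ^ (2 * α - 6) := hNK
      _ ≤ _ := Real.rpow_le_rpow (Nat.cast_nonneg _) (by exact_mod_cast hm2) (by linarith)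
  have h2 : (m : ℝ) ^ (-(2 * α - 2)) = ((m : ℝ) ^ (2 * α - 6))⁻¹ * ((m : ℝ) ^ 4)⁻¹ := by
    rw [← Real.rpow_neg hm.le, ← Real.rpow_natCast, ← Real.rpow_neg hm.le, ← Real.rpow_add hm]
    congr 1
    push_cast
    ring
  have h3 : (N : ℝ) * K * ((m : ℝ) ^ (2 * α - 6))⁻¹ ≤ 1 := by
    rw [← div_eq_mul_inv]
    exact div_le_one_of_le₀ h1 (by positivity)
  have h4 : ((m : ℝ) ^ 4)⁻¹ ≤ 4 / (A (l - 1) : ℝ) ^ 3 := by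
    rw [inv_le_comm₀ (by positivity) (by positivity), inv_div]
    calc (A (l - 1) : ℝ) ^ 3 / 4 ≤ ((A (l - 1) : ℝ) / 8) ^ 4 := by
          have : 0 ≤ (A (l - 1) : ℝ) ^ 3 * ((A (l - 1) : ℝ) - 1024) :=
            mul_nonneg (by positivity) (by linarith)
          nlinarith
      _ ≤ _ := by gcongr
  rw [h2]
  calc (N : ℝ) * K * (((m : ℝ) ^ (2 * α - 6))⁻¹ * ((m : ℝ) ^ 4)⁻¹ / (2 * α - 2))
      = ((N : ℝ) * K * ((m : ℝ) ^ (2 * α - 6))⁻¹) * ((m : ℝ) ^ 4)⁻¹ / (2 * α - 2) := by ring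
    _ ≤ 1 * (4 / (A (l - 1) : ℝ) ^ 3) / (2 * α - 3) := by
        have : 0 < 2 * α - 3 := by linarith
        gcongr
        linarith
    _ = _ := by ring

/-- The probability that a phase of some agent after phase `x` is too short. -/
lemma IsPoissonNoise.prob_not_longPhases (hW : IsPoissonNoise Pr μ P A δ W)
    (hA : IsBudget A (stickySize N K) h (4 * α / gap ^ 2)) (hδ : 7 / 4 ≤ δ) {x : ℕ}
    (hx : h + 1 ≤ x) :
    Pr {ω | ¬ LongPhases α gap (W ω) x} ≤
      ∑' z : ℕ, N * ENNReal.ofReal (Real.exp (-(cBar (δ / 2) * incr A (x + z + 1)))) := by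
  have hsub : {ω | ¬ LongPhases α gap (W ω) x} ⊆ ⋃ z : ℕ, ⋃ i ∈ (Finset.univ : Finset (Fin N)),
      {ω | ¬ ((stickySize N K : ℝ) + 2) * (1 + 4 * α / gap ^ 2 *
        Real.log (startTime ((W ω).len i) (x + z + 1 + 1))) < (W ω).len i (x + z + 1)} := by
    intro ω hω
    simp only [LongPhases, Set.mem_ofPred_eq, not_forall] at hω
    obtain ⟨i, p, hp, hlen⟩ := hω
    simp only [Set.mem_iUnion]
    refine ⟨p - (x + 1), i, Finset.mem_univ _, ?_⟩
    rw [show x + (p - (x + 1)) + 1 = p by omega]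
    exact hlen
  refine (measure_mono hsub).trans ((measure_iUnion_le _).trans (ENNReal.tsum_le_tsum fun z => ?_))
  refine (measure_biUnion_finset_le _ _).trans ?_
  refine (Finset.sum_le_sum fun i _ =>
    (hW.isLens i).prob_short hA (by linarith) (p := x + z + 1) (by omega)).trans (le_of_eq ?_)
  simp

/-- The probability that the phase lengths of some agent are not typical at level `x`. -/
lemma IsPoissonNoise.prob_exists_not_typical (hW : IsPoissonNoise Pr μ P A δ W)
    (hA : IsBudget A (stickySize N K) h (4 * α / gap ^ 2)) (hδ : 7 / 4 ≤ δ)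
    {s l₁ ξ : ℝ} (hs : 0 < s) (hexp : (1 + δ / 2) * (Real.exp s - 1) ≤ s * l₁)
    (hsξ : s * ξ = cBar (δ / 2)) (D x : ℕ) :
    Pr {ω | ∃ i, ¬ TypicalLens A D x (lamS (δ / 2)) l₁ ξ ((W ω).len i)} ≤
      N * ((8 * D * x + 3 : ℕ) *
        ENNReal.ofReal (Real.exp (-(cBar (δ / 2) * incr A (x + 1))))) := by
  have hsub : {ω | ∃ i, ¬ TypicalLens A D x (lamS (δ / 2)) l₁ ξ ((W ω).len i)} ⊆
      ⋃ i ∈ (Finset.univ : Finset (Fin N)),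
        {ω | ¬ TypicalLens A D x (lamS (δ / 2)) l₁ ξ ((W ω).len i)} := by
    rintro ω ⟨i, hi⟩
    simp only [Set.mem_iUnion]
    exact ⟨i, Finset.mem_univ _, hi⟩
  refine (measure_mono hsub).trans ((measure_biUnion_finset_le _ _).trans ?_)
  refine (Finset.sum_le_sum fun i _ =>
    (hW.isLens i).prob_not_typical hA (by linarith) hs hexp hsξ D x).trans (le_of_eq ?_)
  simp

/-- The bound for the probability that the playing set of an agent is not frozen at a time in the
block with index `l`: the phase lengths are not typical at level `x`, or a late confidence bound
fails, or the pull process has not reached all nodes in `(l - 1) / ⌊2 + δ⌋` steps. -/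
lemma IsPoissonNoise.prob_not_settled_le (hμ : IsArmMeans μ)
    (hW : IsPoissonNoise Pr μ P A δ W) (hα : 3 < α) (hK : 2 ≤ K) (hgap : 0 < gap)
    (hμgap : ∀ k, k ≠ 0 → gap ≤ μ 0 - μ k)
    (hA : IsBudget A (stickySize N K) h (4 * α / gap ^ 2))
    (hNK : (N : ℝ) * (K.choose 2 : ℝ) * ((stickySize N K : ℝ) + 1) ≤ (A h : ℝ) ^ (2 * α - 6))
    (hδ : 7 / 4 ≤ δ)
    {Ω' : Type*} [MeasurableSpace Ω'] {Pr' : Measure Ω'}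
    {C : ℕ → Fin N → Ω' → Fin N} (hC : IsPullCalls Pr' P C)
    (i : Fin N) {l x t : ℕ} (hx : h + 1 ≤ x) (hl1 : 2 * ⌈2 + δ⌉₊ * (x - 1) + 1 ≤ l)
    (hl2 : l ≤ 2 * ⌈2 + δ⌉₊ * x) (ht : lamS (δ / 2) * A (2 * l - 2) ≤ t) :
    Pr {ω | ¬ Settled α tie (W ω) i t} ≤
      (N * ((8 * ⌈2 + δ⌉₊ * x + 3 : ℕ) *
          ENNReal.ofReal (Real.exp (-(cBar (δ / 2) * incr A (x + 1))))) +
        ∑' z : ℕ, N * ENNReal.ofReal (Real.exp (-(cBar (δ / 2) * incr A (x + z + 1))))) +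
      ENNReal.ofReal (4 / (2 * α - 3) / (A (l - 1) : ℝ) ^ 3) +
      Pr' {ω | informed (fun k j => C k j ω) ((l - 1) / ⌊2 + δ⌋₊) ≠ Finset.univ} := by
  obtain ⟨s, l₁, ξ, hs, hl₁, hξ, hexp, hsξ, hclock⟩ := exists_clock_of_block hA hδ
  obtain ⟨v, hv, hmv, hvn, hlens⟩ := hclock l x hx hl1 hl2
  set m := max (A (l - 1) / 8 + 1) (A h) with hm
  set n := (l - 1) / ⌊2 + δ⌋₊ with hn
  have hα0 : 0 ≤ α := by linarith
  have hvt : v n ≤ t := by exact_mod_cast hvn.trans ht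
  have hsub : {ω | ¬ Settled α tie (W ω) i t} ⊆
      (({ω | ∃ i, ¬ TypicalLens A ⌈2 + δ⌉₊ x (lamS (δ / 2)) l₁ ξ ((W ω).len i)} ∪
        {ω | ¬ LongPhases α gap (W ω) x}) ∪
        {ω | ∃ i t, m < t ∧ ConfFail α μ (W ω) i t}) ∪
      {ω | (∀ j, Unbounded ((W ω).len j)) ∧
        (∀ k k', k < k' → k' < n → ∀ j,
          phaseOf ((W ω).len j) (v k + 1) < phaseOf ((W ω).len j) (v k' + 1)) ∧
        informed (fun k j => (W ω).call j (phaseOf ((W ω).len j) (v k + 1))) n ≠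
          Finset.univ} := by
    intro ω hω
    by_contra hc
    simp only [Set.mem_union, not_or, Set.mem_ofPred_eq, not_exists, not_not, not_and] at hc
    obtain ⟨⟨⟨h1, h2⟩, h3⟩, h4⟩ := hc
    have hU := fun j => h2.unbounded hα0 j
    have hphase := fun j => (hlens _ (hU j) (h1 j)).2
    have hinf := h4 hU (fun k k' hk hk' j =>
      phaseOf_lt_of_clock (hU j) hv (fun k hk => (hphase j k hk).2) hk hk')
    have := settled_of_informed (tie := tie) hA.q_pos hα0 hgap hμgap
      (lt_of_lt_of_le (Nat.succ_pos _) (le_max_left _ _)) h2 h3 hv hmv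
      (hlens _ (hU 0) (h1 0)).1 (fun k hk j => hphase j k hk) hinf i
    exact hω (this.mono hvt)
  have hl : 1024 ≤ A (l - 1) := by
    have hD4 : 4 ≤ ⌈2 + δ⌉₊ := by
      have : ((3 : ℕ) : ℝ) < 2 + δ := by push_cast; linarith
      exact Nat.lt_ceil.2 this
    have h8 : 8 * (x - 1) ≤ 2 * ⌈2 + δ⌉₊ * (x - 1) := Nat.mul_le_mul_right _ (by omega)
    have h1 := hA.large_add 7
    have h2 : A (h + 7) ≤ A (l - 1) := hA.mono (by have := hA.h_pos; omega)
    have h3 : (1024 : ℝ) ≤ A (h + 7) := by push_cast at h1; linarith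
    exact le_trans (by exact_mod_cast h3) h2
  have hm1 : (A (l - 1) : ℝ) / 8 ≤ m := by
    have h1 : (A (l - 1) : ℝ) ≤ 8 * ((A (l - 1) / 8 + 1 : ℕ) : ℝ) := by
      exact_mod_cast (by omega : A (l - 1) ≤ 8 * (A (l - 1) / 8 + 1))
    have h2 : ((A (l - 1) / 8 + 1 : ℕ) : ℝ) ≤ m := by exact_mod_cast le_max_left _ _
    linarith
  refine (measure_mono hsub).trans ((measure_union_le _ _).trans (add_le_add
    ((measure_union_le _ _).trans (add_le_add
      ((measure_union_le _ _).trans (add_le_add ?_ ?_)) ?_)) ?_))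
  · exact hW.prob_exists_not_typical hA hδ hs hexp hsξ _ x
  · exact hW.prob_not_longPhases hA hδ hx
  · exact hW.prob_exists_confFail_le hμ.nonneg hα hK hNK hA.q_pos (hA.pos h) hl hm1
      (le_max_right _ _)
  · exact hW.prob_not_informed_le hC v n

end Settling

/-! ### Summation over blocks of slots -/

section Blocks

/-- A sum of terms that are at most `1` and, after the slot `b (L + j)`, at most `g j`. -/
lemma sum_le_of_blocks {b : ℕ → ℕ} (hb : Monotone b) (hb' : ∀ n, n ≤ b n) {f g : ℕ → ℝ≥0∞}
    (hf : ∀ t, f t ≤ 1) {L : ℕ} (hg : ∀ j t, b (L + j) ≤ t → f t ≤ g j) (T : ℕ) :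
    ∑ t ∈ Finset.range T, f t ≤
      b L + ∑' j : ℕ, ((b (L + j + 1) - b (L + j) : ℕ) : ℝ≥0∞) * g j := by
  have key : ∀ n, ∑ t ∈ Finset.range (b (L + n)), f t ≤
      b L + ∑ j ∈ Finset.range n, ((b (L + j + 1) - b (L + j) : ℕ) : ℝ≥0∞) * g j := by
    intro n
    induction n with
    | zero =>
      rw [Finset.sum_range_zero, add_zero, add_zero]
      refine (Finset.sum_le_sum fun t _ => hf t).trans ?_
      simp
    | succ n ih =>
      have hle : b (L + n) ≤ b (L + n + 1) := hb (Nat.le_succ _)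
      have e : b (L + (n + 1)) = b (L + n) + (b (L + n + 1) - b (L + n)) := by
        rw [← add_assoc]; omega
      rw [e, Finset.sum_range_add, Finset.sum_range_succ, ← add_assoc]
      refine add_le_add ih ?_
      refine (Finset.sum_le_sum fun t _ => hg n (b (L + n) + t) (Nat.le_add_right _ _)).trans ?_
      simp
  calc ∑ t ∈ Finset.range T, f t ≤ ∑ t ∈ Finset.range (b (L + T)), f t :=
        Finset.sum_le_sum_of_subset (Finset.range_mono
          ((Nat.le_add_left T L).trans (hb' (L + T))))
    _ ≤ _ := (key T).trans (add_le_add le_rfl (ENNReal.sum_le_tsum _))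

/-- Grouping of blocks into larger blocks. -/
lemma tsum_group_le {b : ℕ → ℕ} (hb : Monotone b) (L : ℕ) {d : ℕ} (hd : 0 < d) (G : ℕ → ℝ≥0∞) :
    ∑' j : ℕ, ((b (L + j + 1) - b (L + j) : ℕ) : ℝ≥0∞) * G (j / d) ≤
      ∑' y : ℕ, ((b (L + d * (y + 1)) - b (L + d * y) : ℕ) : ℝ≥0∞) * G y := by
  have tele : ∀ s r, ∑ j ∈ Finset.range r, (b (s + j + 1) - b (s + j)) = b (s + r) - b s := by
    intro s r
    have := Finset.sum_range_tsub (f := fun j => b (s + j)) (fun i j hij =>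
      hb (Nat.add_le_add_left hij s)) r
    simpa [add_assoc] using this
  have key : ∀ n, ∑ j ∈ Finset.range (d * n),
      ((b (L + j + 1) - b (L + j) : ℕ) : ℝ≥0∞) * G (j / d) =
      ∑ y ∈ Finset.range n, ((b (L + d * (y + 1)) - b (L + d * y) : ℕ) : ℝ≥0∞) * G y := by
    intro n
    induction n with
    | zero => simp
    | succ n ih =>
      rw [Nat.mul_succ, Finset.sum_range_add, ih, Finset.sum_range_succ]
      congr 1
      have h1 : ∀ r ∈ Finset.range d,
          ((b (L + (d * n + r) + 1) - b (L + (d * n + r)) : ℕ) : ℝ≥0∞) * G ((d * n + r) / d) =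
          ((b (L + d * n + r + 1) - b (L + d * n + r) : ℕ) : ℝ≥0∞) * G n := by
        intro r hr
        have : (d * n + r) / d = n := by
          rw [Nat.mul_add_div hd, Nat.div_eq_of_lt (Finset.mem_range.1 hr), add_zero]
        rw [this, ← add_assoc L]
      rw [Finset.sum_congr rfl h1, ← Finset.sum_mul, ← Nat.cast_sum, tele, Nat.mul_succ, add_assoc]
  refine ENNReal.tsum_le_of_sum_range_le fun n => ?_
  calc _ ≤ ∑ j ∈ Finset.range (d * n), ((b (L + j + 1) - b (L + j) : ℕ) : ℝ≥0∞) * G (j / d) :=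
        Finset.sum_le_sum_of_subset (Finset.range_mono (Nat.le_mul_of_pos_left n hd))
    _ ≤ _ := by
        rw [key]
        exact ENNReal.sum_le_tsum _

/-- Exchange of the order of summation over `y ≤ m = y + z`. -/
lemma tsum_mul_tsum_shift_le (a E : ℕ → ℝ≥0∞) :
    ∑' y : ℕ, a y * ∑' z : ℕ, E (y + z) ≤
      ∑' m : ℕ, (∑ y ∈ Finset.range (m + 1), a y) * E m := by
  have h1 : ∀ y, ∑' z : ℕ, E (y + z) ≤ ∑' m : ℕ, if y ≤ m then E m else 0 := by
    intro y
    calc ∑' z : ℕ, E (y + z) = ∑' z : ℕ, (fun m => if y ≤ m then E m else 0) (y + z) := by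
          simp
      _ ≤ _ := ENNReal.tsum_comp_le_tsum_of_injective (add_right_injective y) _
  calc ∑' y : ℕ, a y * ∑' z : ℕ, E (y + z)
      ≤ ∑' y : ℕ, ∑' m : ℕ, a y * (if y ≤ m then E m else 0) := by
        refine ENNReal.tsum_le_tsum fun y => ?_
        rw [ENNReal.tsum_mul_left]
        exact mul_le_mul' le_rfl (h1 y)
    _ = ∑' m : ℕ, ∑' y : ℕ, a y * (if y ≤ m then E m else 0) := ENNReal.tsum_comm
    _ = _ := by
        refine tsum_congr fun m => ?_
        rw [tsum_eq_sum (s := Finset.range (m + 1)), Finset.sum_mul]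
        · refine Finset.sum_congr rfl fun y hy => ?_
          rw [if_pos (Nat.lt_succ_iff.1 (Finset.mem_range.1 hy))]
        · intro y hy
          rw [if_neg, mul_zero]
          rw [Finset.mem_range] at hy
          omega

end Blocks

section Spreading

variable {N : ℕ} [NeZero N]

lemma informed_mono (c : ℕ → Fin N → Fin N) : Monotone (informed c) :=
  monotone_nat_of_le_succ fun _ => Finset.subset_union_left

lemma le_spreadTime {c : ℕ → Fin N → Fin N} {m : ℕ} (h : informed c m ≠ Finset.univ) :
    ((m + 1 : ℕ) : ℕ∞) ≤ spreadTime c := by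
  refine le_iInf₂ fun n hn => ?_
  have hn' : informed c n = Finset.univ := hn
  norm_cast
  by_contra hc
  apply h
  have := informed_mono c (show n ≤ m by omega)
  rw [hn'] at this
  exact Finset.univ_subset_iff.1 this

lemma measurableSet_informed {Ω' : Type*} [MeasurableSpace Ω'] {C : ℕ → Fin N → Ω' → Fin N}
    (hC : ∀ n j, Measurable (C n j)) (n : ℕ) :
    MeasurableSet {ω | informed (fun k j => C k j ω) n ≠ Finset.univ} := by
  have h1 : ∀ j, MeasurableSet {ω | j ∈ informed (fun k j => C k j ω) n} := by
    induction n with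
    | zero => intro j; simp only [informed]; exact MeasurableSet.const _
    | succ n ih =>
      intro j
      have e : {ω | j ∈ informed (fun k j => C k j ω) (n + 1)} =
          {ω | j ∈ informed (fun k j => C k j ω) n} ∪
          ⋃ m, ({ω | C n j ω = m} ∩ {ω | m ∈ informed (fun k j => C k j ω) n}) := by
        ext ω
        simp [informed]
      rw [e]
      exact (ih j).union (MeasurableSet.iUnion fun m =>
        (hC n j (measurableSet_singleton m)).inter (ih m))
  have e : {ω | informed (fun k j => C k j ω) n ≠ Finset.univ} =
      (⋂ j, {ω | j ∈ informed (fun k j => C k j ω) n})ᶜ := by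
    ext ω
    simp [Finset.eq_univ_iff_forall]
  rw [e]
  exact (MeasurableSet.iInter h1).compl

/-- The blocks of slots during which a rumor with rounds of length `2 F` is still spreading. -/
lemma tsum_spread_le {A : ℕ → ℕ} (hA : Monotone A) {κ F : ℕ} (hκ : 0 < κ) (hF : 0 < F) (L : ℕ)
    {Ω' : Type*} [MeasurableSpace Ω'] {Pr' : Measure Ω'} {C : ℕ → Fin N → Ω' → Fin N}
    (hC : ∀ n j, Measurable (C n j)) :
    ∑' j : ℕ, ((κ * A (2 * (L + j + 1)) - κ * A (2 * (L + j)) : ℕ) : ℝ≥0∞) *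
      Pr' {ω | informed (fun k j => C k j ω) ((L + j) / F) ≠ Finset.univ} ≤
      κ * ∫⁻ ω, seqAt A (2 * F) (spreadTime fun n j => C n j ω) ∂Pr' := by
  classical
  set b : ℕ → ℕ := fun l => κ * A (2 * l) with hb
  have hbmono : Monotone b := fun l l' h => Nat.mul_le_mul_left _ (hA (by omega))
  set S : ℕ → Set Ω' := fun j =>
    {ω | informed (fun k j => C k j ω) ((L + j) / F) ≠ Finset.univ} with hS
  have hSm : ∀ j, MeasurableSet (S j) := fun j => measurableSet_informed hC _
  have e1 : ∀ j : ℕ, ((b (L + j + 1) - b (L + j) : ℕ) : ℝ≥0∞) * Pr' (S j) =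
      ∫⁻ ω, (S j).indicator (fun _ => ((b (L + j + 1) - b (L + j) : ℕ) : ℝ≥0∞)) ω ∂Pr' :=
    fun j => (lintegral_indicator_const (hSm j) _).symm
  calc ∑' j : ℕ, ((b (L + j + 1) - b (L + j) : ℕ) : ℝ≥0∞) * Pr' (S j)
      = ∫⁻ ω, ∑' j : ℕ,
          (S j).indicator (fun _ => ((b (L + j + 1) - b (L + j) : ℕ) : ℝ≥0∞)) ω ∂Pr' := by
        rw [lintegral_tsum fun j => (measurable_const.indicator (hSm j)).aemeasurable]
        exact tsum_congr e1
    _ ≤ ∫⁻ ω, κ * seqAt A (2 * F) (spreadTime fun n j => C n j ω) ∂Pr' := by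
        refine lintegral_mono fun ω => ?_
        rcases hτ : spreadTime (fun n j => C n j ω) with _ | n
        · change _ ≤ (κ : ℝ≥0∞) * ⊤
          rw [ENNReal.mul_top (by exact_mod_cast hκ.ne')]
          exact le_top
        · change _ ≤ (κ : ℝ≥0∞) * (A (2 * F * n) : ℝ≥0∞)
          have hlt : ∀ j, ω ∈ S j → L + j + 1 ≤ F * n := by
            intro j hj
            have h1 := le_spreadTime hj
            rw [hτ] at h1
            have h1' : (((L + j) / F + 1 : ℕ) : ℕ∞) ≤ ((n : ℕ) : ℕ∞) := h1
            have h2 : (L + j) / F + 1 ≤ n := by exact_mod_cast h1'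
            have h3 := (Nat.div_lt_iff_lt_mul hF).1 (Nat.lt_of_succ_le h2)
            rw [mul_comm] at h3
            exact h3
          refine ENNReal.tsum_le_of_sum_range_le fun M => ?_
          -- the blocks that count are adjacent and end before `b (F * n)`
          have key : ∑ j ∈ Finset.range M,
              (S j).indicator (fun _ => ((b (L + j + 1) - b (L + j) : ℕ) : ℝ≥0∞)) ω ≤
              (b (min (L + M) (F * n)) : ℝ≥0∞) := by
            induction M with
            | zero => simp
            | succ M ih =>
              rw [Finset.sum_range_succ]
              by_cases hM : ω ∈ S M
              · rw [Set.indicator_of_mem hM]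
                have h1 := hlt M hM
                rw [min_eq_left (by omega)] at ih ⊢
                refine (add_le_add ih le_rfl).trans (le_of_eq ?_)
                rw [← Nat.cast_add, ← add_assoc L M 1]
                congr 1
                have := hbmono (Nat.le_succ (L + M))
                simp only [Nat.succ_eq_add_one] at this
                omega
              · rw [Set.indicator_of_notMem hM, add_zero]
                refine ih.trans ?_
                exact_mod_cast hbmono (min_le_min_right _ (by omega))
          refine key.trans ?_
          have h1 : b (min (L + M) (F * n)) ≤ b (F * n) := hbmono (min_le_right _ _)
          have h2 : b (F * n) = κ * A (2 * F * n) := by simp only [hb]; rw [mul_assoc 2 F n]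
          rw [h2] at h1
          exact_mod_cast h1
    _ = _ := lintegral_const_mul' _ _ (ENNReal.natCast_ne_top _)

end Spreading

section Lens

variable {A : ℕ → ℕ} {q h : ℕ} {c : ℝ}

/-- The total cost of the atypical phase lengths. -/
lemma tsum_lens_le (hA : IsBudget A q h c) {κ D N : ℕ} (e : ℕ → ℝ≥0∞) :
    ∑' y : ℕ, ((κ * A (4 * D * (h + y + 1)) - κ * A (4 * D * (h + y)) : ℕ) : ℝ≥0∞) *
        (N * ((8 * D * (h + y + 1) + 3 : ℕ) * e (h + y + 1)) +
          ∑' z : ℕ, N * e (h + y + 1 + z)) ≤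
      ∑' y : ℕ, ((4 * κ * N * A (4 * D * (h + y + 1)) ^ 2 : ℕ) : ℝ≥0∞) * e (h + y + 1) := by
  set b : ℕ → ℕ := fun y => κ * A (4 * D * (h + y)) with hb
  have hbmono : Monotone b := fun y y' hy =>
    Nat.mul_le_mul_left _ (hA.mono (Nat.mul_le_mul_left _ (by omega)))
  have tele : ∀ m, ∑ y ∈ Finset.range m, (b (y + 1) - b y) ≤ b m := fun m => by
    rw [Finset.sum_range_tsub hbmono]
    exact Nat.sub_le _ _
  have h1 : ∀ y : ℕ, ((b (y + 1) - b y : ℕ) : ℝ≥0∞) *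
      (N * ((8 * D * (h + y + 1) + 3 : ℕ) * e (h + y + 1))) ≤
      ((3 * κ * N * A (4 * D * (h + y + 1)) ^ 2 : ℕ) : ℝ≥0∞) * e (h + y + 1) := by
    intro y
    have h2 : 8 * D * (h + y + 1) + 3 ≤ 3 * A (4 * D * (h + y + 1)) := by
      have := hA.succ_le (4 * D * (h + y + 1))
      have e1 : 8 * D * (h + y + 1) = 2 * (4 * D * (h + y + 1)) := by ring
      omega
    have h3 : (b (y + 1) - b y) * N * (8 * D * (h + y + 1) + 3) ≤
        3 * κ * N * A (4 * D * (h + y + 1)) ^ 2 := by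
      calc (b (y + 1) - b y) * N * (8 * D * (h + y + 1) + 3)
          ≤ (κ * A (4 * D * (h + y + 1))) * N * (3 * A (4 * D * (h + y + 1))) := by
            gcongr
            exact Nat.sub_le _ _
        _ = _ := by ring
    rw [← mul_assoc, ← mul_assoc]
    gcongr
    exact_mod_cast h3
  have h2 : ∑' y : ℕ, ((b (y + 1) - b y : ℕ) : ℝ≥0∞) * ∑' z : ℕ, N * e (h + y + 1 + z) ≤
      ∑' y : ℕ, ((κ * N * A (4 * D * (h + y + 1)) ^ 2 : ℕ) : ℝ≥0∞) * e (h + y + 1) := by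
    have h3 := tsum_mul_tsum_shift_le (fun y => ((b (y + 1) - b y : ℕ) : ℝ≥0∞))
      (fun y => N * e (h + y + 1))
    have e1 : ∀ y z, h + (y + z) + 1 = h + y + 1 + z := fun y z => by ring
    simp only [e1] at h3
    refine h3.trans (ENNReal.tsum_le_tsum fun m => ?_)
    rw [← mul_assoc]
    gcongr
    have h4 := tele (m + 1)
    have h5 : b (m + 1) * N ≤ κ * N * A (4 * D * (h + m + 1)) ^ 2 := by
      have h6 := hA.pos (4 * D * (h + m + 1))
      calc b (m + 1) * N = κ * N * A (4 * D * (h + m + 1)) := by simp only [hb]; ring_nf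
        _ ≤ _ := Nat.mul_le_mul_left _ (Nat.le_self_pow (by norm_num) _)
    exact_mod_cast (Nat.mul_le_mul_right N h4).trans h5
  calc _ = ∑' y : ℕ, (((b (y + 1) - b y : ℕ) : ℝ≥0∞) *
        (N * ((8 * D * (h + y + 1) + 3 : ℕ) * e (h + y + 1))) +
        ((b (y + 1) - b y : ℕ) : ℝ≥0∞) * ∑' z : ℕ, N * e (h + y + 1 + z)) :=
        tsum_congr fun y => mul_add _ _ _
    _ ≤ ∑' y : ℕ, ((3 * κ * N * A (4 * D * (h + y + 1)) ^ 2 : ℕ) : ℝ≥0∞) * e (h + y + 1) +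
        ∑' y : ℕ, ((κ * N * A (4 * D * (h + y + 1)) ^ 2 : ℕ) : ℝ≥0∞) * e (h + y + 1) := by
        rw [ENNReal.tsum_add]
        exact add_le_add (ENNReal.tsum_le_tsum h1) h2
    _ = _ := by
        rw [← ENNReal.tsum_add]
        refine tsum_congr fun y => ?_
        rw [← add_mul, ← Nat.cast_add]
        congr 2
        ring

end Lens

/-! ### The bound of the expected regret -/

section Final

/-- The cost of the atypical phase lengths is at most the last sum in `gOne`: there, the factor
`A ^ (2 * (2 * α - 6))` dominates the number of agents. -/
lemma tsum_lens_le_gOne {A : ℕ → ℕ} {q h : ℕ} {c : ℝ} (hA : IsBudget A q h c) {α δ : ℝ}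
    (hα : 3 < α) (hδ : 0 ≤ δ) {κ N : ℕ} (hκ : (κ : ℝ) ≤ 1 + δ)
    (hN : (N : ℝ) ≤ (A h : ℝ) ^ (2 * α - 6)) :
    ∑' y : ℕ, ((4 * κ * N * A (4 * ⌈2 + δ⌉₊ * (h + y + 1)) ^ 2 : ℕ) : ℝ≥0∞) *
        ENNReal.ofReal (Real.exp (-(cBar (δ / 2) * incr A (h + y + 1 + 1)))) ≤
      ENNReal.ofReal (2 * (1 + δ)) *
        (2 * ∑' x : {x : ℕ // ⌈((2 * h : ℕ) : ℝ) / 2⌉₊ ≤ x},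
          ENNReal.ofReal ((A (4 * ⌈2 + δ⌉₊ * x) : ℝ) ^ (2 * (2 * α - 6) + 2) *
            Real.exp (-cDelta δ * incr A (x + 1)))) := by
  have hh : ⌈((2 * h : ℕ) : ℝ) / 2⌉₊ = h := by
    have : ((2 * h : ℕ) : ℝ) / 2 = (h : ℝ) := by push_cast; ring
    rw [this, Nat.ceil_natCast]
  rw [hh, ← mul_assoc, ← ENNReal.tsum_mul_left]
  set G : {x : ℕ // h ≤ x} → ℝ≥0∞ := fun x => ENNReal.ofReal (2 * (1 + δ)) * 2 *
    ENNReal.ofReal ((A (4 * ⌈2 + δ⌉₊ * x) : ℝ) ^ (2 * (2 * α - 6) + 2) *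
            Real.exp (-cDelta δ * incr A (x + 1))) with hG
  have hinj : Function.Injective fun y : ℕ => (⟨h + y + 1, by omega⟩ : {x : ℕ // h ≤ x}) := by
    intro y y' hy
    have := congrArg Subtype.val hy
    simp only at this
    omega
  refine le_trans (ENNReal.tsum_le_tsum fun y => ?_)
    (ENNReal.tsum_comp_le_tsum_of_injective hinj G)
  simp only [hG]
  set x := h + y + 1 with hx
  set a := A (4 * ⌈2 + δ⌉₊ * x) with ha
  have hc : cDelta δ ≤ cBar (δ / 2) := by
    have := cDelta_le_cBar (u := δ / 2) (by linarith)
    rwa [show 2 * (δ / 2) = δ by ring] at this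
  have hexp : Real.exp (-(cBar (δ / 2) * incr A (x + 1))) ≤
      Real.exp (-cDelta δ * incr A (x + 1)) := by
    rw [Real.exp_le_exp, neg_mul, neg_le_neg_iff]
    exact mul_le_mul_of_nonneg_right hc (hA.incr_nonneg _)
  have haA : (A h : ℝ) ≤ a := by
    have hD : 0 < ⌈2 + δ⌉₊ := Nat.ceil_pos.2 (by linarith)
    have : h ≤ 4 * ⌈2 + δ⌉₊ * x := by
      have : x ≤ 4 * ⌈2 + δ⌉₊ * x := Nat.le_mul_of_pos_left x (by omega)
      omega
    exact_mod_cast hA.mono this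
  have hA1 := hA.one_le h
  have ha0 : (0 : ℝ) < a := by linarith
  have hNa : (N : ℝ) * (a : ℝ) ^ 2 ≤ (a : ℝ) ^ (2 * (2 * α - 6) + 2) := by
    have h1 : (1 : ℝ) ≤ (a : ℝ) ^ (2 * α - 6) :=
      Real.one_le_rpow (by linarith) (by linarith)
    have h2 : (N : ℝ) ≤ (a : ℝ) ^ (2 * α - 6) :=
      hN.trans (Real.rpow_le_rpow (by linarith) haA (by linarith))
    have h3 : (a : ℝ) ^ (2 * (2 * α - 6) + 2) =
        (a : ℝ) ^ (2 * α - 6) * (a : ℝ) ^ (2 * α - 6) * (a : ℝ) ^ 2 := by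
      rw [← Real.rpow_add ha0, ← Real.rpow_natCast, ← Real.rpow_add ha0]
      congr 1
      push_cast
      ring
    rw [h3]
    gcongr
    nlinarith
  have h2 : (2 : ℝ≥0∞) = ENNReal.ofReal 2 := by simp
  rw [h2, ← ENNReal.ofReal_mul (by linarith), ← ENNReal.ofReal_mul (by linarith),
    ← ENNReal.ofReal_natCast, ← ENNReal.ofReal_mul (Nat.cast_nonneg _)]
  refine ENNReal.ofReal_le_ofReal ?_
  push_cast
  calc 4 * (κ : ℝ) * N * (a : ℝ) ^ 2 * Real.exp (-(cBar (δ / 2) * incr A (x + 1)))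
      = 4 * (κ : ℝ) * (N * (a : ℝ) ^ 2) * Real.exp (-(cBar (δ / 2) * incr A (x + 1))) := by ring
    _ ≤ 4 * (1 + δ) * (a : ℝ) ^ (2 * (2 * α - 6) + 2) *
        Real.exp (-cDelta δ * incr A (x + 1)) := by gcongr
    _ = _ := by ring

/-- The cost of the late failures of the confidence bounds is at most the second sum in `gOne`. -/
lemma tsum_conf_le_gOne (A : ℕ → ℕ) {α δ : ℝ} (hα : 3 < α) (hδ : 0 ≤ δ) {κ L : ℕ}
    (hκ : (κ : ℝ) ≤ 1 + δ) (hL : 2 ≤ L) :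
    ∑' j : ℕ, ((κ * A (2 * (L + j + 1)) - κ * A (2 * (L + j)) : ℕ) : ℝ≥0∞) *
        ENNReal.ofReal (4 / (2 * α - 3) / (A (L + j) : ℝ) ^ 3) ≤
      ENNReal.ofReal (2 * (1 + δ)) * (ENNReal.ofReal (2 / (2 * α - 3)) *
        ∑' l : {l : ℕ // 3 ≤ l}, ENNReal.ofReal ((A (2 * l) : ℝ) / (A (l - 1) : ℝ) ^ 3)) := by
  rw [← mul_assoc, ← ENNReal.tsum_mul_left]
  set G : {l : ℕ // 3 ≤ l} → ℝ≥0∞ := fun l => ENNReal.ofReal (2 * (1 + δ)) *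
    ENNReal.ofReal (2 / (2 * α - 3)) *
    ENNReal.ofReal ((A (2 * l) : ℝ) / (A (l - 1) : ℝ) ^ 3) with hG
  have hinj : Function.Injective fun j : ℕ => (⟨L + j + 1, by omega⟩ : {l : ℕ // 3 ≤ l}) := by
    intro y y' hy
    have := congrArg Subtype.val hy
    simp only at this
    omega
  refine le_trans (ENNReal.tsum_le_tsum fun j => ?_)
    (ENNReal.tsum_comp_le_tsum_of_injective hinj G)
  simp only [hG, Nat.add_sub_cancel]
  have hα' : 0 < 2 * α - 3 := by linarith
  have h1 : ((κ * A (2 * (L + j + 1)) - κ * A (2 * (L + j)) : ℕ) : ℝ≥0∞) ≤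
      ENNReal.ofReal ((1 + δ) * A (2 * (L + j + 1))) := by
    rw [← ENNReal.ofReal_natCast]
    refine ENNReal.ofReal_le_ofReal ?_
    calc ((κ * A (2 * (L + j + 1)) - κ * A (2 * (L + j)) : ℕ) : ℝ)
        ≤ ((κ * A (2 * (L + j + 1)) : ℕ) : ℝ) := by exact_mod_cast Nat.sub_le _ _
      _ ≤ _ := by push_cast; gcongr
  refine (mul_le_mul' h1 le_rfl).trans (le_of_eq ?_)
  rw [← ENNReal.ofReal_mul (by positivity), ← ENNReal.ofReal_mul (by linarith),
    ← ENNReal.ofReal_mul (by positivity)]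
  congr 1
  ring

variable {N K : ℕ} [NeZero N] [NeZero K] {α : ℝ} {tie : TieBreaking N K}
variable {Ω : Type*} [MeasurableSpace Ω] {Pr : Measure Ω} [IsProbabilityMeasure Pr]
variable {μ : Fin K → ℝ} {P : Matrix (Fin N) (Fin N) ℝ} {A : ℕ → ℕ} {δ : ℝ}
  {W : Ω → Noise N K} {h : ℕ} {gap : ℝ}

/-- The expected number of slots before the playing set of an agent is frozen. -/
lemma IsPoissonNoise.sum_prob_not_settled_le (hμ : IsArmMeans μ)
    (hW : IsPoissonNoise Pr μ P A δ W) (hα : 3 < α) (hK : 2 ≤ K) (hgap : 0 < gap)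
    (hμgap : ∀ k, k ≠ 0 → gap ≤ μ 0 - μ k)
    (hA : IsBudget A (stickySize N K) h (4 * α / gap ^ 2))
    (hNK : (N : ℝ) * (K.choose 2 : ℝ) * ((stickySize N K : ℝ) + 1) ≤ (A h : ℝ) ^ (2 * α - 6))
    (hδ : 7 / 4 ≤ δ)
    {Ω' : Type*} [MeasurableSpace Ω'] {Pr' : Measure Ω'}
    {C : ℕ → Fin N → Ω' → Fin N} (hC : IsPullCalls Pr' P C) (i : Fin N) (T : ℕ) :
    ∑ t ∈ Finset.range T, Pr {ω | ¬ Settled α tie (W ω) i t} ≤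
      ENNReal.ofReal (1 + δ) * A (4 * ⌈2 + δ⌉₊ * h) +
      (ENNReal.ofReal (2 * (1 + δ)) *
          (2 * ∑' x : {x : ℕ // ⌈((2 * h : ℕ) : ℝ) / 2⌉₊ ≤ x},
            ENNReal.ofReal ((A (4 * ⌈2 + δ⌉₊ * x) : ℝ) ^ (2 * (2 * α - 6) + 2) *
              Real.exp (-cDelta δ * incr A (x + 1)))) +
        ENNReal.ofReal (2 * (1 + δ)) * (ENNReal.ofReal (2 / (2 * α - 3)) *
          ∑' l : {l : ℕ // 3 ≤ l}, ENNReal.ofReal ((A (2 * l) : ℝ) / (A (l - 1) : ℝ) ^ 3)) +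
        ENNReal.ofReal (1 + δ) *
          ∫⁻ ω, seqAt A (2 * ⌊2 + δ⌋₊) (spreadTime fun n j => C n j ω) ∂Pr') := by
  set D := ⌈2 + δ⌉₊ with hD
  set F := ⌊2 + δ⌋₊ with hF
  -- a whole number between the mean phase length per unit of budget and `1 + δ`
  set κ := ⌈1 + δ / 2⌉₊ with hκdef
  have hD4 : 4 ≤ D := by
    have : ((3 : ℕ) : ℝ) < 2 + δ := by push_cast; linarith
    exact Nat.lt_ceil.2 this
  have hF3 : 3 ≤ F := Nat.le_floor (by push_cast; linarith)
  have hκ0 : 0 < κ := Nat.ceil_pos.2 (by linarith)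
  have hκ1 : (κ : ℝ) ≤ 1 + δ := by
    rcases le_total 2 δ with h2 | h2
    · have := Nat.ceil_lt_add_one (show (0 : ℝ) ≤ 1 + δ / 2 by linarith)
      rw [← hκdef] at this
      linarith
    · have : κ ≤ 2 := Nat.ceil_le.2 (by push_cast; linarith)
      have : (κ : ℝ) ≤ 2 := by exact_mod_cast this
      linarith
  have hκ2 : ENNReal.ofReal (κ : ℝ) ≤ ENNReal.ofReal (1 + δ) := ENNReal.ofReal_le_ofReal hκ1
  rw [ENNReal.ofReal_natCast] at hκ2
  have hκls : lamS (δ / 2) ≤ κ := (lamS_le (by linarith)).trans (Nat.le_ceil _)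
  set L := 2 * D * h with hL
  have hL2 : 2 ≤ L := by
    have : 2 * D * 1 ≤ 2 * D * h := Nat.mul_le_mul_left _ hA.h_pos
    omega
  set b : ℕ → ℕ := fun l => κ * A (2 * l) with hb
  have hbmono : Monotone b := fun l l' h => Nat.mul_le_mul_left _ (hA.mono (by omega))
  have hbge : ∀ n, n ≤ b n := fun n => by
    have h1 := hA.succ_le (2 * n)
    have h2 : A (2 * n) ≤ κ * A (2 * n) := Nat.le_mul_of_pos_left _ hκ0
    simp only [hb]
    omega
  set e : ℕ → ℝ≥0∞ := fun x => ENNReal.ofReal (Real.exp (-(cBar (δ / 2) * incr A (x + 1))))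
    with he
  set G₁ : ℕ → ℝ≥0∞ := fun y => N * ((8 * D * (h + y + 1) + 3 : ℕ) * e (h + y + 1)) +
    ∑' z : ℕ, N * e (h + y + 1 + z) with hG₁
  set G₂ : ℕ → ℝ≥0∞ := fun j => ENNReal.ofReal (4 / (2 * α - 3) / (A (L + j) : ℝ) ^ 3) with hG₂
  set G₃ : ℕ → ℝ≥0∞ := fun j =>
    Pr' {ω | informed (fun k j => C k j ω) ((L + j) / F) ≠ Finset.univ} with hG₃
  have hblock : ∀ j t, b (L + j) ≤ t →
      Pr {ω | ¬ Settled α tie (W ω) i t} ≤ G₁ (j / (2 * D)) + G₂ j + G₃ j := by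
    intro j t ht
    have hdm := Nat.div_add_mod j (2 * D)
    have hml := Nat.mod_lt j (show 0 < 2 * D by omega)
    have := hW.prob_not_settled_le (tie := tie) hμ hα hK hgap hμgap hA hNK hδ hC i
      (l := L + j + 1) (x := h + j / (2 * D) + 1) (t := t)
      (Nat.succ_le_succ (Nat.le_add_right _ _))
      (by
        rw [← hD, Nat.add_sub_cancel, mul_add]
        omega)
      (by
        rw [← hD, mul_add, mul_add]
        omega)
      (by
        rw [show 2 * (L + j + 1) - 2 = 2 * (L + j) by omega]
        calc lamS (δ / 2) * A (2 * (L + j)) ≤ κ * A (2 * (L + j)) := by gcongr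
          _ ≤ t := by exact_mod_cast ht)
    exact this
  refine (sum_le_of_blocks hbmono hbge (fun t => prob_le_one) hblock T).trans
    (add_le_add ?_ ?_)
  · have e1 : b L = κ * A (4 * D * h) := by simp only [hb, hL]; congr 2; ring
    rw [e1]
    push_cast
    gcongr
  · have hG : ∀ j, ((b (L + j + 1) - b (L + j) : ℕ) : ℝ≥0∞) * (G₁ (j / (2 * D)) + G₂ j + G₃ j) =
        ((b (L + j + 1) - b (L + j) : ℕ) : ℝ≥0∞) * G₁ (j / (2 * D)) +
        ((b (L + j + 1) - b (L + j) : ℕ) : ℝ≥0∞) * G₂ j +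
        ((b (L + j + 1) - b (L + j) : ℕ) : ℝ≥0∞) * G₃ j := fun j => by ring
    simp_rw [hG]
    rw [ENNReal.tsum_add, ENNReal.tsum_add]
    refine add_le_add (add_le_add ?_ ?_) ?_
    · refine (tsum_group_le hbmono L (show 0 < 2 * D by omega) G₁).trans ?_
      have hN1 : (N : ℝ) ≤ (A h : ℝ) ^ (2 * α - 6) := by
        refine le_trans ?_ hNK
        have h1 : (1 : ℝ) ≤ (K.choose 2 : ℝ) := by
          exact_mod_cast Nat.choose_pos hK
        have h2 : (1 : ℝ) ≤ (stickySize N K : ℝ) + 1 := by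
          linarith [Nat.cast_nonneg (α := ℝ) (stickySize N K)]
        have h3 : (0 : ℝ) ≤ N := Nat.cast_nonneg _
        calc (N : ℝ) = N * 1 * 1 := by ring
          _ ≤ _ := by gcongr
      refine le_trans ?_ (tsum_lens_le_gOne hA hα (by linarith) hκ1 hN1)
      refine le_trans (le_of_eq (tsum_congr fun y => ?_)) (tsum_lens_le hA (κ := κ) (D := D) e)
      have e1 : ∀ y, b (L + 2 * D * y) = κ * A (4 * D * (h + y)) := fun y => by
        simp only [hb, hL]; congr 2; ring
      rw [e1, e1, ← add_assoc h y 1]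
    · exact tsum_conf_le_gOne A hα (by linarith) hκ1 hL2
    · refine (tsum_spread_le hA.mono hκ0 (by omega) L hC.measurable).trans ?_
      gcongr

end Final

end GossipBandit

open GossipBandit in
theorem mainTheorem8 {N K : ℕ} [NeZero N] [NeZero K] (hN : 2 ≤ N) (hK : 2 ≤ K)
    (μ : Fin K → ℝ) (hμ : GossipBandit.IsArmMeans μ)
    (P : Matrix (Fin N) (Fin N) ℝ) (hP : GossipBandit.IsGossipMatrix P)
    (hA1 : GossipBandit.AssumptionA1 P)
    (B : ℕ → ℝ) (hB_nonneg : ∀ t, 0 ≤ B t) (hB_mono : Monotone B)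
    (ε : ℝ) (hε : 0 < ε)
    (hA2 : GossipBandit.AssumptionA2 B ε) (hA3 : GossipBandit.AssumptionA3 B ε)
    (α : ℝ) (hα : 3 < α)
    (δ : ℝ) (hδ : 0 < δ)
    (hδD : ∃ D : ℝ, 0 < D ∧ 5 / 4 * D ≤ GossipBandit.cDelta δ ∧
      5 / 4 * D⁻¹ ≤ GossipBandit.dDelta δ)
    (θ : ℝ) (hθ : 0 < θ) (x₀ : ℕ)
    (hx₀ : ∀ x, x₀ ≤ x →
      (GossipBandit.prevVal (GossipBandit.commSeq B ε) x : ℝ) ^ θ ≤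
        GossipBandit.incr (GossipBandit.commSeq B ε) x)
    {Ω : Type*} [MeasurableSpace Ω] (Pr : Measure Ω) [IsProbabilityMeasure Pr]
    (W : Ω → GossipBandit.Noise N K)
    (hW : GossipBandit.IsPoissonNoise Pr μ P (GossipBandit.commSeq B ε) δ W)
    (tie : GossipBandit.TieBreaking N K)
    {Ω' : Type*} [MeasurableSpace Ω'] (Pr' : Measure Ω') [IsProbabilityMeasure Pr']
    (C : ℕ → Fin N → Ω' → Fin N) (hC : GossipBandit.IsPullCalls Pr' P C)
    (i : Fin N) (T : ℕ) :
    ∫⁻ ω, ENNReal.ofReal (GossipBandit.regret α μ tie (W ω) i T) ∂Pr ≤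
      ENNReal.ofReal (GossipBandit.ucbTerm N α μ T)
        + ENNReal.ofReal (1 + δ) *
            ∫⁻ ω, GossipBandit.seqAt (GossipBandit.commSeq B ε) (2 * ⌊2 + δ⌋₊)
              (GossipBandit.spreadTime fun n j => C n j ω) ∂Pr'
        + GossipBandit.gOne α δ (GossipBandit.commSeq B ε)
            (GossipBandit.jStar N K α (μ 0 - μ ⟨1, hK⟩) (GossipBandit.commSeq B ε))
        + (N : ℝ≥0∞) * GossipBandit.gTwo N δ (GossipBandit.commSeq B ε) θ x₀ := by
  classical
  have hδ' := delta_lower hδ hδD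
  set A := commSeq B ε with hAdef
  set gap := μ 0 - μ ⟨1, hK⟩ with hgapdef
  have hgap : 0 < gap := by
    have := hμ.best ⟨1, hK⟩ (fun h => by simp [Fin.ext_iff] at h)
    rw [hgapdef]; linarith
  have hgap1 : gap ≤ 1 := by
    have h1 := hμ.nonneg ⟨1, hK⟩
    have h2 := hμ.lt_one
    rw [hgapdef]; linarith
  have hμgap : ∀ k, k ≠ 0 → gap ≤ μ 0 - μ k := by
    intro k hk
    have h1 : (⟨1, hK⟩ : Fin K) ≤ k := by
      rw [Fin.le_def]
      have : k.val ≠ 0 := fun h => hk (Fin.ext (by simpa using h))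
      simp only
      omega
    have := hμ.anti h1
    rw [hgapdef]; linarith
  obtain ⟨h, hh⟩ : ∃ h, jStar N K α gap A = 2 * h := ⟨_, rfl⟩
  obtain ⟨hA, hNK⟩ := isBudget_commSeq hε hB_nonneg hA2 hθ hx₀ (by omega : 0 < N)
    (by omega : 0 < K) hα hgap hgap1 hh
  rw [hh]
  set U := ∑ k : Fin K with 1 ≤ k.val ∧ k.val ≤ stickySize N K + 1, 1 / (μ 0 - μ k) with hU
  have hU0 : 0 ≤ U := Finset.sum_nonneg fun k _ => one_div_nonneg.2 (by
    linarith [hμ.anti (Fin.zero_le k)])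
  have hlogT : 0 ≤ Real.log T := Real.log_natCast_nonneg _
  -- the measurability of these events is not needed: a measurable superset has the same
  -- probability
  set S₁ : ℕ → Set Ω := fun t => toMeasurable Pr {ω | ¬ Settled α tie (W ω) i t} with hS₁
  set S₂ : ℕ → Set Ω := fun t => toMeasurable Pr {ω | ConfFail α μ (W ω) i (t + 1)} with hS₂
  have hpt : ∀ ω, ENNReal.ofReal (regret α μ tie (W ω) i T) ≤
      ∑ t ∈ Finset.range T, (S₁ t).indicator 1 ω + ∑ t ∈ Finset.range T, (S₂ t).indicator 1 ω +
        ((stickySize N K + 1 : ℕ) + ENNReal.ofReal (U * (4 * α * Real.log T))) := by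
    intro ω
    refine (ENNReal.ofReal_le_ofReal (regret_le hμ (by linarith) i T)).trans ?_
    refine ENNReal.ofReal_add_le.trans ?_
    rw [← add_assoc]
    refine add_le_add (ENNReal.ofReal_add_le.trans (add_le_add (ENNReal.ofReal_add_le.trans
      (add_le_add ?_ ?_)) ?_)) le_rfl
    · rw [ENNReal.ofReal_sum_of_nonneg (fun t _ => by split_ifs <;> norm_num)]
      refine Finset.sum_le_sum fun t _ => ?_
      by_cases hs : Settled α tie (W ω) i t
      · simp [hs]
      · rw [if_neg hs, Set.indicator_of_mem (subset_toMeasurable Pr _ hs)]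
        simp
    · rw [ENNReal.ofReal_sum_of_nonneg (fun t _ => by split_ifs <;> norm_num)]
      refine Finset.sum_le_sum fun t _ => ?_
      by_cases hs : ConfFail α μ (W ω) i (t + 1)
      · rw [if_pos hs, Set.indicator_of_mem (subset_toMeasurable Pr _ hs)]
        simp
      · simp [hs]
    · rw [ENNReal.ofReal_natCast]
  have hm₁ : ∀ t, Measurable ((S₁ t).indicator (1 : Ω → ℝ≥0∞)) := fun t =>
    measurable_one.indicator (measurableSet_toMeasurable _ _)
  have hm₂ : ∀ t, Measurable ((S₂ t).indicator (1 : Ω → ℝ≥0∞)) := fun t =>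
    measurable_one.indicator (measurableSet_toMeasurable _ _)
  have hint : ∫⁻ ω, ENNReal.ofReal (regret α μ tie (W ω) i T) ∂Pr ≤
      ∑ t ∈ Finset.range T, Pr {ω | ¬ Settled α tie (W ω) i t} +
      ∑ t ∈ Finset.range T, Pr {ω | ConfFail α μ (W ω) i (t + 1)} +
        ((stickySize N K + 1 : ℕ) + ENNReal.ofReal (U * (4 * α * Real.log T))) := by
    refine (lintegral_mono hpt).trans (le_of_eq ?_)
    rw [lintegral_add_right _ measurable_const, lintegral_const, measure_univ, mul_one,
      lintegral_add_right _ (Finset.measurable_sum _ fun t _ => hm₂ t),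
      lintegral_finsetSum _ fun t _ => hm₁ t, lintegral_finsetSum _ fun t _ => hm₂ t]
    simp only [hS₁, hS₂, lintegral_indicator_one (measurableSet_toMeasurable _ _),
      measure_toMeasurable]
  have hset := hW.sum_prob_not_settled_le (tie := tie) hμ hα hK hgap hμgap hA hNK hδ' hC i T
  have hconf := hW.sum_prob_confFail hμ.nonneg hα.le i T
  have hucb : ENNReal.ofReal (ucbTerm N α μ T) =
      ENNReal.ofReal (U * (4 * α * Real.log T)) + ENNReal.ofReal (K / 4) := by
    unfold ucbTerm
    rw [ENNReal.ofReal_add (by positivity) (by positivity)]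
  -- the slots before the first block, and the first pull of each suboptimal arm
  have hstart : ENNReal.ofReal (1 + δ) * A (4 * ⌈2 + δ⌉₊ * h) + (stickySize N K + 1 : ℕ) ≤
      ENNReal.ofReal (2 * (1 + δ)) * (A (2 * ⌈2 + δ⌉₊ * (2 * h)) : ℝ≥0∞) := by
    rw [show 2 * ⌈2 + δ⌉₊ * (2 * h) = 4 * ⌈2 + δ⌉₊ * h by ring]
    have h1 : ((stickySize N K + 1 : ℕ) : ℝ) ≤ A (4 * ⌈2 + δ⌉₊ * h) := by
      have h2 := hA.long h le_rfl
      have h3 := incr_le_self A h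
      have h4 : (A h : ℝ) ≤ A (4 * ⌈2 + δ⌉₊ * h) := by
        have hD : 0 < ⌈2 + δ⌉₊ := Nat.ceil_pos.2 (by linarith)
        exact_mod_cast hA.mono (Nat.le_mul_of_pos_left h (by omega))
      have h5 : 0 ≤ 4 * α / gap ^ 2 * Real.log (A h) :=
        mul_nonneg (by positivity) (Real.log_natCast_nonneg _)
      have h6 : (0 : ℝ) ≤ stickySize N K := Nat.cast_nonneg _
      push_cast
      nlinarith
    have h0 : (0 : ℝ) ≤ A (4 * ⌈2 + δ⌉₊ * h) := Nat.cast_nonneg _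
    rw [← ENNReal.ofReal_natCast, ← ENNReal.ofReal_natCast, ← ENNReal.ofReal_mul (by linarith),
      ← ENNReal.ofReal_mul (by linarith), ← ENNReal.ofReal_add (by positivity) (by positivity)]
    refine ENNReal.ofReal_le_ofReal ?_
    nlinarith
  -- the remaining terms already suffice without the nonnegative `N * gTwo`
  refine le_trans ?_ le_self_add
  refine hint.trans ((add_le_add (add_le_add hset hconf) le_rfl).trans ?_)
  rw [hucb]
  unfold gOne
  rw [mul_add (ENNReal.ofReal (2 * (1 + δ))), mul_add (ENNReal.ofReal (2 * (1 + δ)))]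
  calc _ = (ENNReal.ofReal (U * (4 * α * Real.log T)) + ENNReal.ofReal (K / 4)) +
        ENNReal.ofReal (1 + δ) *
          ∫⁻ ω, seqAt A (2 * ⌊2 + δ⌋₊) (spreadTime fun n j => C n j ω) ∂Pr' +
        ((ENNReal.ofReal (1 + δ) * A (4 * ⌈2 + δ⌉₊ * h) + (stickySize N K + 1 : ℕ)) +
          ENNReal.ofReal (2 * (1 + δ)) * (ENNReal.ofReal (2 / (2 * α - 3)) *
            ∑' l : {l : ℕ // 3 ≤ l}, ENNReal.ofReal ((A (2 * l) : ℝ) / (A (l - 1) : ℝ) ^ 3)) +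
          ENNReal.ofReal (2 * (1 + δ)) *
            (2 * ∑' x : {x : ℕ // ⌈((2 * h : ℕ) : ℝ) / 2⌉₊ ≤ x},
              ENNReal.ofReal ((A (4 * ⌈2 + δ⌉₊ * x) : ℝ) ^ (2 * (2 * α - 6) + 2) *
                Real.exp (-cDelta δ * incr A (x + 1))))) := by ring
    _ ≤ _ := by gcongr
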